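/- Let $R$ be a commutative ring with unity, and let $C$ and $D$ be (coassociative, counital) $R$-coalgebras which are flat as $R$-modules. Let $\mathcal M^C$ (resp. ${}^C\mathcal M$) denote the $R$-linear category of right (resp. left) $C$-comodules, and let $M\,\square_C N\subseteq M\otimes_R N$ denote the cotensor product, i.e. the kernel of $\varrho_M\otimes \mathrm{id}-\mathrm{id}\otimes\varrho_N$. A right $D$-comodule $X$ is called - *quasi-finite* if the functor $-\otimes_R X: R\text{-Mod}\to\mathcal M^D$ has a left adjoint, which is then denoted $h_D(X,-)$; - *faithfully coflat* if the functor $X\,\square_D -:{}^D\mathcal M\to R\text{-Mod}$ is exact and faithful; - an *injector* if the functor $-\otimes_R X: R\text{-Mod}\to\mathcal M^D$ preserves injective objects. If $X$ is quasi-finite with unit of adjunction $\eta: X\to h_D(X,X)\otimes X$, its *coendomorphism coalgebra* is $e_D(X)=h_D(X,X)$, whose comultiplication $\Delta$ and counit $\varepsilon$ are the $R$-linear maps determined by $(\Delta\otimes\mathrm{id})\eta=(\mathrm{id}\otimes\eta)\eta$ and $(\varepsilon\otimes\mathrm{id})\eta=$ the canonical isomorphism $X\to R\otimes X$. The notions for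 left comodules are defined symmetrically. Equivalences between comodule categories are understood to be $R$-linear. Then the following are equivalent: 1. $\mathcal M^C$ and $\mathcal M^D$ are equivalent ($C$ and $D$ are Morita–Takeuchi equivalent). 2. ${}^C\mathcal M$ and ${}^D\mathcal M$ are equivalent. 3. There exists a $C$-$D$-bicomodule $X$ such that $X_D$ is quasi-finite, faithfully coflat and an injector, and $e_D(X)\cong C$ as coalgebras. 4. There exists a $C$-$D$-bicomodule $X$ such that ${}_CX$ is quasi-finite, faithfully coflat and an injector, and $e_C(X)\cong D$ as coalgebras. 5. There exists a $D$-$C$-bicomodule $Y$ such that $Y_C$ is quasi-finite, faithfully coflat and an injector, and $e_C(Y)\cong D$ as coalgebras. 6. There exists a $D$-$C$-bicomodule $Y$ such that ${}_DY$ is quasi-finite, faithfully coflat and an injector, and $e_D(Y)\cong C$ as coalgebras. -/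

import Mathlib

open CategoryTheory
open scoped TensorProduct

universe u

namespace MoritaTakeuchi

section Comodules

variable (R : Type u) [CommRing R] (C : Type u) [AddCommGroup C] [Module R C] [Coalgebra R C]

/-- Right `C`-comodules: an `R`-module `M` with a coassociative and counital `R`-linear coaction
`M → M ⊗ C`. -/
structure RightComodule where
  carrier : Type u
  [addCommGroup : AddCommGroup carrier]
  [module : Module R carrier]
  coact : carrier →ₗ[R] carrier ⊗[R] C
  coassoc : TensorProduct.assoc R carrier C C ∘ₗ coact.rTensor C ∘ₗ coact =
    (Coalgebra.comul (R := R) (A := C)).lTensor carrier ∘ₗ coact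
  counit : (Coalgebra.counit (R := R) (A := C)).lTensor carrier ∘ₗ coact =
    (TensorProduct.mk R carrier R).flip 1

/-- Left `C`-comodules: an `R`-module `M` with a coassociative and counital `R`-linear coaction
`M → C ⊗ M`. -/
structure LeftComodule where
  carrier : Type u
  [addCommGroup : AddCommGroup carrier]
  [module : Module R carrier]
  coact : carrier →ₗ[R] C ⊗[R] carrier
  coassoc : TensorProduct.assoc R C C carrier ∘ₗ
      (Coalgebra.comul (R := R) (A := C)).rTensor carrier ∘ₗ coact =
    coact.lTensor C ∘ₗ coact
  counit : (Coalgebra.counit (R := R) (A := C)).rTensor carrier ∘ₗ coact =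
    TensorProduct.mk R R carrier 1

attribute [instance] RightComodule.addCommGroup RightComodule.module
attribute [instance] LeftComodule.addCommGroup LeftComodule.module

end Comodules

/-- `C`-`D`-bicomodules: a left `C`-comodule and right `D`-comodule on the same `R`-module whose
two coactions commute, that is, the left coaction `X → C ⊗ X` is right `D`-colinear. -/
structure Bicomodule (R : Type u) [CommRing R]
    (C : Type u) [AddCommGroup C] [Module R C] [Coalgebra R C]
    (D : Type u) [AddCommGroup D] [Module R D] [Coalgebra R D] where
  carrier : Type u
  [addCommGroup : AddCommGroup carrier]
  [module : Module R carrier]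
  lcoact : carrier →ₗ[R] C ⊗[R] carrier
  lcoassoc : TensorProduct.assoc R C C carrier ∘ₗ
      (Coalgebra.comul (R := R) (A := C)).rTensor carrier ∘ₗ lcoact =
    lcoact.lTensor C ∘ₗ lcoact
  lcounit : (Coalgebra.counit (R := R) (A := C)).rTensor carrier ∘ₗ lcoact =
    TensorProduct.mk R R carrier 1
  rcoact : carrier →ₗ[R] carrier ⊗[R] D
  rcoassoc : TensorProduct.assoc R carrier D D ∘ₗ rcoact.rTensor D ∘ₗ rcoact =
    (Coalgebra.comul (R := R) (A := D)).lTensor carrier ∘ₗ rcoact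
  rcounit : (Coalgebra.counit (R := R) (A := D)).lTensor carrier ∘ₗ rcoact =
    (TensorProduct.mk R carrier R).flip 1
  bicolinear : TensorProduct.assoc R C carrier D ∘ₗ lcoact.rTensor D ∘ₗ rcoact =
    rcoact.lTensor C ∘ₗ lcoact

attribute [instance] Bicomodule.addCommGroup Bicomodule.module

variable {R : Type u} [CommRing R] {C : Type u} [AddCommGroup C] [Module R C] [Coalgebra R C]
  {D : Type u} [AddCommGroup D] [Module R D] [Coalgebra R D]

/-- The underlying right `D`-comodule of a `C`-`D`-bicomodule. -/
abbrev Bicomodule.right (X : Bicomodule R C D) : RightComodule R D where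
  carrier := X.carrier
  coact := X.rcoact
  coassoc := X.rcoassoc
  counit := X.rcounit

/-- The underlying left `C`-comodule of a `C`-`D`-bicomodule. -/
abbrev Bicomodule.left (X : Bicomodule R C D) : LeftComodule R C where
  carrier := X.carrier
  coact := X.lcoact
  coassoc := X.lcoassoc
  counit := X.lcounit

/-! ### The `R`-linear categories of right and of left comodules -/

namespace RightComodule

/-- Right colinear maps. -/
@[ext]
structure Hom (M N : RightComodule R C) where
  hom : M.carrier →ₗ[R] N.carrier
  colinear : N.coact ∘ₗ hom = hom.rTensor C ∘ₗ M.coact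

instance : Category (RightComodule R C) where
  Hom M N := Hom M N
  id M := ⟨LinearMap.id, by simp⟩
  comp f g := ⟨g.hom ∘ₗ f.hom, by
    rw [← LinearMap.comp_assoc, g.colinear, LinearMap.comp_assoc, f.colinear,
      ← LinearMap.comp_assoc, LinearMap.rTensor_comp]⟩

section

variable {M N P : RightComodule R C}

@[ext]
theorem hom_ext {f g : M ⟶ N} (h : f.hom = g.hom) : f = g := Hom.ext h

@[simp] theorem id_hom : (𝟙 M : M ⟶ M).hom = LinearMap.id := rfl

@[simp] theorem comp_hom (f : M ⟶ N) (g : N ⟶ P) : (f ≫ g).hom = g.hom ∘ₗ f.hom := rfl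

theorem colinear_apply (f : M ⟶ N) (x : M.carrier) :
    N.coact (f.hom x) = f.hom.rTensor C (M.coact x) :=
  LinearMap.congr_fun f.colinear x

instance : Zero (M ⟶ N) := ⟨⟨0, by simp⟩⟩

instance : Add (M ⟶ N) := ⟨fun f g => ⟨f.hom + g.hom, by
  rw [LinearMap.comp_add, f.colinear, g.colinear, LinearMap.rTensor_add, LinearMap.add_comp]⟩⟩

instance : Neg (M ⟶ N) := ⟨fun f => ⟨-f.hom, by
  rw [LinearMap.comp_neg, f.colinear, LinearMap.rTensor_neg, LinearMap.neg_comp]⟩⟩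

instance : SMul R (M ⟶ N) := ⟨fun r f => ⟨r • f.hom, by
  rw [LinearMap.comp_smul, f.colinear, LinearMap.rTensor_smul, LinearMap.smul_comp]⟩⟩

@[simp] theorem zero_hom : (0 : M ⟶ N).hom = 0 := rfl

@[simp] theorem add_hom (f g : M ⟶ N) : (f + g).hom = f.hom + g.hom := rfl

@[simp] theorem neg_hom (f : M ⟶ N) : (-f).hom = -f.hom := rfl

@[simp] theorem smul_hom (r : R) (f : M ⟶ N) : (r • f).hom = r • f.hom := rfl

instance : AddCommGroup (M ⟶ N) where
  add_assoc f g h := by ext; simp [add_assoc]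
  zero_add f := by ext; simp
  add_zero f := by ext; simp
  nsmul := nsmulRec
  zsmul := zsmulRec
  neg_add_cancel f := by ext; simp
  add_comm f g := by ext; simp [add_comm]

instance : Module R (M ⟶ N) where
  one_smul f := by ext; simp
  mul_smul r s f := by ext; simp [mul_smul]
  smul_zero r := by ext; simp
  smul_add r f g := by ext; simp
  add_smul r s f := by ext; simp [add_smul]
  zero_smul f := by ext; simp

end

instance : Preadditive (RightComodule R C) where
  add_comp _ _ _ f g h := by ext; simp
  comp_add _ _ _ f g h := by ext; simp

instance : Linear R (RightComodule R C) where
  smul_comp _ _ _ r f g := by ext; simp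
  comp_smul _ _ _ f r g := by ext; simp

end RightComodule

namespace LeftComodule

/-- Left colinear maps. -/
@[ext]
structure Hom (M N : LeftComodule R C) where
  hom : M.carrier →ₗ[R] N.carrier
  colinear : N.coact ∘ₗ hom = hom.lTensor C ∘ₗ M.coact

instance : Category (LeftComodule R C) where
  Hom M N := Hom M N
  id M := ⟨LinearMap.id, by simp⟩
  comp f g := ⟨g.hom ∘ₗ f.hom, by
    rw [← LinearMap.comp_assoc, g.colinear, LinearMap.comp_assoc, f.colinear,
      ← LinearMap.comp_assoc, LinearMap.lTensor_comp]⟩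

section

variable {M N P : LeftComodule R C}

@[ext]
theorem hom_ext {f g : M ⟶ N} (h : f.hom = g.hom) : f = g := Hom.ext h

@[simp] theorem id_hom : (𝟙 M : M ⟶ M).hom = LinearMap.id := rfl

@[simp] theorem comp_hom (f : M ⟶ N) (g : N ⟶ P) : (f ≫ g).hom = g.hom ∘ₗ f.hom := rfl

theorem colinear_apply (f : M ⟶ N) (x : M.carrier) :
    N.coact (f.hom x) = f.hom.lTensor C (M.coact x) :=
  LinearMap.congr_fun f.colinear x

instance : Zero (M ⟶ N) := ⟨⟨0, by simp⟩⟩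

instance : Add (M ⟶ N) := ⟨fun f g => ⟨f.hom + g.hom, by
  rw [LinearMap.comp_add, f.colinear, g.colinear, LinearMap.lTensor_add, LinearMap.add_comp]⟩⟩

instance : Neg (M ⟶ N) := ⟨fun f => ⟨-f.hom, by
  rw [LinearMap.comp_neg, f.colinear, LinearMap.lTensor_neg, LinearMap.neg_comp]⟩⟩

instance : SMul R (M ⟶ N) := ⟨fun r f => ⟨r • f.hom, by
  rw [LinearMap.comp_smul, f.colinear, LinearMap.lTensor_smul, LinearMap.smul_comp]⟩⟩

@[simp] theorem zero_hom : (0 : M ⟶ N).hom = 0 := rfl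

@[simp] theorem add_hom (f g : M ⟶ N) : (f + g).hom = f.hom + g.hom := rfl

@[simp] theorem neg_hom (f : M ⟶ N) : (-f).hom = -f.hom := rfl

@[simp] theorem smul_hom (r : R) (f : M ⟶ N) : (r • f).hom = r • f.hom := rfl

instance : AddCommGroup (M ⟶ N) where
  add_assoc f g h := by ext; simp [add_assoc]
  zero_add f := by ext; simp
  add_zero f := by ext; simp
  nsmul := nsmulRec
  zsmul := zsmulRec
  neg_add_cancel f := by ext; simp
  add_comm f g := by ext; simp [add_comm]

instance : Module R (M ⟶ N) where
  one_smul f := by ext; simp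
  mul_smul r s f := by ext; simp [mul_smul]
  smul_zero r := by ext; simp
  smul_add r f g := by ext; simp
  add_smul r s f := by ext; simp [add_smul]
  zero_smul f := by ext; simp

end

instance : Preadditive (LeftComodule R C) where
  add_comp _ _ _ f g h := by ext; simp
  comp_add _ _ _ f g h := by ext; simp

instance : Linear R (LeftComodule R C) where
  smul_comp _ _ _ r f g := by ext; simp
  comp_smul _ _ _ f r g := by ext; simp

end LeftComodule

/-- Two coalgebras have equivalent categories of right comodules: there is an `R`-linear
equivalence between them. -/
def RightComodule.Equivalent (R : Type u) [CommRing R]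
    (C : Type u) [AddCommGroup C] [Module R C] [Coalgebra R C]
    (D : Type u) [AddCommGroup D] [Module R D] [Coalgebra R D] : Prop :=
  ∃ F : RightComodule R C ⥤ RightComodule R D, F.IsEquivalence ∧ F.Additive ∧ F.Linear R

/-- Two coalgebras have equivalent categories of left comodules: there is an `R`-linear
equivalence between them. -/
def LeftComodule.Equivalent (R : Type u) [CommRing R]
    (C : Type u) [AddCommGroup C] [Module R C] [Coalgebra R C]
    (D : Type u) [AddCommGroup D] [Module R D] [Coalgebra R D] : Prop :=
  ∃ F : LeftComodule R C ⥤ LeftComodule R D, F.IsEquivalence ∧ F.Additive ∧ F.Linear R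

/-! ### The functors `- ⊗ X` and `X ⊗ -` from modules to comodules -/

namespace RightComodule

theorem coassoc_apply (X : RightComodule R C) (x : X.carrier) :
    TensorProduct.assoc R X.carrier C C (X.coact.rTensor C (X.coact x)) =
      (Coalgebra.comul (R := R) (A := C)).lTensor X.carrier (X.coact x) :=
  LinearMap.congr_fun X.coassoc x

theorem counit_apply (X : RightComodule R C) (x : X.carrier) :
    (Coalgebra.counit (R := R) (A := C)).lTensor X.carrier (X.coact x) = x ⊗ₜ 1 :=
  LinearMap.congr_fun X.counit x

/-- The right comodule `W ⊗ X`, with coaction `id ⊗ ρ_X`. -/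
abbrev tensor (X : RightComodule R C) (W : Type u) [AddCommGroup W] [Module R W] :
    RightComodule R C where
  carrier := W ⊗[R] X.carrier
  coact := (TensorProduct.assoc R W X.carrier C).symm.toLinearMap ∘ₗ X.coact.lTensor W
  coassoc := by
    ext w x
    have key : ∀ z : X.carrier ⊗[R] C,
        TensorProduct.assoc R (W ⊗[R] X.carrier) C C
          (((TensorProduct.assoc R W X.carrier C).symm.toLinearMap ∘ₗ
            X.coact.lTensor W).rTensor C ((TensorProduct.assoc R W X.carrier C).symm (w ⊗ₜ z))) =
        (TensorProduct.assoc R W X.carrier (C ⊗[R] C)).symm (w ⊗ₜ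
          TensorProduct.assoc R X.carrier C C (X.coact.rTensor C z)) := by
      intro z
      induction z with
      | zero => simp
      | add a b ha hb => simp only [TensorProduct.tmul_add, map_add, ha, hb]
      | tmul a c =>
        simp only [TensorProduct.assoc_symm_tmul, LinearMap.rTensor_tmul, LinearMap.comp_apply,
          LinearMap.lTensor_tmul, LinearEquiv.coe_coe]
        induction X.coact a with
        | zero => simp
        | add a b ha hb => simp only [TensorProduct.tmul_add, TensorProduct.add_tmul, map_add, ha, hb]
        | tmul a c => simp
    have key2 : ∀ z : X.carrier ⊗[R] C,
        (Coalgebra.comul (R := R) (A := C)).lTensor (W ⊗[R] X.carrier)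
          ((TensorProduct.assoc R W X.carrier C).symm (w ⊗ₜ z)) =
        (TensorProduct.assoc R W X.carrier (C ⊗[R] C)).symm (w ⊗ₜ
          (Coalgebra.comul (R := R) (A := C)).lTensor X.carrier z) := by
      intro z
      induction z with
      | zero => simp
      | add a b ha hb => simp only [TensorProduct.tmul_add, map_add, ha, hb]
      | tmul a c => simp
    have := key (X.coact x)
    rw [coassoc_apply, ← key2] at this
    exact this
  counit := by
    ext w x
    have key : ∀ z : X.carrier ⊗[R] C,
        (Coalgebra.counit (R := R) (A := C)).lTensor (W ⊗[R] X.carrier)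
          ((TensorProduct.assoc R W X.carrier C).symm (w ⊗ₜ z)) =
        (TensorProduct.assoc R W X.carrier R).symm (w ⊗ₜ
          (Coalgebra.counit (R := R) (A := C)).lTensor X.carrier z) := by
      intro z
      induction z with
      | zero => simp
      | add a b ha hb => simp only [TensorProduct.tmul_add, map_add, ha, hb]
      | tmul a c => simp
    have := key (X.coact x)
    rw [counit_apply] at this
    exact this

theorem tensor_colinear (X : RightComodule R C) {V W : Type u} [AddCommGroup V] [Module R V]
    [AddCommGroup W] [Module R W] (f : V →ₗ[R] W) :
    (X.tensor W).coact ∘ₗ f.rTensor X.carrier =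
      (f.rTensor X.carrier).rTensor C ∘ₗ (X.tensor V).coact := by
  ext v x
  have key : ∀ z : X.carrier ⊗[R] C,
      (TensorProduct.assoc R W X.carrier C).symm (f v ⊗ₜ z) =
      (f.rTensor X.carrier).rTensor C ((TensorProduct.assoc R V X.carrier C).symm (v ⊗ₜ z)) := by
    intro z
    induction z with
    | zero => simp
    | add a b ha hb => simp only [TensorProduct.tmul_add, map_add, ha, hb]
    | tmul a c => simp
  exact key (X.coact x)

/-- The functor `- ⊗ X` from `R`-modules to right comodules. -/
abbrev tensorFunctor (X : RightComodule R C) : ModuleCat.{u} R ⥤ RightComodule R C where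
  obj W := X.tensor W
  map f := ⟨f.hom.rTensor X.carrier, X.tensor_colinear f.hom⟩
  map_id W := by apply hom_ext; simp
  map_comp f g := by apply hom_ext; simp [LinearMap.rTensor_comp]

/-- `X` is quasi-finite: the functor `- ⊗ X` has a left adjoint. -/
abbrev IsQuasiFinite (X : RightComodule R C) : Prop := X.tensorFunctor.IsRightAdjoint

/-- `X` is an injector: the functor `- ⊗ X` preserves injective objects. -/
def IsInjector (X : RightComodule R C) : Prop := X.tensorFunctor.PreservesInjectiveObjects

end RightComodule

namespace LeftComodule

theorem coassoc_apply (X : LeftComodule R C) (x : X.carrier) :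
    TensorProduct.assoc R C C X.carrier
        ((Coalgebra.comul (R := R) (A := C)).rTensor X.carrier (X.coact x)) =
      X.coact.lTensor C (X.coact x) :=
  LinearMap.congr_fun X.coassoc x

theorem counit_apply (X : LeftComodule R C) (x : X.carrier) :
    (Coalgebra.counit (R := R) (A := C)).rTensor X.carrier (X.coact x) = 1 ⊗ₜ x :=
  LinearMap.congr_fun X.counit x

/-- The left comodule `X ⊗ W`, with coaction `ρ_X ⊗ id`. -/
abbrev tensor (X : LeftComodule R C) (W : Type u) [AddCommGroup W] [Module R W] :
    LeftComodule R C where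
  carrier := X.carrier ⊗[R] W
  coact := (TensorProduct.assoc R C X.carrier W).toLinearMap ∘ₗ X.coact.rTensor W
  coassoc := by
    ext x w
    have key : ∀ z : C ⊗[R] X.carrier,
        ((TensorProduct.assoc R C X.carrier W).toLinearMap ∘ₗ
            X.coact.rTensor W).lTensor C (TensorProduct.assoc R C X.carrier W (z ⊗ₜ w)) =
        (TensorProduct.assoc R C X.carrier W).toLinearMap.lTensor C
          (TensorProduct.assoc R C (C ⊗[R] X.carrier) W (X.coact.lTensor C z ⊗ₜ w)) := by
      intro z
      induction z with
      | zero => simp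
      | add a b ha hb => simp only [TensorProduct.add_tmul, map_add, ha, hb]
      | tmul a c => simp
    have key2 : ∀ z : C ⊗[R] X.carrier,
        TensorProduct.assoc R C C (X.carrier ⊗[R] W)
          ((Coalgebra.comul (R := R) (A := C)).rTensor (X.carrier ⊗[R] W)
            (TensorProduct.assoc R C X.carrier W (z ⊗ₜ w))) =
        (TensorProduct.assoc R C X.carrier W).toLinearMap.lTensor C
          (TensorProduct.assoc R C (C ⊗[R] X.carrier) W
            (TensorProduct.assoc R C C X.carrier
              ((Coalgebra.comul (R := R) (A := C)).rTensor X.carrier z) ⊗ₜ w)) := by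
      intro z
      induction z with
      | zero => simp
      | add a b ha hb => simp only [TensorProduct.add_tmul, map_add, ha, hb]
      | tmul a c =>
        simp only [TensorProduct.assoc_tmul, LinearMap.rTensor_tmul]
        induction (Coalgebra.comul (R := R) (A := C)) a with
        | zero => simp
        | add a b ha hb => simp only [TensorProduct.add_tmul, map_add, ha, hb]
        | tmul a c => simp
    have := key (X.coact x)
    rw [← coassoc_apply, ← key2] at this
    exact this.symm
  counit := by
    ext x w
    have key : ∀ z : C ⊗[R] X.carrier,
        (Coalgebra.counit (R := R) (A := C)).rTensor (X.carrier ⊗[R] W)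
          (TensorProduct.assoc R C X.carrier W (z ⊗ₜ w)) =
        TensorProduct.assoc R R X.carrier W
          ((Coalgebra.counit (R := R) (A := C)).rTensor X.carrier z ⊗ₜ w) := by
      intro z
      induction z with
      | zero => simp
      | add a b ha hb => simp only [TensorProduct.add_tmul, map_add, ha, hb]
      | tmul a c => simp
    have := key (X.coact x)
    rw [counit_apply] at this
    exact this

theorem tensor_colinear (X : LeftComodule R C) {V W : Type u} [AddCommGroup V] [Module R V]
    [AddCommGroup W] [Module R W] (f : V →ₗ[R] W) :
    (X.tensor W).coact ∘ₗ f.lTensor X.carrier =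
      (f.lTensor X.carrier).lTensor C ∘ₗ (X.tensor V).coact := by
  ext x v
  have key : ∀ z : C ⊗[R] X.carrier,
      TensorProduct.assoc R C X.carrier W (z ⊗ₜ f v) =
      (f.lTensor X.carrier).lTensor C (TensorProduct.assoc R C X.carrier V (z ⊗ₜ v)) := by
    intro z
    induction z with
    | zero => simp
    | add a b ha hb => simp only [TensorProduct.add_tmul, map_add, ha, hb]
    | tmul a c => simp
  exact key (X.coact x)

/-- The functor `X ⊗ -` from `R`-modules to left comodules. -/
abbrev tensorFunctor (X : LeftComodule R C) : ModuleCat.{u} R ⥤ LeftComodule R C where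
  obj W := X.tensor W
  map f := ⟨f.hom.lTensor X.carrier, X.tensor_colinear f.hom⟩
  map_id W := by apply hom_ext; simp
  map_comp f g := by apply hom_ext; simp [LinearMap.lTensor_comp]

/-- `X` is quasi-finite: the functor `X ⊗ -` has a left adjoint. -/
abbrev IsQuasiFinite (X : LeftComodule R C) : Prop := X.tensorFunctor.IsRightAdjoint

/-- `X` is an injector: the functor `X ⊗ -` preserves injective objects. -/
def IsInjector (X : LeftComodule R C) : Prop := X.tensorFunctor.PreservesInjectiveObjects

end LeftComodule

/-! ### The cotensor product and faithfully coflat comodules -/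

/-- The map `ρ_M ⊗ id - id ⊗ ρ_N : M ⊗ N → M ⊗ C ⊗ N`. -/
noncomputable def cotensorMap (M : RightComodule R C) (N : LeftComodule R C) :
    M.carrier ⊗[R] N.carrier →ₗ[R] M.carrier ⊗[R] (C ⊗[R] N.carrier) :=
  (TensorProduct.assoc R M.carrier C N.carrier).toLinearMap ∘ₗ M.coact.rTensor N.carrier -
    N.coact.lTensor M.carrier

/-- The cotensor product `M □_C N`, a submodule of `M ⊗ N`. -/
noncomputable def cotensor (M : RightComodule R C) (N : LeftComodule R C) :
    Submodule R (M.carrier ⊗[R] N.carrier) :=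
  LinearMap.ker (cotensorMap M N)

theorem cotensorMap_lTensor (M : RightComodule R C) {N N' : LeftComodule R C} (f : N ⟶ N')
    (z : M.carrier ⊗[R] N.carrier) :
    cotensorMap M N' (f.hom.lTensor M.carrier z) =
      (f.hom.lTensor C).lTensor M.carrier (cotensorMap M N z) := by
  induction z with
  | zero => simp
  | add a b ha hb => simp only [map_add, ha, hb]
  | tmul m n =>
    have key : ∀ z : M.carrier ⊗[R] C,
        TensorProduct.assoc R M.carrier C N'.carrier (z ⊗ₜ f.hom n) =
        (f.hom.lTensor C).lTensor M.carrier
          (TensorProduct.assoc R M.carrier C N.carrier (z ⊗ₜ n)) := by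
      intro z
      induction z with
      | zero => simp
      | add a b ha hb => simp only [TensorProduct.add_tmul, map_add, ha, hb]
      | tmul a c => simp
    simp [cotensorMap, key, LeftComodule.colinear_apply]

theorem cotensorMap_rTensor {M M' : RightComodule R C} (N : LeftComodule R C) (f : M ⟶ M')
    (z : M.carrier ⊗[R] N.carrier) :
    cotensorMap M' N (f.hom.rTensor N.carrier z) =
      f.hom.rTensor (C ⊗[R] N.carrier) (cotensorMap M N z) := by
  induction z with
  | zero => simp
  | add a b ha hb => simp only [map_add, ha, hb]
  | tmul m n =>
    have key : ∀ z : M.carrier ⊗[R] C,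
        TensorProduct.assoc R M'.carrier C N.carrier (f.hom.rTensor C z ⊗ₜ n) =
        f.hom.rTensor (C ⊗[R] N.carrier)
          (TensorProduct.assoc R M.carrier C N.carrier (z ⊗ₜ n)) := by
      intro z
      induction z with
      | zero => simp
      | add a b ha hb => simp only [TensorProduct.add_tmul, map_add, ha, hb]
      | tmul a c => simp
    simp [cotensorMap, key, RightComodule.colinear_apply]

/-- The functor `M □_C -` from left `C`-comodules to `R`-modules. -/
noncomputable def RightComodule.cotensorFunctor (M : RightComodule R C) :
    LeftComodule R C ⥤ ModuleCat.{u} R where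
  obj N := ModuleCat.of R (cotensor M N)
  map {N N'} f := ModuleCat.ofHom ((f.hom.lTensor M.carrier).restrict fun z hz => by
    rw [cotensor, LinearMap.mem_ker] at hz ⊢
    rw [cotensorMap_lTensor, hz, map_zero])
  map_id N := by
    ext z
    exact LinearMap.congr_fun (LinearMap.lTensor_id _ _) z.1
  map_comp f g := by
    ext z
    exact LinearMap.congr_fun (LinearMap.lTensor_comp _ g.hom f.hom) z.1

/-- The functor `- □_C N` from right `C`-comodules to `R`-modules. -/
noncomputable def LeftComodule.cotensorFunctor (N : LeftComodule R C) :
    RightComodule R C ⥤ ModuleCat.{u} R where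
  obj M := ModuleCat.of R (cotensor M N)
  map {M M'} f := ModuleCat.ofHom ((f.hom.rTensor N.carrier).restrict fun z hz => by
    rw [cotensor, LinearMap.mem_ker] at hz ⊢
    rw [cotensorMap_rTensor, hz, map_zero])
  map_id M := by
    ext z
    exact LinearMap.congr_fun (LinearMap.rTensor_id _ _) z.1
  map_comp f g := by
    ext z
    exact LinearMap.congr_fun (LinearMap.rTensor_comp _ g.hom f.hom) z.1

/-- `M` is coflat: the functor `M □_C -` is exact, that is, it carries short exact sequences of
left `C`-comodules to short exact sequences. (For `R`-flat `C`, a sequence of comodules is exact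
if and only if the sequence of underlying `R`-modules is.) -/
def RightComodule.IsCoflat (M : RightComodule R C) : Prop :=
  ∀ ⦃N₁ N₂ N₃ : LeftComodule R C⦄ (f : N₁ ⟶ N₂) (g : N₂ ⟶ N₃),
    Function.Injective f.hom → Function.Exact f.hom g.hom → Function.Surjective g.hom →
    Function.Injective (M.cotensorFunctor.map f).hom ∧
      Function.Exact (M.cotensorFunctor.map f).hom (M.cotensorFunctor.map g).hom ∧
      Function.Surjective (M.cotensorFunctor.map g).hom

/-- `N` is coflat: the functor `- □_C N` is exact, that is, it carries short exact sequences of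
right `C`-comodules to short exact sequences. (For `R`-flat `C`, a sequence of comodules is exact
if and only if the sequence of underlying `R`-modules is.) -/
def LeftComodule.IsCoflat (N : LeftComodule R C) : Prop :=
  ∀ ⦃M₁ M₂ M₃ : RightComodule R C⦄ (f : M₁ ⟶ M₂) (g : M₂ ⟶ M₃),
    Function.Injective f.hom → Function.Exact f.hom g.hom → Function.Surjective g.hom →
    Function.Injective (N.cotensorFunctor.map f).hom ∧
      Function.Exact (N.cotensorFunctor.map f).hom (N.cotensorFunctor.map g).hom ∧
      Function.Surjective (N.cotensorFunctor.map g).hom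

/-- `M` is faithfully coflat: the functor `M □_C -` is exact and faithful. -/
def RightComodule.IsFaithfullyCoflat (M : RightComodule R C) : Prop :=
  M.IsCoflat ∧ M.cotensorFunctor.Faithful

/-- `N` is faithfully coflat: the functor `- □_C N` is exact and faithful. -/
def LeftComodule.IsFaithfullyCoflat (N : LeftComodule R C) : Prop :=
  N.IsCoflat ∧ N.cotensorFunctor.Faithful

/-! ### The cohom functor and the coendomorphism coalgebra -/

namespace RightComodule

/-- The cohom functor `h(X, -)`: the left adjoint of `- ⊗ X`. -/
noncomputable def cohom (X : RightComodule R C) [X.IsQuasiFinite] :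
    RightComodule R C ⥤ ModuleCat.{u} R :=
  X.tensorFunctor.leftAdjoint

/-- The adjunction between `h(X, -)` and `- ⊗ X`. -/
noncomputable def cohomAdj (X : RightComodule R C) [X.IsQuasiFinite] :
    X.cohom ⊣ X.tensorFunctor :=
  Adjunction.ofIsRightAdjoint X.tensorFunctor

/-- The underlying module `h(X, X)` of the coendomorphism coalgebra `e(X)`. -/
def Coend (X : RightComodule R C) [X.IsQuasiFinite] : Type u := X.cohom.obj X

noncomputable instance (X : RightComodule R C) [X.IsQuasiFinite] : AddCommGroup X.Coend :=
  inferInstanceAs (AddCommGroup (X.cohom.obj X))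

noncomputable instance (X : RightComodule R C) [X.IsQuasiFinite] : Module R X.Coend :=
  inferInstanceAs (Module R (X.cohom.obj X))

variable (X : RightComodule R C) [X.IsQuasiFinite]

/-- The unit of adjunction `η : X → h(X, X) ⊗ X`. -/
noncomputable def coendUnit : X ⟶ X.tensor X.Coend := X.cohomAdj.unit.app X

/-- The unit of adjunction as a linear map. -/
noncomputable def coendCoact : X.carrier →ₗ[R] X.Coend ⊗[R] X.carrier := X.coendUnit.hom

/-- The linear map `h(X, X) → W` that corresponds to a colinear map `X → W ⊗ X`. -/
noncomputable def coendLift {W : Type u} [AddCommGroup W] [Module R W] (f : X ⟶ X.tensor W) :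
    X.Coend →ₗ[R] W :=
  ((X.cohomAdj.homEquiv X (ModuleCat.of R W)).symm f).hom

theorem coendLift_spec {W : Type u} [AddCommGroup W] [Module R W] (f : X ⟶ X.tensor W) :
    (X.coendLift f).rTensor X.carrier ∘ₗ X.coendCoact = f.hom := by
  have h := (X.cohomAdj.homEquiv X (ModuleCat.of R W)).apply_symm_apply f
  rw [Adjunction.homEquiv_unit] at h
  exact congrArg Hom.hom h

theorem coend_hom_ext {W : Type u} [AddCommGroup W] [Module R W] {f g : X.Coend →ₗ[R] W}
    (h : ∀ x, f.rTensor X.carrier (X.coendCoact x) = g.rTensor X.carrier (X.coendCoact x)) :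
    f = g := by
  have h' : (X.cohomAdj.homEquiv X (ModuleCat.of R W)) (ModuleCat.ofHom f) =
      (X.cohomAdj.homEquiv X (ModuleCat.of R W)) (ModuleCat.ofHom g) := by
    rw [Adjunction.homEquiv_unit, Adjunction.homEquiv_unit]
    exact hom_ext (LinearMap.ext h)
  exact congrArg ModuleCat.Hom.hom ((X.cohomAdj.homEquiv X (ModuleCat.of R W)).injective h')

/-- The colinear map `id ⊗ f : W ⊗ X → W ⊗ Y`. -/
noncomputable def tensorMap (W : Type u) [AddCommGroup W] [Module R W] {X Y : RightComodule R C}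
    (f : X ⟶ Y) : X.tensor W ⟶ Y.tensor W where
  hom := f.hom.lTensor W
  colinear := by
    ext w x
    have key : ∀ z : X.carrier ⊗[R] C,
        (TensorProduct.assoc R W Y.carrier C).symm (w ⊗ₜ f.hom.rTensor C z) =
        (f.hom.lTensor W).rTensor C ((TensorProduct.assoc R W X.carrier C).symm (w ⊗ₜ z)) := by
      intro z
      induction z with
      | zero => simp
      | add a b ha hb => simp only [TensorProduct.tmul_add, map_add, ha, hb]
      | tmul a c => simp
    have := key (X.coact x)
    rw [← colinear_apply] at this
    exact this

/-- The colinear isomorphism `V ⊗ (W ⊗ X) → (V ⊗ W) ⊗ X`. -/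
noncomputable def tensorAssoc (X : RightComodule R C) (V W : Type u) [AddCommGroup V] [Module R V]
    [AddCommGroup W] [Module R W] : (X.tensor W).tensor V ⟶ X.tensor (V ⊗[R] W) where
  hom := (TensorProduct.assoc R V W X.carrier).symm.toLinearMap
  colinear := by
    apply TensorProduct.ext'
    intro v (y : W ⊗[R] X.carrier)
    induction y with
    | zero => simp
    | add a b ha hb => rw [TensorProduct.tmul_add, map_add, map_add, ha, hb]
    | tmul w x =>
      have key : ∀ z : X.carrier ⊗[R] C,
          (TensorProduct.assoc R (V ⊗[R] W) X.carrier C).symm ((v ⊗ₜ w) ⊗ₜ z) =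
          (TensorProduct.assoc R V W X.carrier).symm.toLinearMap.rTensor C
            ((TensorProduct.assoc R V (W ⊗[R] X.carrier) C).symm
              (v ⊗ₜ (TensorProduct.assoc R W X.carrier C).symm (w ⊗ₜ z))) := by
        intro z
        induction z with
        | zero => simp
        | add a b ha hb => simp only [TensorProduct.tmul_add, map_add, ha, hb]
        | tmul a c => simp
      exact key (X.coact x)

/-- The colinear isomorphism `X → R ⊗ X`. -/
noncomputable def toBaseTensor (X : RightComodule R C) : X ⟶ X.tensor R where
  hom := (TensorProduct.lid R X.carrier).symm.toLinearMap
  colinear := by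
    ext x
    have key : ∀ z : X.carrier ⊗[R] C,
        (TensorProduct.assoc R R X.carrier C).symm (1 ⊗ₜ z) =
        (TensorProduct.lid R X.carrier).symm.toLinearMap.rTensor C z := by
      intro z
      induction z with
      | zero => simp
      | add a b ha hb => simp only [TensorProduct.tmul_add, map_add, ha, hb]
      | tmul a c => simp
    exact key (X.coact x)

/-- The comultiplication of `e(X)`: it corresponds to
`(id ⊗ η) η : X → h(X, X) ⊗ h(X, X) ⊗ X`. -/
noncomputable def coendComul : X.Coend →ₗ[R] X.Coend ⊗[R] X.Coend :=
  X.coendLift (X.coendUnit ≫ tensorMap X.Coend X.coendUnit ≫ X.tensorAssoc X.Coend X.Coend)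

/-- The counit of `e(X)`: it corresponds to the canonical isomorphism `X → R ⊗ X`. -/
noncomputable def coendCounit : X.Coend →ₗ[R] R := X.coendLift X.toBaseTensor

theorem coendComul_spec (x : X.carrier) :
    X.coendComul.rTensor X.carrier (X.coendCoact x) =
      (TensorProduct.assoc R X.Coend X.Coend X.carrier).symm
        (X.coendCoact.lTensor X.Coend (X.coendCoact x)) :=
  LinearMap.congr_fun (X.coendLift_spec _) x

theorem coendCounit_spec (x : X.carrier) :
    X.coendCounit.rTensor X.carrier (X.coendCoact x) = 1 ⊗ₜ x :=
  LinearMap.congr_fun (X.coendLift_spec _) x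

/-- The coendomorphism coalgebra `e(X) = h(X, X)`. -/
noncomputable instance : Coalgebra R X.Coend where
  comul := X.coendComul
  counit := X.coendCounit
  coassoc := by
    apply X.coend_hom_ext
    intro x
    have hl : ∀ z : X.Coend ⊗[R] X.carrier,
        (X.coendComul.rTensor X.Coend).rTensor X.carrier
          ((TensorProduct.assoc R X.Coend X.Coend X.carrier).symm
            (X.coendCoact.lTensor X.Coend z)) =
        (TensorProduct.assoc R (X.Coend ⊗[R] X.Coend) X.Coend X.carrier).symm
          (X.coendCoact.lTensor (X.Coend ⊗[R] X.Coend)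
            (X.coendComul.rTensor X.carrier z)) := by
      intro z
      induction z with
      | zero => simp
      | add a b ha hb => simp only [map_add, ha, hb]
      | tmul e y =>
        simp only [LinearMap.lTensor_tmul, LinearMap.rTensor_tmul]
        induction X.coendCoact y with
        | zero => simp
        | add a b ha hb => simp only [TensorProduct.tmul_add, map_add, ha, hb]
        | tmul a c => simp
    have hr : ∀ z : X.Coend ⊗[R] X.carrier,
        (TensorProduct.assoc R X.Coend X.Coend X.Coend).toLinearMap.rTensor X.carrier
          ((TensorProduct.assoc R (X.Coend ⊗[R] X.Coend) X.Coend X.carrier).symm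
            (X.coendCoact.lTensor (X.Coend ⊗[R] X.Coend)
              ((TensorProduct.assoc R X.Coend X.Coend X.carrier).symm
                (X.coendCoact.lTensor X.Coend z)))) =
        (X.coendComul.lTensor X.Coend).rTensor X.carrier
          ((TensorProduct.assoc R X.Coend X.Coend X.carrier).symm
            (X.coendCoact.lTensor X.Coend z)) := by
      intro z
      induction z with
      | zero => simp
      | add a b ha hb => simp only [map_add, ha, hb]
      | tmul e y =>
        have h1 : ∀ w : X.Coend ⊗[R] X.carrier,
            (X.coendComul.lTensor X.Coend).rTensor X.carrier
              ((TensorProduct.assoc R X.Coend X.Coend X.carrier).symm (e ⊗ₜ w)) =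
            (TensorProduct.assoc R X.Coend (X.Coend ⊗[R] X.Coend) X.carrier).symm
              (e ⊗ₜ X.coendComul.rTensor X.carrier w) := by
          intro w
          induction w with
          | zero => simp
          | add a b ha hb => simp only [TensorProduct.tmul_add, map_add, ha, hb]
          | tmul a c => simp
        rw [LinearMap.lTensor_tmul, h1, coendComul_spec]
        induction X.coendCoact y with
        | zero => simp
        | add a b ha hb => simp only [TensorProduct.tmul_add, map_add, ha, hb]
        | tmul f v =>
          simp only [LinearMap.lTensor_tmul, TensorProduct.assoc_symm_tmul]
          induction X.coendCoact v with
          | zero => simp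
          | add a b ha hb => simp only [TensorProduct.tmul_add, map_add, ha, hb]
          | tmul a c => simp
    simp only [LinearMap.rTensor_comp, LinearMap.comp_apply]
    rw [coendComul_spec, hl, coendComul_spec, hr]
  rTensor_counit_comp_comul := by
    apply X.coend_hom_ext
    intro x
    have h1 : ∀ z : X.Coend ⊗[R] X.carrier,
        (X.coendCounit.rTensor X.Coend).rTensor X.carrier
          ((TensorProduct.assoc R X.Coend X.Coend X.carrier).symm
            (X.coendCoact.lTensor X.Coend z)) =
        (TensorProduct.assoc R R X.Coend X.carrier).symm
          (X.coendCoact.lTensor R (X.coendCounit.rTensor X.carrier z)) := by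
      intro z
      induction z with
      | zero => simp
      | add a b ha hb => simp only [map_add, ha, hb]
      | tmul e y =>
        simp only [LinearMap.lTensor_tmul, LinearMap.rTensor_tmul]
        induction X.coendCoact y with
        | zero => simp
        | add a b ha hb => simp only [TensorProduct.tmul_add, map_add, ha, hb]
        | tmul a c => simp
    rw [LinearMap.rTensor_comp, LinearMap.comp_apply, coendComul_spec, h1, coendCounit_spec,
      LinearMap.lTensor_tmul]
    induction X.coendCoact x with
    | zero => simp
    | add a b ha hb => simp only [TensorProduct.tmul_add, map_add, ha, hb]
    | tmul a c => simp
  lTensor_counit_comp_comul := by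
    apply X.coend_hom_ext
    intro x
    rw [LinearMap.rTensor_comp, LinearMap.comp_apply, coendComul_spec]
    induction X.coendCoact x with
    | zero => simp
    | add a b ha hb => simp only [map_add, ha, hb]
    | tmul e y =>
      have h1 : ∀ w : X.Coend ⊗[R] X.carrier,
          (X.coendCounit.lTensor X.Coend).rTensor X.carrier
            ((TensorProduct.assoc R X.Coend X.Coend X.carrier).symm (e ⊗ₜ w)) =
          (TensorProduct.assoc R X.Coend R X.carrier).symm
            (e ⊗ₜ X.coendCounit.rTensor X.carrier w) := by
        intro w
        induction w with
        | zero => simp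
        | add a b ha hb => simp only [TensorProduct.tmul_add, map_add, ha, hb]
        | tmul a c => simp
      rw [LinearMap.lTensor_tmul, h1, coendCounit_spec]
      simp

end RightComodule

namespace LeftComodule

/-- The cohom functor `h(X, -)`: the left adjoint of `X ⊗ -`. -/
noncomputable def cohom (X : LeftComodule R C) [X.IsQuasiFinite] :
    LeftComodule R C ⥤ ModuleCat.{u} R :=
  X.tensorFunctor.leftAdjoint

/-- The adjunction between `h(X, -)` and `X ⊗ -`. -/
noncomputable def cohomAdj (X : LeftComodule R C) [X.IsQuasiFinite] :
    X.cohom ⊣ X.tensorFunctor :=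
  Adjunction.ofIsRightAdjoint X.tensorFunctor

/-- The underlying module `h(X, X)` of the coendomorphism coalgebra `e(X)`. -/
def Coend (X : LeftComodule R C) [X.IsQuasiFinite] : Type u := X.cohom.obj X

noncomputable instance (X : LeftComodule R C) [X.IsQuasiFinite] : AddCommGroup X.Coend :=
  inferInstanceAs (AddCommGroup (X.cohom.obj X))

noncomputable instance (X : LeftComodule R C) [X.IsQuasiFinite] : Module R X.Coend :=
  inferInstanceAs (Module R (X.cohom.obj X))

variable (X : LeftComodule R C) [X.IsQuasiFinite]

/-- The unit of adjunction `η : X → X ⊗ h(X, X)`. -/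
noncomputable def coendUnit : X ⟶ X.tensor X.Coend := X.cohomAdj.unit.app X

/-- The unit of adjunction as a linear map. -/
noncomputable def coendCoact : X.carrier →ₗ[R] X.carrier ⊗[R] X.Coend := X.coendUnit.hom

/-- The linear map `h(X, X) → W` that corresponds to a colinear map `X → X ⊗ W`. -/
noncomputable def coendLift {W : Type u} [AddCommGroup W] [Module R W] (f : X ⟶ X.tensor W) :
    X.Coend →ₗ[R] W :=
  ((X.cohomAdj.homEquiv X (ModuleCat.of R W)).symm f).hom

theorem coendLift_spec {W : Type u} [AddCommGroup W] [Module R W] (f : X ⟶ X.tensor W) :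
    (X.coendLift f).lTensor X.carrier ∘ₗ X.coendCoact = f.hom := by
  have h := (X.cohomAdj.homEquiv X (ModuleCat.of R W)).apply_symm_apply f
  rw [Adjunction.homEquiv_unit] at h
  exact congrArg Hom.hom h

theorem coend_hom_ext {W : Type u} [AddCommGroup W] [Module R W] {f g : X.Coend →ₗ[R] W}
    (h : ∀ x, f.lTensor X.carrier (X.coendCoact x) = g.lTensor X.carrier (X.coendCoact x)) :
    f = g := by
  have h' : (X.cohomAdj.homEquiv X (ModuleCat.of R W)) (ModuleCat.ofHom f) =
      (X.cohomAdj.homEquiv X (ModuleCat.of R W)) (ModuleCat.ofHom g) := by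
    rw [Adjunction.homEquiv_unit, Adjunction.homEquiv_unit]
    exact hom_ext (LinearMap.ext h)
  exact congrArg ModuleCat.Hom.hom ((X.cohomAdj.homEquiv X (ModuleCat.of R W)).injective h')

/-- The colinear map `f ⊗ id : X ⊗ W → Y ⊗ W`. -/
noncomputable def tensorMap (W : Type u) [AddCommGroup W] [Module R W] {X Y : LeftComodule R C}
    (f : X ⟶ Y) : X.tensor W ⟶ Y.tensor W where
  hom := f.hom.rTensor W
  colinear := by
    ext x w
    have key : ∀ z : C ⊗[R] X.carrier,
        TensorProduct.assoc R C Y.carrier W (f.hom.lTensor C z ⊗ₜ w) =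
        (f.hom.rTensor W).lTensor C (TensorProduct.assoc R C X.carrier W (z ⊗ₜ w)) := by
      intro z
      induction z with
      | zero => simp
      | add a b ha hb => simp only [TensorProduct.add_tmul, map_add, ha, hb]
      | tmul a c => simp
    have := key (X.coact x)
    rw [← colinear_apply] at this
    exact this

/-- The colinear isomorphism `(X ⊗ W) ⊗ V → X ⊗ (W ⊗ V)`. -/
noncomputable def tensorAssoc (X : LeftComodule R C) (V W : Type u) [AddCommGroup V] [Module R V]
    [AddCommGroup W] [Module R W] : (X.tensor W).tensor V ⟶ X.tensor (W ⊗[R] V) where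
  hom := (TensorProduct.assoc R X.carrier W V).toLinearMap
  colinear := by
    apply TensorProduct.ext'
    intro (y : X.carrier ⊗[R] W) v
    induction y with
    | zero => simp
    | add a b ha hb => rw [TensorProduct.add_tmul, map_add, map_add, ha, hb]
    | tmul x w =>
      have key : ∀ z : C ⊗[R] X.carrier,
          TensorProduct.assoc R C X.carrier (W ⊗[R] V) (z ⊗ₜ (w ⊗ₜ v)) =
          (TensorProduct.assoc R X.carrier W V).toLinearMap.lTensor C
            (TensorProduct.assoc R C (X.carrier ⊗[R] W) V
              (TensorProduct.assoc R C X.carrier W (z ⊗ₜ w) ⊗ₜ v)) := by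
        intro z
        induction z with
        | zero => simp
        | add a b ha hb => simp only [TensorProduct.add_tmul, map_add, ha, hb]
        | tmul a c => simp
      exact key (X.coact x)

/-- The colinear isomorphism `X → X ⊗ R`. -/
noncomputable def toBaseTensor (X : LeftComodule R C) : X ⟶ X.tensor R where
  hom := (TensorProduct.rid R X.carrier).symm.toLinearMap
  colinear := by
    ext x
    have key : ∀ z : C ⊗[R] X.carrier,
        TensorProduct.assoc R C X.carrier R (z ⊗ₜ 1) =
        (TensorProduct.rid R X.carrier).symm.toLinearMap.lTensor C z := by
      intro z
      induction z with
      | zero => simp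
      | add a b ha hb => simp only [TensorProduct.add_tmul, map_add, ha, hb]
      | tmul a c => simp
    exact key (X.coact x)

/-- The comultiplication of `e(X)`: it corresponds to
`(η ⊗ id) η : X → X ⊗ h(X, X) ⊗ h(X, X)`. -/
noncomputable def coendComul : X.Coend →ₗ[R] X.Coend ⊗[R] X.Coend :=
  X.coendLift (X.coendUnit ≫ tensorMap X.Coend X.coendUnit ≫ X.tensorAssoc X.Coend X.Coend)

/-- The counit of `e(X)`: it corresponds to the canonical isomorphism `X → X ⊗ R`. -/
noncomputable def coendCounit : X.Coend →ₗ[R] R := X.coendLift X.toBaseTensor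

theorem coendComul_spec (x : X.carrier) :
    X.coendComul.lTensor X.carrier (X.coendCoact x) =
      TensorProduct.assoc R X.carrier X.Coend X.Coend
        (X.coendCoact.rTensor X.Coend (X.coendCoact x)) :=
  LinearMap.congr_fun (X.coendLift_spec _) x

theorem coendCounit_spec (x : X.carrier) :
    X.coendCounit.lTensor X.carrier (X.coendCoact x) = x ⊗ₜ 1 :=
  LinearMap.congr_fun (X.coendLift_spec _) x

/-- The coendomorphism coalgebra `e(X) = h(X, X)`. -/
noncomputable instance : Coalgebra R X.Coend where
  comul := X.coendComul
  counit := X.coendCounit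
  coassoc := by
    apply X.coend_hom_ext
    intro x
    have hl : ∀ z : X.carrier ⊗[R] X.Coend,
        (X.coendComul.lTensor X.Coend).lTensor X.carrier
          (TensorProduct.assoc R X.carrier X.Coend X.Coend
            (X.coendCoact.rTensor X.Coend z)) =
        TensorProduct.assoc R X.carrier X.Coend (X.Coend ⊗[R] X.Coend)
          (X.coendCoact.rTensor (X.Coend ⊗[R] X.Coend)
            (X.coendComul.lTensor X.carrier z)) := by
      intro z
      induction z with
      | zero => simp
      | add a b ha hb => simp only [map_add, ha, hb]
      | tmul y e =>
        simp only [LinearMap.lTensor_tmul, LinearMap.rTensor_tmul]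
        induction X.coendCoact y with
        | zero => simp
        | add a b ha hb => simp only [TensorProduct.add_tmul, map_add, ha, hb]
        | tmul a c => simp
    have hr : ∀ z : X.carrier ⊗[R] X.Coend,
        (TensorProduct.assoc R X.Coend X.Coend X.Coend).toLinearMap.lTensor X.carrier
          ((X.coendComul.rTensor X.Coend).lTensor X.carrier
            (TensorProduct.assoc R X.carrier X.Coend X.Coend
              (X.coendCoact.rTensor X.Coend z))) =
        TensorProduct.assoc R X.carrier X.Coend (X.Coend ⊗[R] X.Coend)
          (X.coendCoact.rTensor (X.Coend ⊗[R] X.Coend)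
            (TensorProduct.assoc R X.carrier X.Coend X.Coend
              (X.coendCoact.rTensor X.Coend z))) := by
      intro z
      induction z with
      | zero => simp
      | add a b ha hb => simp only [map_add, ha, hb]
      | tmul y e =>
        have h1 : ∀ w : X.carrier ⊗[R] X.Coend,
            (X.coendComul.rTensor X.Coend).lTensor X.carrier
              (TensorProduct.assoc R X.carrier X.Coend X.Coend (w ⊗ₜ e)) =
            TensorProduct.assoc R X.carrier (X.Coend ⊗[R] X.Coend) X.Coend
              (X.coendComul.lTensor X.carrier w ⊗ₜ e) := by
          intro w
          induction w with
          | zero => simp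
          | add a b ha hb => simp only [TensorProduct.add_tmul, map_add, ha, hb]
          | tmul a c => simp
        rw [LinearMap.rTensor_tmul, h1, coendComul_spec]
        induction X.coendCoact y with
        | zero => simp
        | add a b ha hb => simp only [TensorProduct.add_tmul, map_add, ha, hb]
        | tmul v f =>
          simp only [LinearMap.rTensor_tmul, TensorProduct.assoc_tmul]
          induction X.coendCoact v with
          | zero => simp
          | add a b ha hb => simp only [TensorProduct.add_tmul, map_add, ha, hb]
          | tmul a c => simp
    simp only [LinearMap.lTensor_comp, LinearMap.comp_apply]
    rw [coendComul_spec, hl, coendComul_spec, hr]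
  rTensor_counit_comp_comul := by
    apply X.coend_hom_ext
    intro x
    rw [LinearMap.lTensor_comp, LinearMap.comp_apply, coendComul_spec]
    induction X.coendCoact x with
    | zero => simp
    | add a b ha hb => simp only [map_add, ha, hb]
    | tmul y e =>
      have h1 : ∀ w : X.carrier ⊗[R] X.Coend,
          (X.coendCounit.rTensor X.Coend).lTensor X.carrier
            (TensorProduct.assoc R X.carrier X.Coend X.Coend (w ⊗ₜ e)) =
          TensorProduct.assoc R X.carrier R X.Coend
            (X.coendCounit.lTensor X.carrier w ⊗ₜ e) := by
        intro w
        induction w with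
        | zero => simp
        | add a b ha hb => simp only [TensorProduct.add_tmul, map_add, ha, hb]
        | tmul a c => simp
      rw [LinearMap.rTensor_tmul, h1, coendCounit_spec]
      simp
  lTensor_counit_comp_comul := by
    apply X.coend_hom_ext
    intro x
    have h1 : ∀ z : X.carrier ⊗[R] X.Coend,
        (X.coendCounit.lTensor X.Coend).lTensor X.carrier
          (TensorProduct.assoc R X.carrier X.Coend X.Coend
            (X.coendCoact.rTensor X.Coend z)) =
        TensorProduct.assoc R X.carrier X.Coend R
          (X.coendCoact.rTensor R (X.coendCounit.lTensor X.carrier z)) := by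
      intro z
      induction z with
      | zero => simp
      | add a b ha hb => simp only [map_add, ha, hb]
      | tmul y e =>
        simp only [LinearMap.lTensor_tmul, LinearMap.rTensor_tmul]
        induction X.coendCoact y with
        | zero => simp
        | add a b ha hb => simp only [TensorProduct.add_tmul, map_add, ha, hb]
        | tmul a c => simp
    rw [LinearMap.lTensor_comp, LinearMap.comp_apply, coendComul_spec, h1, coendCounit_spec,
      LinearMap.rTensor_tmul]
    induction X.coendCoact x with
    | zero => simp
    | add a b ha hb => simp only [TensorProduct.add_tmul, map_add, ha, hb]
    | tmul a c => simp

end LeftComodule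

/-! ### The conditions on a comodule -/

/-- The right `C`-comodule `X` is quasi-finite, faithfully coflat and an injector, and its
coendomorphism coalgebra is isomorphic to the coalgebra `E`. -/
def RightComodule.IsMoritaTakeuchi (X : RightComodule R C)
    (E : Type u) [AddCommGroup E] [Module R E] [Coalgebra R E] : Prop :=
  ∃ _ : X.IsQuasiFinite, X.IsFaithfullyCoflat ∧ X.IsInjector ∧ Nonempty (X.Coend ≃ₗc[R] E)

/-- The left `C`-comodule `X` is quasi-finite, faithfully coflat and an injector, and its
coendomorphism coalgebra is isomorphic to the coalgebra `E`. -/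
def LeftComodule.IsMoritaTakeuchi (X : LeftComodule R C)
    (E : Type u) [AddCommGroup E] [Module R E] [Coalgebra R E] : Prop :=
  ∃ _ : X.IsQuasiFinite, X.IsFaithfullyCoflat ∧ X.IsInjector ∧ Nonempty (X.Coend ≃ₗc[R] E)

end MoritaTakeuchi

/-! Everything rests on one kind of object: a right `D`-comodule `X` that is quasi-finite, flat over
`R`, an injector and a cogenerator (every comodule embeds in some `W ⊗ X`), with a left coaction `X
→ C ⊗ X` that is universal, so that `C = h(X, X)`. Conditions 1 and 3 each produce such an `X`, and
such an `X` gives 1, 3 and 6.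

From 1. In an `R`-linear category `W ⊗ M` is characterised by `Hom(W ⊗ M, N) = Hom_R(W, Hom(M, N))`.
Hence a linear equivalence `F` commutes with `W ⊗ -` (`isIso_comparison`), and `X = F(C)` inherits
the properties of `C` itself, for which `h(C, -)` is the forgetful functor
(`isFlatCogenerator_map_regular`, `exists_bicomodule_map_regular`).

From 3. An isomorphism `e(X) ≅ C` turns the unit of adjunction into a universal left coaction.
Coflatness gives flatness, because `X □ (D ⊗ W) = W ⊗ X` and `D` is flat (`IsCoflat.flat`). Let `Y =
h(X, D)` with universal map `δ : D → Y ⊗ X`. Faithfulness of `X □ -` makes `W ⊗ δ` injective for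
every `W` (`lTensor_unit_injective`), so `M → M ⊗ D → M ⊗ Y ⊗ X` is an embedding.

To 1. Since `X` is an injector, `h(X, -)` is exact (`map_injective`, `map_exact`). Applied to `0 → N
□ X → N ⊗ X → N ⊗ C ⊗ X`, and with `h(X, W ⊗ X) = W ⊗ C`, it gives `0 → h(X, N □ X) → N ⊗ C → N ⊗ C
⊗ C`. The kernel of the last map is `N`, so `h(X, N □ X) ≅ N` (`cotensorCounit_bijective`).
Cogeneration makes `M → h(X, M) ⊗ X` injective. It follows that `h(X, -)` is faithful and reflects
surjections, and that `M → h(X, M) □ X` is an isomorphism. Thus `h(X, -)` is an equivalence from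
`D`-comodules to `C`-comodules.

To 6 and 3. Applying `h(X, -)` to `M → M ⊗ D → M ⊗ D ⊗ D` gives `h(X, M) = M □ Y`
(`range_toCotensor`); in particular `C = X □ Y`. The maps `D → Y ⊗ X` and `C → X ⊗ Y` make `X □ -`
left adjoint to `Y ⊗ -` (`cotensorAdj`). So `Y` is quasi-finite with `e(Y) = X □ Y = C`. It is an
injector because `X` is flat, and faithfully coflat because `- □ Y = h(X, -)`. The same adjunction
shows that `X` is faithfully coflat.

Left-handed statements. Left comodules over a coalgebra are right comodules over its co-opposite, so
6 → 2 and 2 → 3 follow from right-handed results over the co-opposites. Conditions 4 and 5 enter by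
exchanging `C` and `D`. -/

namespace MoritaTakeuchi

variable {R : Type u} [CommRing R] {C : Type u} [AddCommGroup C] [Module R C] [Coalgebra R C]
  {D : Type u} [AddCommGroup D] [Module R D] [Coalgebra R D]

/-! ### Naturality of the associator of the tensor product. -/

section Naturality

variable {A A' B B' E E' : Type u} [AddCommGroup A] [Module R A] [AddCommGroup A'] [Module R A']
  [AddCommGroup B] [Module R B] [AddCommGroup B'] [Module R B']
  [AddCommGroup E] [Module R E] [AddCommGroup E'] [Module R E']

theorem assoc_rTensor_rTensor (f : A →ₗ[R] A') (z : (A ⊗[R] B) ⊗[R] E) :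
    TensorProduct.assoc R A' B E ((f.rTensor B).rTensor E z) =
      f.rTensor (B ⊗[R] E) (TensorProduct.assoc R A B E z) := by
  have : (TensorProduct.assoc R A' B E).toLinearMap ∘ₗ (f.rTensor B).rTensor E =
      f.rTensor (B ⊗[R] E) ∘ₗ (TensorProduct.assoc R A B E).toLinearMap := by ext; simp
  exact LinearMap.congr_fun this z

theorem assoc_lTensor_rTensor (f : B →ₗ[R] B') (z : (A ⊗[R] B) ⊗[R] E) :
    TensorProduct.assoc R A B' E ((f.lTensor A).rTensor E z) =
      (f.rTensor E).lTensor A (TensorProduct.assoc R A B E z) := by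
  have : (TensorProduct.assoc R A B' E).toLinearMap ∘ₗ (f.lTensor A).rTensor E =
      (f.rTensor E).lTensor A ∘ₗ (TensorProduct.assoc R A B E).toLinearMap := by ext; simp
  exact LinearMap.congr_fun this z

theorem assoc_lTensor (f : E →ₗ[R] E') (z : (A ⊗[R] B) ⊗[R] E) :
    TensorProduct.assoc R A B E' (f.lTensor (A ⊗[R] B) z) =
      (f.lTensor B).lTensor A (TensorProduct.assoc R A B E z) := by
  have : (TensorProduct.assoc R A B E').toLinearMap ∘ₗ f.lTensor (A ⊗[R] B) =
      (f.lTensor B).lTensor A ∘ₗ (TensorProduct.assoc R A B E).toLinearMap := by ext; simp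
  exact LinearMap.congr_fun this z

theorem assoc_symm_rTensor (f : A →ₗ[R] A') (z : A ⊗[R] (B ⊗[R] E)) :
    (TensorProduct.assoc R A' B E).symm (f.rTensor (B ⊗[R] E) z) =
      (f.rTensor B).rTensor E ((TensorProduct.assoc R A B E).symm z) := by
  rw [LinearEquiv.symm_apply_eq, assoc_rTensor_rTensor, LinearEquiv.apply_symm_apply]

theorem assoc_symm_rTensor_lTensor (f : B →ₗ[R] B') (z : A ⊗[R] (B ⊗[R] E)) :
    (TensorProduct.assoc R A B' E).symm ((f.rTensor E).lTensor A z) =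
      (f.lTensor A).rTensor E ((TensorProduct.assoc R A B E).symm z) := by
  rw [LinearEquiv.symm_apply_eq, assoc_lTensor_rTensor, LinearEquiv.apply_symm_apply]

theorem assoc_symm_lTensor_lTensor (f : E →ₗ[R] E') (z : A ⊗[R] (B ⊗[R] E)) :
    (TensorProduct.assoc R A B E').symm ((f.lTensor B).lTensor A z) =
      f.lTensor (A ⊗[R] B) ((TensorProduct.assoc R A B E).symm z) := by
  rw [LinearEquiv.symm_apply_eq, assoc_lTensor, LinearEquiv.apply_symm_apply]

theorem lTensor_rTensor_apply (f : A →ₗ[R] A') (g : B →ₗ[R] B') (z : A ⊗[R] B) :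
    g.lTensor A' (f.rTensor B z) = f.rTensor B' (g.lTensor A z) := by
  rw [← LinearMap.comp_apply, ← LinearMap.comp_apply, LinearMap.lTensor_comp_rTensor,
    LinearMap.rTensor_comp_lTensor]

end Naturality

/-! ### Kernels, cokernels and factorisations of colinear maps. -/

namespace RightComodule

section Kernels

variable [Module.Flat R D]

/-- A submodule of a comodule that is stable under the coaction, given by an injective map. -/
abbrev ofInjective (M : RightComodule R D) {K : Type u} [AddCommGroup K] [Module R K]
    (i : K →ₗ[R] M.carrier) (hi : Function.Injective i) (κ : K →ₗ[R] K ⊗[R] D)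
    (hκ : i.rTensor D ∘ₗ κ = M.coact ∘ₗ i) : RightComodule R D where
  carrier := K
  coact := κ
  coassoc := by
    -- Flatness of `D` makes `K ⊗ D ⊗ D → M ⊗ D ⊗ D` injective, so coassociativity may be checked
    -- inside `M`.
    have hi2 := Module.Flat.rTensor_preserves_injective_linearMap (M := D ⊗[R] D) i hi
    have hκ' : ∀ x, i.rTensor D (κ x) = M.coact (i x) := LinearMap.congr_fun hκ
    ext x
    apply hi2
    simp only [LinearMap.comp_apply, LinearEquiv.coe_coe]
    rw [← assoc_rTensor_rTensor, ← LinearMap.rTensor_comp_apply, hκ, LinearMap.rTensor_comp_apply,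
      hκ', coassoc_apply, ← hκ', lTensor_rTensor_apply]
  counit := by
    have hi2 := Module.Flat.rTensor_preserves_injective_linearMap (M := R) i hi
    have hκ' : ∀ x, i.rTensor D (κ x) = M.coact (i x) := LinearMap.congr_fun hκ
    ext x
    apply hi2
    rw [LinearMap.comp_apply, ← lTensor_rTensor_apply, hκ', counit_apply]
    rfl

/-- The coaction on the kernel of a colinear map. -/
noncomputable def kernelCoact {M N : RightComodule R D} (f : M ⟶ N) :
    LinearMap.ker f.hom →ₗ[R] LinearMap.ker f.hom ⊗[R] D :=
  (LinearEquiv.ofInjective ((LinearMap.ker f.hom).subtype.rTensor D)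
      (Module.Flat.rTensor_preserves_injective_linearMap _
        (Submodule.injective_subtype _))).symm.toLinearMap ∘ₗ
    LinearMap.codRestrict _ (M.coact ∘ₗ (LinearMap.ker f.hom).subtype) (fun x => by
      -- Flatness identifies `ker f ⊗ D` with the kernel of `f ⊗ D`, and colinearity of `f` places
      -- the coaction of `x` there.
      have hex : Function.Exact ((LinearMap.ker f.hom).subtype.rTensor D) (f.hom.rTensor D) :=
        Module.Flat.rTensor_exact D (LinearMap.exact_subtype_ker_map f.hom)
      refine (hex _).1 ?_
      change f.hom.rTensor D (M.coact x.1) = 0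
      rw [← colinear_apply, LinearMap.mem_ker.1 x.2, map_zero])

theorem subtype_kernelCoact {M N : RightComodule R D} (f : M ⟶ N) :
    (LinearMap.ker f.hom).subtype.rTensor D ∘ₗ kernelCoact f =
      M.coact ∘ₗ (LinearMap.ker f.hom).subtype := by
  apply LinearMap.ext
  intro x
  exact congrArg Subtype.val (LinearEquiv.apply_symm_apply (LinearEquiv.ofInjective
    ((LinearMap.ker f.hom).subtype.rTensor D)
      (Module.Flat.rTensor_preserves_injective_linearMap _ (Submodule.injective_subtype _))) _)

/-- The kernel of a colinear map. -/
noncomputable abbrev kernel {M N : RightComodule R D} (f : M ⟶ N) : RightComodule R D :=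
  M.ofInjective (LinearMap.ker f.hom).subtype (Submodule.injective_subtype _) (kernelCoact f)
    (subtype_kernelCoact f)

/-- The inclusion of the kernel of a colinear map. -/
noncomputable abbrev kernelι {M N : RightComodule R D} (f : M ⟶ N) : kernel f ⟶ M where
  hom := (LinearMap.ker f.hom).subtype
  colinear := (subtype_kernelCoact f).symm

/-- The linear kernel is a comodule because `D` is flat. Its inclusion becomes zero after `f`, hence
is zero when `f` is a monomorphism. -/
theorem injective_of_mono {M N : RightComodule R D} (f : M ⟶ N) [Mono f] :
    Function.Injective f.hom := by
  have h : kernelι f = 0 := by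
    rw [← cancel_mono f]
    apply hom_ext
    apply LinearMap.ext
    intro x
    rw [Limits.zero_comp]
    exact LinearMap.mem_ker.1 x.2
  rw [← LinearMap.ker_eq_bot, Submodule.eq_bot_iff]
  intro x hx
  exact LinearMap.congr_fun (congrArg Hom.hom h) (⟨x, hx⟩ : LinearMap.ker f.hom)

/-- A colinear map whose range is contained in that of an injective colinear map factors
through it. -/
theorem exists_factor_of_range_le {P K N : RightComodule R D} (g : P ⟶ N) (i : K ⟶ N)
    (hi : Function.Injective i.hom) (h : ∀ x, g.hom x ∈ LinearMap.range i.hom) :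
    ∃ l : P ⟶ K, l ≫ i = g := by
  let l : P.carrier →ₗ[R] K.carrier := (LinearEquiv.ofInjective i.hom hi).symm.toLinearMap ∘ₗ
    LinearMap.codRestrict _ g.hom h
  have hl : i.hom ∘ₗ l = g.hom := by
    ext x
    exact congrArg Subtype.val (LinearEquiv.apply_symm_apply (LinearEquiv.ofInjective i.hom hi) _)
  refine ⟨⟨l, ?_⟩, hom_ext hl⟩
  -- Colinearity of `l` is tested after the map `i ⊗ D`, injective by flatness.
  have hi2 := Module.Flat.rTensor_preserves_injective_linearMap (M := D) i.hom hi
  refine LinearMap.cancel_left hi2 |>.1 ?_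
  rw [← LinearMap.comp_assoc, ← i.colinear, LinearMap.comp_assoc, hl, ← LinearMap.comp_assoc,
    ← LinearMap.rTensor_comp, hl, g.colinear]

end Kernels

theorem mono_of_injective {M N : RightComodule R D} (f : M ⟶ N) (hf : Function.Injective f.hom) :
    Mono f where
  right_cancellation g h e := by
    ext x
    exact hf (LinearMap.congr_fun (congrArg Hom.hom e) x)

theorem epi_of_surjective {M N : RightComodule R D} (f : M ⟶ N) (hf : Function.Surjective f.hom) :
    Epi f where
  left_cancellation g h e := by
    ext x
    obtain ⟨y, rfl⟩ := hf x
    exact LinearMap.congr_fun (congrArg Hom.hom e) y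

/-- A bijective colinear map is an isomorphism. -/
noncomputable def isoOfBijective {M N : RightComodule R D} (f : M ⟶ N)
    (hf : Function.Bijective f.hom) : M ≅ N where
  hom := f
  inv := ⟨(LinearEquiv.ofBijective f.hom hf).symm.toLinearMap, by
    have h : f.hom ∘ₗ (LinearEquiv.ofBijective f.hom hf).symm.toLinearMap = LinearMap.id := by
      ext x
      exact LinearEquiv.apply_symm_apply (LinearEquiv.ofBijective f.hom hf) x
    have h' : (LinearEquiv.ofBijective f.hom hf).symm.toLinearMap ∘ₗ f.hom = LinearMap.id := by
      ext x
      exact LinearEquiv.symm_apply_apply (LinearEquiv.ofBijective f.hom hf) x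
    calc M.coact ∘ₗ (LinearEquiv.ofBijective f.hom hf).symm.toLinearMap
        = ((LinearEquiv.ofBijective f.hom hf).symm.toLinearMap ∘ₗ f.hom).rTensor D ∘ₗ
            M.coact ∘ₗ (LinearEquiv.ofBijective f.hom hf).symm.toLinearMap := by
          rw [h', LinearMap.rTensor_id, LinearMap.id_comp]
      _ = (LinearEquiv.ofBijective f.hom hf).symm.toLinearMap.rTensor D ∘ₗ
            (N.coact ∘ₗ f.hom) ∘ₗ (LinearEquiv.ofBijective f.hom hf).symm.toLinearMap := by
          rw [f.colinear, LinearMap.rTensor_comp]; rfl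
      _ = _ := by rw [LinearMap.comp_assoc, h, LinearMap.comp_id]⟩
  hom_inv_id := by
    ext x
    exact LinearEquiv.symm_apply_apply (LinearEquiv.ofBijective f.hom hf) x
  inv_hom_id := by
    ext x
    exact LinearEquiv.apply_symm_apply (LinearEquiv.ofBijective f.hom hf) x

/-- A colinear map that vanishes on the kernel of a surjective colinear map factors through it. -/
theorem exists_factor_of_ker_le {M Q P : RightComodule R D} (q : M ⟶ Q)
    (hq : Function.Surjective q.hom) (g : M ⟶ P) (h : ∀ x, q.hom x = 0 → g.hom x = 0) :
    ∃ l : Q ⟶ P, q ≫ l = g := by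
  obtain ⟨s, hs⟩ := hq.hasRightInverse
  have hker : ∀ x y, q.hom x = q.hom y → g.hom x = g.hom y := fun x y e => by
    rw [← sub_eq_zero, ← map_sub]
    exact h _ (by rw [map_sub, e, sub_self])
  let l : Q.carrier →ₗ[R] P.carrier :=
    { toFun := fun y => g.hom (s y)
      map_add' := fun a b => by
        rw [← map_add]
        exact hker _ _ (by rw [map_add, hs, hs, hs])
      map_smul' := fun r a => by
        rw [RingHom.id_apply, ← map_smul]
        exact hker _ _ (by rw [map_smul, hs, hs]) }
  have hl : l ∘ₗ q.hom = g.hom := by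
    ext x
    exact hker _ _ (hs _)
  refine ⟨⟨l, ?_⟩, hom_ext hl⟩
  refine LinearMap.cancel_right hq |>.1 ?_
  rw [LinearMap.comp_assoc, LinearMap.comp_assoc, hl, q.colinear, ← LinearMap.comp_assoc,
    ← LinearMap.rTensor_comp, hl, g.colinear]

/-- The coaction on the cokernel of a colinear map. -/
noncomputable def cokernelCoact {M N : RightComodule R D} (f : M ⟶ N) :
    (N.carrier ⧸ LinearMap.range f.hom) →ₗ[R] (N.carrier ⧸ LinearMap.range f.hom) ⊗[R] D :=
  (LinearMap.range f.hom).liftQ ((LinearMap.range f.hom).mkQ.rTensor D ∘ₗ N.coact) (by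
    rintro _ ⟨x, rfl⟩
    rw [LinearMap.mem_ker, LinearMap.comp_apply, colinear_apply, ← LinearMap.rTensor_comp_apply,
      LinearMap.range_mkQ_comp, LinearMap.rTensor_zero, LinearMap.zero_apply])

theorem cokernelCoact_comp {M N : RightComodule R D} (f : M ⟶ N) :
    cokernelCoact f ∘ₗ (LinearMap.range f.hom).mkQ =
      (LinearMap.range f.hom).mkQ.rTensor D ∘ₗ N.coact :=
  Submodule.liftQ_mkQ _ _ _

/-- The cokernel of a colinear map. -/
noncomputable abbrev cokernel {M N : RightComodule R D} (f : M ⟶ N) : RightComodule R D where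
  carrier := N.carrier ⧸ LinearMap.range f.hom
  coact := cokernelCoact f
  coassoc := by
    have hκ : ∀ x, cokernelCoact f ((LinearMap.range f.hom).mkQ x) =
      (LinearMap.range f.hom).mkQ.rTensor D (N.coact x) :=
      LinearMap.congr_fun (cokernelCoact_comp f)
    refine LinearMap.cancel_right (Submodule.mkQ_surjective _) |>.1 (LinearMap.ext fun x => ?_)
    simp only [LinearMap.comp_apply, LinearEquiv.coe_coe]
    rw [hκ, ← LinearMap.rTensor_comp_apply, cokernelCoact_comp, LinearMap.rTensor_comp_apply,
      assoc_rTensor_rTensor, coassoc_apply, lTensor_rTensor_apply]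
  counit := by
    have hκ : ∀ x, cokernelCoact f ((LinearMap.range f.hom).mkQ x) =
      (LinearMap.range f.hom).mkQ.rTensor D (N.coact x) :=
      LinearMap.congr_fun (cokernelCoact_comp f)
    refine LinearMap.cancel_right (Submodule.mkQ_surjective _) |>.1 (LinearMap.ext fun x => ?_)
    simp only [LinearMap.comp_apply]
    rw [hκ, lTensor_rTensor_apply, counit_apply]
    rfl

/-- The projection to the cokernel of a colinear map. -/
noncomputable abbrev cokernelπ {M N : RightComodule R D} (f : M ⟶ N) : N ⟶ cokernel f where
  hom := (LinearMap.range f.hom).mkQ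
  colinear := cokernelCoact_comp f

end RightComodule

/-! ### Cohom modules by their universal property, and exactness of `h(X, -)` for an injector `X`.
-/

namespace RightComodule

/-- The colinear map `k ⊗ id : V ⊗ X → W ⊗ X`. -/
abbrev tensorHom (X : RightComodule R D) {V W : Type u} [AddCommGroup V] [Module R V]
    [AddCommGroup W] [Module R W] (k : V →ₗ[R] W) : X.tensor V ⟶ X.tensor W :=
  ⟨k.rTensor X.carrier, X.tensor_colinear k⟩

/-- The colinear map `M → W ⊗ M` that sends `m` to `w ⊗ m`. -/
abbrev inclTensor (M : RightComodule R D) {W : Type u} [AddCommGroup W] [Module R W] (w : W) :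
    M ⟶ M.tensor W where
  hom := TensorProduct.mk R W M.carrier w
  colinear := by
    ext m
    have : (TensorProduct.assoc R W M.carrier D).symm.toLinearMap ∘ₗ
        TensorProduct.mk R W (M.carrier ⊗[R] D) w =
        (TensorProduct.mk R W M.carrier w).rTensor D := by
      ext; simp
    exact LinearMap.congr_fun this (M.coact m)

/-- The coalgebra `D` as a right comodule over itself. -/
abbrev regular (R : Type u) [CommRing R] (D : Type u) [AddCommGroup D] [Module R D]
    [Coalgebra R D] : RightComodule R D where
  carrier := D
  coact := Coalgebra.comul
  coassoc := Coalgebra.coassoc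
  counit := Coalgebra.lTensor_counit_comp_comul

/-- The coaction of a comodule `M` as a colinear map `M → M ⊗ D`. -/
abbrev coactHom (M : RightComodule R D) : M ⟶ (regular R D).tensor M.carrier where
  hom := M.coact
  colinear := by
    ext m
    change (TensorProduct.assoc R M.carrier D D).symm _ = _
    rw [LinearEquiv.symm_apply_eq]
    exact (M.coassoc_apply m).symm

/-- The counit supplies a linear retraction of the coaction. -/
theorem coact_injective (M : RightComodule R D) : Function.Injective M.coact := by
  intro x y h
  have e := congrArg (TensorProduct.rid R M.carrier)
    (congrArg ((Coalgebra.counit (R := R) (A := D)).lTensor M.carrier) h)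
  simpa only [counit_apply, TensorProduct.rid_tmul, one_smul] using e

/-- The colinear map `M → V ⊗ X` exhibits `V` as the cohom module `h(X, M)`. -/
structure IsCohom {X M : RightComodule R D} {V : Type u} [AddCommGroup V] [Module R V]
    (η : M ⟶ X.tensor V) : Prop where
  exists_lift : ∀ {W : Type u} [AddCommGroup W] [Module R W] (f : M ⟶ X.tensor W),
    ∃ k : V →ₗ[R] W, k.rTensor X.carrier ∘ₗ η.hom = f.hom
  hom_ext : ∀ {W : Type u} [AddCommGroup W] [Module R W] {k k' : V →ₗ[R] W},
    (∀ x, k.rTensor X.carrier (η.hom x) = k'.rTensor X.carrier (η.hom x)) → k = k'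

/-- The unit of adjunction `M → h(X, M) ⊗ X`. -/
noncomputable def cohomUnit (X : RightComodule R D) [X.IsQuasiFinite] (M : RightComodule R D) :
    M ⟶ X.tensor (X.cohom.obj M) :=
  X.cohomAdj.unit.app M

theorem isCohom_unit (X : RightComodule R D) [X.IsQuasiFinite] (M : RightComodule R D) :
    IsCohom (X.cohomUnit M) where
  exists_lift {W} _ _ f := by
    refine ⟨((X.cohomAdj.homEquiv M (ModuleCat.of R W)).symm f).hom, ?_⟩
    have h := (X.cohomAdj.homEquiv M (ModuleCat.of R W)).apply_symm_apply f
    rw [Adjunction.homEquiv_unit] at h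
    exact congrArg Hom.hom h
  hom_ext {W} _ _ f g h := by
    have h' : (X.cohomAdj.homEquiv M (ModuleCat.of R W)) (ModuleCat.ofHom f) =
        (X.cohomAdj.homEquiv M (ModuleCat.of R W)) (ModuleCat.ofHom g) := by
      rw [Adjunction.homEquiv_unit, Adjunction.homEquiv_unit]
      exact RightComodule.hom_ext (LinearMap.ext h)
    exact congrArg ModuleCat.Hom.hom ((X.cohomAdj.homEquiv M (ModuleCat.of R W)).injective h')

theorem isCohom_coendUnit (X : RightComodule R D) [X.IsQuasiFinite] : IsCohom X.coendUnit where
  exists_lift f := ⟨X.coendLift f, X.coendLift_spec f⟩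
  hom_ext h := X.coend_hom_ext h

namespace IsCohom

section

variable {X M N P : RightComodule R D} {V V' V'' W : Type u} [AddCommGroup V] [Module R V]
  [AddCommGroup V'] [Module R V'] [AddCommGroup V''] [Module R V''] [AddCommGroup W] [Module R W]
  {η : M ⟶ X.tensor V} {η' : N ⟶ X.tensor V'} {η'' : P ⟶ X.tensor V''}

/-- The linear map `h(X, M) → W` that corresponds to a colinear map `M → W ⊗ X`. -/
noncomputable def lift (h : IsCohom η) (f : M ⟶ X.tensor W) : V →ₗ[R] W :=
  (h.exists_lift f).choose

theorem lift_apply (h : IsCohom η) (f : M ⟶ X.tensor W) (x : M.carrier) :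
    (h.lift f).rTensor X.carrier (η.hom x) = f.hom x :=
  LinearMap.congr_fun (h.exists_lift f).choose_spec x

theorem lift_comp (h : IsCohom η) (f : M ⟶ X.tensor W) : η ≫ X.tensorHom (h.lift f) = f :=
  RightComodule.hom_ext (h.exists_lift f).choose_spec

/-- The linear map `h(X, M) → h(X, N)` that corresponds to a colinear map `M → N`. -/
noncomputable def map (h : IsCohom η) (_h' : IsCohom η') (f : M ⟶ N) : V →ₗ[R] V' :=
  h.lift (f ≫ η')

theorem map_apply (h : IsCohom η) (h' : IsCohom η') (f : M ⟶ N) (x : M.carrier) :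
    (h.map h' f).rTensor X.carrier (η.hom x) = η'.hom (f.hom x) :=
  h.lift_apply _ x

theorem eq_map (h : IsCohom η) (h' : IsCohom η') (f : M ⟶ N) {k : V →ₗ[R] V'}
    (hk : ∀ x, k.rTensor X.carrier (η.hom x) = η'.hom (f.hom x)) : k = h.map h' f :=
  h.hom_ext fun x => by rw [hk, map_apply]

theorem map_id (h : IsCohom η) : h.map h (𝟙 M) = LinearMap.id :=
  (h.eq_map _ _ fun x => by simp).symm

theorem map_comp (h : IsCohom η) (h' : IsCohom η') (h'' : IsCohom η'') (f : M ⟶ N)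
    (g : N ⟶ P) : h.map h'' (f ≫ g) = h'.map h'' g ∘ₗ h.map h' f :=
  (h.eq_map _ _ fun x => by
    rw [LinearMap.rTensor_comp_apply, map_apply, map_apply]
    rfl).symm

/-- Embed `V = h(X, M)` in an injective module `Q` by `j`. Then `Q ⊗ X` is an injective comodule, so
`M → V ⊗ X → Q ⊗ X` extends along `f` to `N`. The extension corresponds to a map `h(X, N) → Q`, and
its composite with `h(X, f)` is `j`. -/
theorem map_injective (hX : X.IsInjector) (h : IsCohom η) (h' : IsCohom η') (f : M ⟶ N)
    (hf : Function.Injective f.hom) : Function.Injective (h.map h' f) := by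
  let Q := Injective.under (ModuleCat.of R V)
  let j : V →ₗ[R] Q := (Injective.ι (ModuleCat.of R V)).hom
  have hj : Function.Injective j := (ModuleCat.mono_iff_injective _).1 inferInstance
  have hQ : Injective (X.tensor Q) := hX.injective_obj (X := Q) inferInstance
  have hmono : Mono f := mono_of_injective f hf
  let e : N ⟶ X.tensor Q := Injective.factorThru (η ≫ X.tensorHom j) f
  have he : f ≫ e = η ≫ X.tensorHom j := Injective.comp_factorThru _ _
  have key : h'.lift e ∘ₗ h.map h' f = j := by
    apply h.hom_ext
    intro x
    rw [LinearMap.rTensor_comp_apply, map_apply, lift_apply]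
    exact LinearMap.congr_fun (congrArg Hom.hom he) x
  rw [← key] at hj
  exact Function.Injective.of_comp hj

/-- For an injector, the cohom functor is exact. -/
theorem map_exact (hX : X.IsInjector) [X.IsQuasiFinite] (h : IsCohom η)
    (h' : IsCohom η') (h'' : IsCohom η'') (i : M ⟶ N) (f : N ⟶ P)
    (hif : Function.Exact i.hom f.hom) : Function.Exact (h.map h' i) (h'.map h'' f) := by
  have hzero : i ≫ f = 0 := by
    ext x
    exact hif.apply_apply_eq_zero x
  intro v
  constructor
  · intro hv
    -- By exactness the cokernel of `i` embeds in `P` through `l`, and `h(X, l)` is injective. So an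
    -- element killed by `h(X, f)` is already killed by `h(X, -)` of the cokernel projection.
    have hQ := isCohom_unit X (cokernel i)
    have hker : ∀ y, (cokernelπ i).hom y = 0 → y ∈ LinearMap.range i.hom :=
      fun y hy => (Submodule.Quotient.mk_eq_zero _).1 hy
    obtain ⟨l, hl⟩ := exists_factor_of_ker_le (cokernelπ i) (Submodule.mkQ_surjective _) f
      (fun y hy => by
        obtain ⟨x, rfl⟩ := hker y hy
        exact hif.apply_apply_eq_zero x)
    have hlinj : Function.Injective l.hom := by
      rw [← LinearMap.ker_eq_bot, Submodule.eq_bot_iff]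
      intro q hq
      obtain ⟨y, rfl⟩ := Submodule.mkQ_surjective _ q
      have hy : f.hom y = 0 := by
        rw [← hl]
        exact hq
      exact (Submodule.Quotient.mk_eq_zero _).2 ((hif y).1 hy)
    -- Right exactness from the universal property: composed with the quotient of `V'` by the image
    -- of `h(X, i)`, the map `η'` vanishes on the image of `i` and descends to the cokernel. Hence
    -- that quotient map factors through `h(X, coker i)`.
    obtain ⟨m, hm⟩ := exists_factor_of_ker_le (cokernelπ i) (Submodule.mkQ_surjective _)
      (η' ≫ X.tensorHom (LinearMap.range (h.map h' i)).mkQ) (fun y hy => by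
        obtain ⟨x, rfl⟩ := hker y hy
        change (LinearMap.range (h.map h' i)).mkQ.rTensor X.carrier (η'.hom (i.hom x)) = 0
        rw [← h.map_apply h', ← LinearMap.rTensor_comp_apply, LinearMap.range_mkQ_comp]
        simp)
    have h1 : hQ.lift m ∘ₗ h'.map hQ (cokernelπ i) = (LinearMap.range (h.map h' i)).mkQ := by
      apply h'.hom_ext
      intro y
      rw [LinearMap.rTensor_comp_apply, map_apply, lift_apply]
      exact LinearMap.congr_fun (congrArg Hom.hom hm) y
    have h2 : h'.map hQ (cokernelπ i) v = 0 := by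
      apply hQ.map_injective hX h'' l hlinj
      rw [map_zero, ← hv, ← hl, map_comp h' hQ h'']
      rfl
    have h3 : (LinearMap.range (h.map h' i)).mkQ v = 0 := by
      rw [← h1, LinearMap.comp_apply, h2, map_zero]
    exact (Submodule.Quotient.mk_eq_zero _).1 h3
  · rintro ⟨w, rfl⟩
    rw [← LinearMap.comp_apply, ← map_comp h h' h'']
    have : h.map h'' (i ≫ f) = 0 := by
      symm
      apply h.eq_map
      intro x
      rw [hzero]
      simp
    rw [this, LinearMap.zero_apply]

/-- The cohom modules of two universal maps are isomorphic. -/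
noncomputable def equiv {η' : M ⟶ X.tensor V'} (h : IsCohom η) (h' : IsCohom η') : V ≃ₗ[R] V' :=
  LinearEquiv.ofLinearMap (h.lift η') (h'.lift η)
    (h'.hom_ext fun x => by
      rw [LinearMap.rTensor_comp_apply, lift_apply, lift_apply, LinearMap.rTensor_id,
        LinearMap.id_apply])
    (h.hom_ext fun x => by
      rw [LinearMap.rTensor_comp_apply, lift_apply, lift_apply, LinearMap.rTensor_id,
        LinearMap.id_apply])

theorem of_equiv (h : IsCohom η) (e : V ≃ₗ[R] V') : IsCohom (η ≫ X.tensorHom e.toLinearMap) where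
  exists_lift f := ⟨h.lift f ∘ₗ e.symm.toLinearMap, by
    ext x
    change (h.lift f ∘ₗ e.symm.toLinearMap).rTensor X.carrier
      (e.toLinearMap.rTensor X.carrier (η.hom x)) = f.hom x
    rw [← LinearMap.rTensor_comp_apply, LinearMap.comp_assoc, LinearEquiv.symm_comp,
      LinearMap.comp_id, lift_apply]⟩
  hom_ext {W} _ _ k k' hk := by
    refine LinearMap.cancel_right e.surjective |>.1 (h.hom_ext fun x => ?_)
    rw [LinearMap.rTensor_comp_apply, LinearMap.rTensor_comp_apply]
    exact hk x

end

section Tensor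

variable {X M : RightComodule R D} {V : Type u} [AddCommGroup V] [Module R V]
  {η : M ⟶ X.tensor V}

/-- `h(X, W ⊗ M) = W ⊗ h(X, M)`. -/
theorem tensor (h : IsCohom η) (W : Type u) [AddCommGroup W] [Module R W] :
    IsCohom (tensorMap W η ≫ X.tensorAssoc W V) := by
  have key : ∀ {U : Type u} [AddCommGroup U] [Module R U] (k : W ⊗[R] V →ₗ[R] U) (w : W)
      (z : V ⊗[R] X.carrier), k.rTensor X.carrier ((TensorProduct.assoc R W V X.carrier).symm
        (w ⊗ₜ z)) = (k ∘ₗ TensorProduct.mk R W V w).rTensor X.carrier z := by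
    intro U _ _ k w z
    rw [LinearMap.rTensor_comp_apply]
    rfl
  constructor
  · intro U _ _ f
    have hspec := fun w : W => h.lift_apply (M.inclTensor w ≫ f)
    -- For fixed `w`, restrict `f` to `w ⊗ M` and lift; uniqueness of lifts makes the result linear
    -- in `w`.
    let k : W →ₗ[R] V →ₗ[R] U :=
      { toFun := fun w => h.lift (M.inclTensor w ≫ f)
        map_add' := fun a b => h.hom_ext fun x => by
          rw [LinearMap.rTensor_add, LinearMap.add_apply, hspec, hspec, hspec]
          simp
        map_smul' := fun r a => h.hom_ext fun x => by
          rw [LinearMap.rTensor_smul, LinearMap.smul_apply, hspec, hspec]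
          exact f.hom.map_smul r (a ⊗ₜ x) }
    refine ⟨TensorProduct.lift k, ?_⟩
    apply TensorProduct.ext'
    intro w m
    change (TensorProduct.lift k).rTensor X.carrier
      ((TensorProduct.assoc R W V X.carrier).symm (w ⊗ₜ η.hom m)) = f.hom (w ⊗ₜ m)
    rw [key]
    have : TensorProduct.lift k ∘ₗ TensorProduct.mk R W V w = h.lift (M.inclTensor w ≫ f) := by
      ext v
      simp [k]
    rw [this, hspec]
    rfl
  · intro U _ _ k k' hk
    apply TensorProduct.ext
    apply LinearMap.ext
    intro w
    change k ∘ₗ TensorProduct.mk R W V w = k' ∘ₗ TensorProduct.mk R W V w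
    apply h.hom_ext
    intro m
    rw [← key, ← key]
    exact hk (w ⊗ₜ m)

theorem tensor_apply (η : M ⟶ X.tensor V) (W : Type u) [AddCommGroup W] [Module R W]
    (z : W ⊗[R] M.carrier) : (tensorMap W η ≫ X.tensorAssoc W V).hom z =
      (TensorProduct.assoc R W V X.carrier).symm (η.hom.lTensor W z) := rfl

end Tensor

end IsCohom

end RightComodule

/-- The left coaction of a bicomodule as a right colinear map. -/
abbrev Bicomodule.lcoactHom (X : Bicomodule R C D) : X.right ⟶ X.right.tensor C where
  hom := X.lcoact
  colinear := by
    ext x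
    have := LinearMap.congr_fun X.bicolinear x
    exact (TensorProduct.assoc R C X.carrier D).symm_apply_eq.2 this.symm

/-! ### Flat cogenerators, and the coaction of `C` on `h(X, M)` for a `C`-`D`-bicomodule `X`. -/

section Coherence

variable {A B F G : Type u} [AddCommGroup A] [Module R A] [AddCommGroup B] [Module R B]
  [AddCommGroup F] [Module R F] [AddCommGroup G] [Module R G]

/-- A form of the pentagon identity. -/
theorem assoc_rTensor_assoc_symm (z : A ⊗[R] ((B ⊗[R] F) ⊗[R] G)) :
    (TensorProduct.assoc R A B F).toLinearMap.rTensor G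
      ((TensorProduct.assoc R (A ⊗[R] B) F G).symm ((TensorProduct.assoc R A B (F ⊗[R] G)).symm
        ((TensorProduct.assoc R B F G).toLinearMap.lTensor A z))) =
      (TensorProduct.assoc R A (B ⊗[R] F) G).symm z := by
  have : (TensorProduct.assoc R A B F).toLinearMap.rTensor G ∘ₗ
      (TensorProduct.assoc R (A ⊗[R] B) F G).symm.toLinearMap ∘ₗ
      (TensorProduct.assoc R A B (F ⊗[R] G)).symm.toLinearMap ∘ₗ
      (TensorProduct.assoc R B F G).toLinearMap.lTensor A =
      (TensorProduct.assoc R A (B ⊗[R] F) G).symm.toLinearMap := by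
    ext; simp
  exact LinearMap.congr_fun this z

theorem assoc_symm_lTensor_mk (z : A ⊗[R] B) :
    (TensorProduct.assoc R A R B).symm ((TensorProduct.mk R R B 1).lTensor A z) =
      ((TensorProduct.mk R A R).flip 1).rTensor B z := by
  have : (TensorProduct.assoc R A R B).symm.toLinearMap ∘ₗ (TensorProduct.mk R R B 1).lTensor A =
      ((TensorProduct.mk R A R).flip 1).rTensor B := by
    ext; simp
  exact LinearMap.congr_fun this z

end Coherence

namespace Bicomodule

theorem lcoassoc_apply (X : Bicomodule R C D) (x : X.carrier) :
    X.lcoact.lTensor C (X.lcoact x) = TensorProduct.assoc R C C X.carrier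
      ((Coalgebra.comul (R := R) (A := C)).rTensor X.carrier (X.lcoact x)) :=
  (LinearMap.congr_fun X.lcoassoc x).symm

theorem lcounit_apply (X : Bicomodule R C D) (x : X.carrier) :
    (Coalgebra.counit (R := R) (A := C)).rTensor X.carrier (X.lcoact x) = 1 ⊗ₜ x :=
  LinearMap.congr_fun X.lcounit x

end Bicomodule

namespace RightComodule

/-- The right `D`-comodule `X` is quasi-finite, flat and an injector, and it cogenerates the
category of right `D`-comodules. -/
structure IsFlatCogenerator (X : RightComodule R D) : Prop where
  isQuasiFinite : X.IsQuasiFinite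
  isInjector : X.IsInjector
  flat : Module.Flat R X.carrier
  cogenerates : ∀ M : RightComodule R D, ∃ W : ModuleCat.{u} R, ∃ f : M ⟶ X.tensor W,
    Function.Injective f.hom

/-- Every colinear map `M → W ⊗ X` factors through `η`, and cogeneration provides one that is
injective. -/
theorem IsCohom.injective {X M : RightComodule R D} {V : Type u} [AddCommGroup V] [Module R V]
    {η : M ⟶ X.tensor V} (h : IsCohom η) (hX : X.IsFlatCogenerator) :
    Function.Injective η.hom := by
  obtain ⟨W, f, hf⟩ := hX.cogenerates M
  intro x y hxy
  apply hf
  rw [← h.lift_apply f, ← h.lift_apply f, hxy]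

/-- A coalgebra isomorphism `e(X) ≃ C` makes `X` a `C`-`D`-bicomodule. -/
theorem exists_bicomodule {X : RightComodule R D} (hX : X.IsMoritaTakeuchi C) :
    ∃ B : Bicomodule R C D, B.right = X ∧ IsCohom B.lcoactHom := by
  obtain ⟨hq, -, -, ⟨e⟩⟩ := hX
  have hcomul : TensorProduct.map e.toCoalgHom.toLinearMap e.toCoalgHom.toLinearMap ∘ₗ
    Coalgebra.comul = Coalgebra.comul ∘ₗ e.toCoalgHom.toLinearMap := e.toCoalgHom.map_comp_comul
  have hcounit : Coalgebra.counit ∘ₗ e.toCoalgHom.toLinearMap = Coalgebra.counit :=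
    e.toCoalgHom.counit_comp
  set f : X.Coend →ₗ[R] C := e.toCoalgHom.toLinearMap with hf
  refine ⟨{ carrier := X.carrier
            rcoact := X.coact
            rcoassoc := X.coassoc
            rcounit := X.counit
            lcoact := f.rTensor X.carrier ∘ₗ X.coendCoact
            lcoassoc := ?_
            lcounit := ?_
            bicolinear := ?_ }, rfl, ?_⟩
  · ext x
    simp only [LinearMap.comp_apply, LinearEquiv.coe_coe]
    rw [← LinearMap.rTensor_comp_apply, ← hcomul]
    have h1 : TensorProduct.map f f = f.rTensor C ∘ₗ f.lTensor X.Coend :=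
      (LinearMap.rTensor_comp_lTensor _ _ _).symm
    rw [h1, LinearMap.rTensor_comp_apply, LinearMap.rTensor_comp_apply]
    change TensorProduct.assoc R C C X.carrier ((f.rTensor C).rTensor X.carrier
      ((f.lTensor X.Coend).rTensor X.carrier (X.coendComul.rTensor X.carrier
        (X.coendCoact x)))) = _
    rw [coendComul_spec, assoc_rTensor_rTensor, assoc_lTensor_rTensor,
      LinearEquiv.apply_symm_apply, ← lTensor_rTensor_apply, lTensor_rTensor_apply,
      lTensor_rTensor_apply, LinearMap.lTensor_comp_apply]
  · ext x
    rw [LinearMap.comp_apply, LinearMap.comp_apply, ← LinearMap.rTensor_comp_apply, hcounit]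
    exact X.coendCounit_spec x
  · have h := (X.coendUnit ≫ X.tensorHom f).colinear
    ext x
    exact ((TensorProduct.assoc R C X.carrier D).symm_apply_eq.1 (LinearMap.congr_fun h x)).symm
  · exact X.isCohom_coendUnit.of_equiv e.toLinearEquiv

end RightComodule

namespace RightComodule.IsCohom

section

variable {X : Bicomodule R C D} {M N : RightComodule R D} {V V' : Type u} [AddCommGroup V]
  [Module R V] [AddCommGroup V'] [Module R V'] {η : M ⟶ X.right.tensor V} {η' : N ⟶ X.right.tensor V'}

/-- The coaction of `C` on `h(X, M)`. -/
noncomputable def coact (h : IsCohom (X := X.right) η) : V →ₗ[R] V ⊗[R] C :=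
  h.lift (η ≫ tensorMap V X.lcoactHom ≫ X.right.tensorAssoc V C)

theorem coact_apply (h : IsCohom (X := X.right) η) (x : M.carrier) :
    h.coact.rTensor X.carrier (η.hom x) =
      (TensorProduct.assoc R V C X.carrier).symm (X.lcoact.lTensor V (η.hom x)) :=
  h.lift_apply _ x

/-- The right `C`-comodule `h(X, M)`. -/
noncomputable abbrev comodule (h : IsCohom (X := X.right) η) : RightComodule R C where
  carrier := V
  coact := h.coact
  coassoc := by
    apply h.hom_ext
    intro x
    change _ = ((Coalgebra.comul (R := R) (A := C)).lTensor V ∘ₗ h.coact).rTensor X.carrier _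
    rw [LinearMap.rTensor_comp_apply, LinearMap.rTensor_comp_apply, LinearMap.rTensor_comp_apply]
    change (TensorProduct.assoc R V C C).toLinearMap.rTensor X.carrier
      ((h.coact.rTensor C).rTensor X.carrier (h.coact.rTensor X.carrier (η.hom x))) =
      ((Coalgebra.comul (R := R) (A := C)).lTensor V).rTensor X.carrier
        (h.coact.rTensor X.carrier (η.hom x))
    rw [coact_apply, ← assoc_symm_rTensor, ← lTensor_rTensor_apply, coact_apply,
      ← assoc_symm_lTensor_lTensor, ← LinearMap.lTensor_comp_apply]
    have hl : X.lcoact.lTensor C ∘ₗ X.lcoact = (TensorProduct.assoc R C C X.carrier).toLinearMap ∘ₗ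
      (Coalgebra.comul (R := R) (A := C)).rTensor X.carrier ∘ₗ X.lcoact := X.lcoassoc.symm
    rw [hl, LinearMap.lTensor_comp_apply, assoc_rTensor_assoc_symm, LinearMap.lTensor_comp_apply,
      assoc_symm_rTensor_lTensor]
  counit := by
    apply h.hom_ext
    intro x
    change ((Coalgebra.counit (R := R) (A := C)).lTensor V ∘ₗ h.coact).rTensor X.carrier
      (η.hom x) = ((TensorProduct.mk R V R).flip 1).rTensor X.carrier (η.hom x)
    rw [LinearMap.rTensor_comp_apply, coact_apply, ← assoc_symm_rTensor_lTensor,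
      ← LinearMap.lTensor_comp_apply, X.lcounit, assoc_symm_lTensor_mk]

/-- The colinear map `h(X, M) → h(X, N)` that corresponds to a colinear map `M → N`. -/
noncomputable abbrev mapHom (h : IsCohom (X := X.right) η) (h' : IsCohom (X := X.right) η')
    (f : M ⟶ N) : h.comodule ⟶ h'.comodule where
  hom := h.map h' f
  colinear := by
    apply h.hom_ext
    intro x
    change (h'.coact ∘ₗ h.map h' f).rTensor X.carrier (η.hom x) =
      ((h.map h' f).rTensor C ∘ₗ h.coact).rTensor X.carrier (η.hom x)
    rw [LinearMap.rTensor_comp_apply, LinearMap.rTensor_comp_apply, h.coact_apply, h.map_apply,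
      h'.coact_apply, ← assoc_symm_rTensor, ← lTensor_rTensor_apply, h.map_apply]

end

end RightComodule.IsCohom

namespace Bicomodule

variable (X : Bicomodule R C D)

/-- The colinear map `N ⊗ X → N ⊗ C ⊗ X` whose kernel is `N □ X`. -/
noncomputable def cotensorHom (N : RightComodule R C) :
    X.right.tensor N.carrier ⟶ X.right.tensor (N.carrier ⊗[R] C) :=
  X.right.tensorHom N.coact - (RightComodule.tensorMap N.carrier X.lcoactHom ≫
    X.right.tensorAssoc N.carrier C)

theorem cotensorHom_apply (N : RightComodule R C) (z : N.carrier ⊗[R] X.carrier) :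
    (X.cotensorHom N).hom z = N.coact.rTensor X.carrier z -
      (TensorProduct.assoc R N.carrier C X.carrier).symm (X.lcoact.lTensor N.carrier z) := by
  rw [cotensorHom, sub_eq_add_neg, sub_eq_add_neg]
  rfl

end Bicomodule

/-! ### The functor `h(X, -)` is an equivalence with quasi-inverse `- □ X`. -/

namespace RightComodule

theorem Equivalent.symm (h : Equivalent R C D) : Equivalent R D C := by
  obtain ⟨F, hF, hadd, hlin⟩ := h
  have : F.asEquivalence.functor.Additive := hadd
  have : F.asEquivalence.functor.Linear R := hlin
  exact ⟨F.asEquivalence.inverse, inferInstance, inferInstance, inferInstance⟩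

/-- The functor `h(X, -)` from right `D`-comodules to right `C`-comodules. -/
noncomputable abbrev cohomFunctor (X : Bicomodule R C D) [X.right.IsQuasiFinite] :
    RightComodule R D ⥤ RightComodule R C where
  obj M := (isCohom_unit X.right M).comodule
  map {M N} f := (isCohom_unit X.right M).mapHom (isCohom_unit X.right N) f
  map_id M := hom_ext (isCohom_unit X.right M).map_id
  map_comp {M N P} f g := hom_ext ((isCohom_unit X.right M).map_comp (isCohom_unit X.right N)
    (isCohom_unit X.right P) f g)

instance (X : Bicomodule R C D) [X.right.IsQuasiFinite] : (cohomFunctor X).Additive where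
  map_add {M N f g} := by
    apply hom_ext
    have hM := isCohom_unit X.right M
    have hN := isCohom_unit X.right N
    refine (hM.eq_map hN (f + g) (k := hM.map hN f + hM.map hN g) fun x => ?_).symm
    rw [LinearMap.rTensor_add, LinearMap.add_apply, hM.map_apply, hM.map_apply, ← map_add]
    rfl

instance (X : Bicomodule R C D) [X.right.IsQuasiFinite] : (cohomFunctor X).Linear R where
  map_smul {M N} f r := by
    apply hom_ext
    have hM := isCohom_unit X.right M
    have hN := isCohom_unit X.right N
    refine (hM.eq_map hN (r • f) (k := r • hM.map hN f) fun x => ?_).symm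
    rw [LinearMap.rTensor_smul, LinearMap.smul_apply, hM.map_apply, ← map_smul]
    rfl

theorem cohomFunctor_faithful {X : Bicomodule R C D} (hX : X.right.IsFlatCogenerator)
    [X.right.IsQuasiFinite] : (cohomFunctor X).Faithful where
  map_injective {M N} f g hfg := by
    ext x
    apply (isCohom_unit X.right N).injective hX
    have hM := isCohom_unit X.right M
    have hN := isCohom_unit X.right N
    have e : hM.map hN f = hM.map hN g := congrArg Hom.hom hfg
    rw [← hM.map_apply hN, ← hM.map_apply hN, e]

/-- Let `π` be the projection to the cokernel of `f`. Then `h(X, π)` vanishes after the surjection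
`h(X, f)`, so it is zero. The universal map of the cokernel is injective, hence `π` itself is zero.
-/
theorem surjective_of_map_surjective {X : Bicomodule R C D} (hX : X.right.IsFlatCogenerator)
    {M N : RightComodule R D} {V V' : Type u} [AddCommGroup V] [Module R V]
    [AddCommGroup V'] [Module R V']
    {η : M ⟶ X.right.tensor V} {η' : N ⟶ X.right.tensor V'} (h : IsCohom (X := X.right) η)
    (h' : IsCohom (X := X.right) η') (f : M ⟶ N)
    (hf : Function.Surjective (h.map h' f)) : Function.Surjective f.hom := by
  have := hX.isQuasiFinite
  have hQ := isCohom_unit X.right (cokernel f)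
  have h0 : f ≫ cokernelπ f = 0 := hom_ext (LinearMap.range_mkQ_comp _)
  have h1 : h'.map hQ (cokernelπ f) = 0 := by
    refine LinearMap.cancel_right hf |>.1 ?_
    rw [← IsCohom.map_comp h h' hQ, h0, LinearMap.zero_comp]
    symm
    apply h.eq_map
    intro x
    simp
  intro y
  apply (Submodule.Quotient.mk_eq_zero (LinearMap.range f.hom)).1
  apply hQ.injective hX
  rw [map_zero]
  refine (h'.map_apply hQ (cokernelπ f) y).symm.trans ?_
  rw [h1]
  simp

section

variable [Module.Flat R D] {X : Bicomodule R C D}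

theorem kernelι_cotensorHom (N : RightComodule R C) (p : (kernel (X.cotensorHom N)).carrier) :
    N.coact.rTensor X.carrier ((kernelι (X.cotensorHom N)).hom p) =
      (TensorProduct.assoc R N.carrier C X.carrier).symm
        (X.lcoact.lTensor N.carrier ((kernelι (X.cotensorHom N)).hom p)) := by
  rw [← sub_eq_zero, ← Bicomodule.cotensorHom_apply]
  exact LinearMap.mem_ker.1 p.2

/-- The fork `N → N ⊗ C ⇉ N ⊗ C ⊗ C` is split by the counit: apply it to the last tensor factor on
both sides of `hz`. -/
theorem eq_coact_of_coact_rTensor_eq (N : RightComodule R C) (z : N.carrier ⊗[R] C)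
    (hz : N.coact.rTensor C z = (TensorProduct.assoc R N.carrier C C).symm
      ((Coalgebra.comul (R := R) (A := C)).lTensor N.carrier z)) :
    z = N.coact (TensorProduct.rid R N.carrier
      ((Coalgebra.counit (R := R) (A := C)).lTensor N.carrier z)) := by
  have e := congrArg (TensorProduct.rid R (N.carrier ⊗[R] C))
    (congrArg ((Coalgebra.counit (R := R) (A := C)).lTensor (N.carrier ⊗[R] C)) hz)
  rw [lTensor_rTensor_apply, ← assoc_symm_lTensor_lTensor, ← LinearMap.lTensor_comp_apply,
    Coalgebra.lTensor_counit_comp_comul] at e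
  have h1 : ∀ y : N.carrier ⊗[R] R, TensorProduct.rid R (N.carrier ⊗[R] C)
      (N.coact.rTensor R y) = N.coact (TensorProduct.rid R N.carrier y) := by
    intro y
    have : (TensorProduct.rid R (N.carrier ⊗[R] C)).toLinearMap ∘ₗ N.coact.rTensor R =
      N.coact ∘ₗ (TensorProduct.rid R N.carrier).toLinearMap := by ext; simp
    exact LinearMap.congr_fun this y
  have h2 : ∀ y : N.carrier ⊗[R] C, TensorProduct.rid R (N.carrier ⊗[R] C)
      ((TensorProduct.assoc R N.carrier C R).symm
        (((TensorProduct.mk R C R).flip 1).lTensor N.carrier y)) = y := by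
    intro y
    have : (TensorProduct.rid R (N.carrier ⊗[R] C)).toLinearMap ∘ₗ
      (TensorProduct.assoc R N.carrier C R).symm.toLinearMap ∘ₗ
        ((TensorProduct.mk R C R).flip 1).lTensor N.carrier = LinearMap.id := by ext; simp
    exact LinearMap.congr_fun this y
  rw [h1, h2] at e
  exact e.symm

section

variable {V : Type u} [AddCommGroup V] [Module R V] {N : RightComodule R C}
  {η : kernel (X.cotensorHom N) ⟶ X.right.tensor V}

/-- The counit `h(X, N □ X) → N`. -/
noncomputable abbrev cotensorCounit (h : IsCohom (X := X.right) η) : h.comodule ⟶ N where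
  hom := h.lift (kernelι (X.cotensorHom N))
  colinear := by
    apply h.hom_ext
    intro p
    change (N.coact ∘ₗ h.lift (kernelι (X.cotensorHom N))).rTensor X.carrier (η.hom p) =
      ((h.lift (kernelι (X.cotensorHom N))).rTensor C ∘ₗ h.coact).rTensor X.carrier (η.hom p)
    rw [LinearMap.rTensor_comp_apply, LinearMap.rTensor_comp_apply, h.coact_apply,
      h.lift_apply, ← assoc_symm_rTensor, ← lTensor_rTensor_apply, h.lift_apply]
    exact kernelι_cotensorHom N p

/-- Exactness of `h(X, -)` turns the sequence that defines `N □ X` into an exact sequence `0 → h(X,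
N □ X) → N ⊗ C → N ⊗ C ⊗ C`, since `h(X, W ⊗ X) = W ⊗ C`. Its first map is the coaction of `N` after
the counit `ε` (`e1`), its second is the difference `ρ_N ⊗ id - id ⊗ Δ` (`e2`), and the kernel of
the latter is the image of the coaction. -/
theorem cotensorCounit_bijective (hX : X.right.IsFlatCogenerator) (hC : IsCohom X.lcoactHom)
    (h : IsCohom (X := X.right) η) : Function.Bijective (cotensorCounit h).hom := by
  have := hX.isQuasiFinite
  set ε := h.lift (kernelι (X.cotensorHom N)) with hε
  have hN := hC.tensor N.carrier
  have hNC := hC.tensor (N.carrier ⊗[R] C)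
  have e1 : h.map hN (kernelι (X.cotensorHom N)) = N.coact ∘ₗ ε := by
    symm
    apply h.eq_map
    intro p
    change (N.coact ∘ₗ ε).rTensor X.carrier (η.hom p) = _
    rw [LinearMap.rTensor_comp_apply]
    refine (congrArg _ (h.lift_apply _ p)).trans ?_
    exact kernelι_cotensorHom N p
  have e2 : hN.map hNC (X.cotensorHom N) = N.coact.rTensor C -
      (TensorProduct.assoc R N.carrier C C).symm.toLinearMap ∘ₗ
        (Coalgebra.comul (R := R) (A := C)).lTensor N.carrier := by
    symm
    apply hN.eq_map
    intro z
    rw [LinearMap.rTensor_sub]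
    change (N.coact.rTensor C).rTensor X.carrier ((TensorProduct.assoc R N.carrier C
        X.carrier).symm (X.lcoact.lTensor N.carrier z)) -
      ((TensorProduct.assoc R N.carrier C C).symm.toLinearMap ∘ₗ
        (Coalgebra.comul (R := R) (A := C)).lTensor N.carrier).rTensor X.carrier
        ((TensorProduct.assoc R N.carrier C X.carrier).symm (X.lcoact.lTensor N.carrier z)) =
      (TensorProduct.assoc R _ C X.carrier).symm (X.lcoact.lTensor _ ((X.cotensorHom N).hom z))
    rw [X.cotensorHom_apply, map_sub, map_sub]
    congr 1
    · change (N.coact.rTensor C).rTensor X.carrier ((TensorProduct.assoc R N.carrier C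
        X.carrier).symm (X.lcoact.lTensor N.carrier z)) = (TensorProduct.assoc R _ C
        X.carrier).symm (X.lcoact.lTensor _ (N.coact.rTensor X.carrier z))
      rw [← assoc_symm_rTensor, lTensor_rTensor_apply]
    · rw [LinearMap.rTensor_comp_apply]
      change (TensorProduct.assoc R N.carrier C C).symm.toLinearMap.rTensor X.carrier
        (((Coalgebra.comul (R := R) (A := C)).lTensor N.carrier).rTensor X.carrier
          ((TensorProduct.assoc R N.carrier C X.carrier).symm (X.lcoact.lTensor N.carrier z))) =
        (TensorProduct.assoc R _ C X.carrier).symm (X.lcoact.lTensor _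
          ((TensorProduct.assoc R N.carrier C X.carrier).symm (X.lcoact.lTensor N.carrier z)))
      have hl : X.lcoact.lTensor C ∘ₗ X.lcoact = (TensorProduct.assoc R C C X.carrier).toLinearMap
        ∘ₗ (Coalgebra.comul (R := R) (A := C)).rTensor X.carrier ∘ₗ X.lcoact := X.lcoassoc.symm
      rw [← assoc_symm_rTensor_lTensor, ← assoc_symm_lTensor_lTensor,
        ← LinearMap.lTensor_comp_apply, ← LinearMap.lTensor_comp_apply, hl,
        LinearMap.lTensor_comp_apply N.carrier (TensorProduct.assoc R C C X.carrier).toLinearMap]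
      refine (congrArg _ (assoc_rTensor_assoc_symm _).symm).trans ?_
      rw [← LinearMap.rTensor_comp_apply, LinearEquiv.symm_comp, LinearMap.rTensor_id,
        LinearMap.id_apply]
  have hex := IsCohom.map_exact hX.isInjector h hN hNC (kernelι (X.cotensorHom N))
    (X.cotensorHom N) (LinearMap.exact_subtype_ker_map _)
  have hinj := IsCohom.map_injective hX.isInjector h hN (kernelι (X.cotensorHom N))
    (Submodule.injective_subtype _)
  rw [e1] at hinj hex
  rw [e2] at hex
  refine ⟨Function.Injective.of_comp hinj, fun n => ?_⟩
  -- By coassociativity the coaction of `n` lies in the kernel, so it equals the coaction of `ε v`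
  -- for some `v`; injectivity of the coaction gives `n = ε v`.
  obtain ⟨v, hv⟩ := (hex (N.coact n)).1 (by
    rw [LinearMap.sub_apply, sub_eq_zero, LinearMap.comp_apply, ← coassoc_apply]
    exact (LinearEquiv.symm_apply_apply _ _).symm)
  exact ⟨v, N.coact_injective hv⟩

end

theorem cohomFunctor_essSurj (hX : X.right.IsFlatCogenerator) (hC : IsCohom X.lcoactHom)
    [X.right.IsQuasiFinite] : (cohomFunctor X).EssSurj where
  mem_essImage N := ⟨kernel (X.cotensorHom N),
    ⟨isoOfBijective (cotensorCounit (isCohom_unit X.right (kernel (X.cotensorHom N))))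
      (cotensorCounit_bijective hX hC (isCohom_unit X.right (kernel (X.cotensorHom N))))⟩⟩

/-- The point is that the unit `j : N → h(X, N) □ X` is bijective. A map `φ : h(X, M) → h(X, N)`
then comes from `j⁻¹ ∘ g`, where `g : M → h(X, N) □ X` is its adjoint. -/
theorem cohomFunctor_full (hX : X.right.IsFlatCogenerator) (hC : IsCohom X.lcoactHom)
    [X.right.IsQuasiFinite] : (cohomFunctor X).Full where
  map_surjective {M N} φ := by
    have hM := isCohom_unit X.right M
    have hN := isCohom_unit X.right N
    have hP := isCohom_unit X.right (kernel (X.cotensorHom hN.comodule))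
    obtain ⟨j, hj⟩ := exists_factor_of_range_le (X.right.cohomUnit N)
      (kernelι (X.cotensorHom hN.comodule)) (Submodule.injective_subtype _) (fun x => by
        rw [Submodule.range_subtype, LinearMap.mem_ker, X.cotensorHom_apply, sub_eq_zero]
        exact hN.coact_apply x)
    have hj' : ∀ x, (kernelι (X.cotensorHom hN.comodule)).hom (j.hom x) =
      (X.right.cohomUnit N).hom x := fun x =>
        LinearMap.congr_fun (congrArg Hom.hom hj) x
    have hjinj : Function.Injective j.hom := fun x y hxy => hN.injective hX (by
      rw [← hj', ← hj', hxy])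
    -- A triangle identity. Since the counit is bijective, it forces `h(X, j)` to be surjective, and
    -- `h(X, -)` reflects surjectivity.
    have hεj : (cotensorCounit hP).hom ∘ₗ hN.map hP j = LinearMap.id := by
      apply hN.hom_ext
      intro x
      change ((cotensorCounit hP).hom ∘ₗ hN.map hP j).rTensor X.carrier _ = _
      rw [LinearMap.rTensor_comp_apply, LinearMap.rTensor_id, LinearMap.id_apply]
      exact (congrArg ((cotensorCounit hP).hom.rTensor X.carrier) (hN.map_apply hP j x)).trans
        ((hP.lift_apply _ (j.hom x)).trans (hj' x))
    have hjsurj : Function.Surjective j.hom := by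
      refine surjective_of_map_surjective hX hN hP j fun v => ?_
      refine ⟨(cotensorCounit hP).hom v, (cotensorCounit_bijective hX hC hP).1 ?_⟩
      exact LinearMap.congr_fun hεj _
    -- The map `M → h(X, M) ⊗ X → h(X, N) ⊗ X` induced by `φ` lands in `h(X, N) □ X` because `φ` is
    -- `C`-colinear.
    obtain ⟨g, hg⟩ := exists_factor_of_range_le
      (X.right.cohomUnit M ≫ X.right.tensorHom φ.hom)
      (kernelι (X.cotensorHom hN.comodule)) (Submodule.injective_subtype _) (fun x => by
        rw [Submodule.range_subtype, LinearMap.mem_ker, X.cotensorHom_apply, sub_eq_zero]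
        change hN.coact.rTensor X.carrier (φ.hom.rTensor X.carrier
          ((X.right.cohomUnit M).hom x)) = (TensorProduct.assoc R _ C X.carrier).symm
            (X.lcoact.lTensor _ (φ.hom.rTensor X.carrier ((X.right.cohomUnit M).hom x)))
        have hφ : hN.coact ∘ₗ φ.hom = φ.hom.rTensor C ∘ₗ hM.coact := φ.colinear
        rw [← LinearMap.rTensor_comp_apply, hφ, LinearMap.rTensor_comp_apply, hM.coact_apply,
          lTensor_rTensor_apply, assoc_symm_rTensor])
    refine ⟨g ≫ (isoOfBijective j ⟨hjinj, hjsurj⟩).inv, hom_ext (hM.eq_map hN _ fun x => ?_).symm⟩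
    rw [← hj']
    change _ = (kernelι (X.cotensorHom hN.comodule)).hom
      ((((isoOfBijective j ⟨hjinj, hjsurj⟩).inv ≫ (isoOfBijective j ⟨hjinj, hjsurj⟩).hom)).hom
        (g.hom x))
    rw [Iso.inv_hom_id]
    exact (LinearMap.congr_fun (congrArg Hom.hom hg) x).symm

theorem IsFlatCogenerator.equivalent (hX : X.right.IsFlatCogenerator)
    (hC : IsCohom X.lcoactHom) : Equivalent R C D := by
  have := hX.isQuasiFinite
  have := cohomFunctor_faithful hX
  have := cohomFunctor_essSurj hX hC
  have := cohomFunctor_full hX hC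
  exact Equivalent.symm ⟨cohomFunctor X, {}, inferInstance, inferInstance⟩

end

end RightComodule

/-! ### The left `D`-comodule `Y = h(X, D)` and the identity `h(X, M) = M □ Y`. -/

section Coherence

variable {A B F G : Type u} [AddCommGroup A] [Module R A] [AddCommGroup B] [Module R B]
  [AddCommGroup F] [Module R F] [AddCommGroup G] [Module R G]

theorem assoc_rTensor_assoc_symm' (z : (A ⊗[R] B) ⊗[R] (F ⊗[R] G)) :
    (TensorProduct.assoc R A B F).toLinearMap.rTensor G
      ((TensorProduct.assoc R (A ⊗[R] B) F G).symm z) =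
    (TensorProduct.assoc R A (B ⊗[R] F) G).symm
      ((TensorProduct.assoc R B F G).symm.toLinearMap.lTensor A
        (TensorProduct.assoc R A B (F ⊗[R] G) z)) := by
  have : (TensorProduct.assoc R A B F).toLinearMap.rTensor G ∘ₗ
      (TensorProduct.assoc R (A ⊗[R] B) F G).symm.toLinearMap =
      (TensorProduct.assoc R A (B ⊗[R] F) G).symm.toLinearMap ∘ₗ
      (TensorProduct.assoc R B F G).symm.toLinearMap.lTensor A ∘ₗ
      (TensorProduct.assoc R A B (F ⊗[R] G)).toLinearMap := by
    ext; simp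
  exact LinearMap.congr_fun this z

theorem assoc_symm_rTensor_assoc_symm (z : A ⊗[R] (B ⊗[R] (F ⊗[R] G))) :
    (TensorProduct.assoc R A B F).symm.toLinearMap.rTensor G
      ((TensorProduct.assoc R A (B ⊗[R] F) G).symm
        ((TensorProduct.assoc R B F G).symm.toLinearMap.lTensor A z)) =
    (TensorProduct.assoc R (A ⊗[R] B) F G).symm
      ((TensorProduct.assoc R A B (F ⊗[R] G)).symm z) := by
  have : (TensorProduct.assoc R A B F).symm.toLinearMap.rTensor G ∘ₗ
      (TensorProduct.assoc R A (B ⊗[R] F) G).symm.toLinearMap ∘ₗ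
      (TensorProduct.assoc R B F G).symm.toLinearMap.lTensor A =
      (TensorProduct.assoc R (A ⊗[R] B) F G).symm.toLinearMap ∘ₗ
      (TensorProduct.assoc R A B (F ⊗[R] G)).symm.toLinearMap := by
    ext; simp
  exact LinearMap.congr_fun this z

end Coherence

theorem comul_lTensor_comul (d : D) : (Coalgebra.comul (R := R) (A := D)).lTensor D
    (Coalgebra.comul (R := R) d) = TensorProduct.assoc R D D D
      ((Coalgebra.comul (R := R) (A := D)).rTensor D (Coalgebra.comul (R := R) d)) :=
  (LinearMap.congr_fun (Coalgebra.coassoc (R := R) (A := D)) d).symm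

namespace RightComodule

namespace IsCohom

variable {X M N : RightComodule R D} {V V' Y : Type u} [AddCommGroup V] [Module R V]
  [AddCommGroup V'] [Module R V'] [AddCommGroup Y] [Module R Y]
  {η : M ⟶ X.tensor V} {η' : N ⟶ X.tensor V'} {δ : regular R D ⟶ X.tensor Y}

/-- The map `h(X, M) → h(X, M ⊗ D) = M ⊗ h(X, D)` induced by the coaction of `M`. -/
noncomputable def toCotensor (hδ : IsCohom δ) (h : IsCohom η) : V →ₗ[R] M.carrier ⊗[R] Y :=
  h.map (hδ.tensor M.carrier) M.coactHom

theorem toCotensor_apply (hδ : IsCohom δ) (h : IsCohom η) (m : M.carrier) :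
    (hδ.toCotensor h).rTensor X.carrier (η.hom m) =
      (TensorProduct.assoc R M.carrier Y X.carrier).symm (δ.hom.lTensor M.carrier (M.coact m)) :=
  h.map_apply _ _ m

theorem toCotensor_injective (hX : X.IsInjector) (hδ : IsCohom δ) (h : IsCohom η) :
    Function.Injective (hδ.toCotensor h) :=
  h.map_injective hX (hδ.tensor M.carrier) M.coactHom M.coact_injective

theorem toCotensor_naturality (hδ : IsCohom δ) (h : IsCohom η) (h' : IsCohom η') (f : M ⟶ N) :
    hδ.toCotensor h' ∘ₗ h.map h' f = f.hom.rTensor Y ∘ₗ hδ.toCotensor h := by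
  apply h.hom_ext
  intro m
  rw [LinearMap.rTensor_comp_apply, h.map_apply, toCotensor_apply, LinearMap.rTensor_comp_apply,
    toCotensor_apply, ← assoc_symm_rTensor, ← lTensor_rTensor_apply, colinear_apply]

/-- The left coaction of `D` on `h(X, D)`. -/
noncomputable abbrev leftCoact (hδ : IsCohom δ) : Y →ₗ[R] D ⊗[R] Y := hδ.toCotensor hδ

theorem leftCoact_apply (hδ : IsCohom δ) (d : D) :
    hδ.leftCoact.rTensor X.carrier (δ.hom d) =
      (TensorProduct.assoc R D Y X.carrier).symm (δ.hom.lTensor D (Coalgebra.comul (R := R) d)) :=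
  hδ.toCotensor_apply hδ d

theorem leftCoact_comp (hδ : IsCohom δ) :
    hδ.leftCoact.rTensor X.carrier ∘ₗ δ.hom =
      (TensorProduct.assoc R D Y X.carrier).symm.toLinearMap ∘ₗ δ.hom.lTensor D ∘ₗ
        Coalgebra.comul :=
  LinearMap.ext hδ.leftCoact_apply

/-- The left `D`-comodule `h(X, D)`. -/
noncomputable abbrev leftComodule (hδ : IsCohom δ) : LeftComodule R D where
  carrier := Y
  coact := hδ.leftCoact
  coassoc := by
    apply hδ.hom_ext
    intro (d : D)
    change ((TensorProduct.assoc R D D Y).toLinearMap ∘ₗ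
      (Coalgebra.comul (R := R) (A := D)).rTensor Y ∘ₗ hδ.leftCoact).rTensor X.carrier
        (δ.hom d) = (hδ.leftCoact.lTensor D ∘ₗ hδ.leftCoact).rTensor X.carrier (δ.hom d)
    rw [LinearMap.rTensor_comp_apply, LinearMap.rTensor_comp_apply, LinearMap.rTensor_comp_apply,
      leftCoact_apply, ← assoc_symm_rTensor, ← lTensor_rTensor_apply, ← assoc_symm_rTensor_lTensor,
      ← LinearMap.lTensor_comp_apply, leftCoact_comp, assoc_rTensor_assoc_symm',
      LinearMap.lTensor_comp_apply, LinearMap.lTensor_comp_apply, assoc_lTensor,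
      comul_lTensor_comul]
  counit := by
    apply hδ.hom_ext
    intro (d : D)
    change ((Coalgebra.counit (R := R) (A := D)).rTensor Y ∘ₗ hδ.leftCoact).rTensor X.carrier
        (δ.hom d) = (TensorProduct.mk R R Y 1).rTensor X.carrier (δ.hom d)
    rw [LinearMap.rTensor_comp_apply, leftCoact_apply, ← assoc_symm_rTensor,
      ← lTensor_rTensor_apply, Coalgebra.rTensor_counit_comul, LinearMap.lTensor_tmul]
    have : (TensorProduct.assoc R R Y X.carrier).symm.toLinearMap ∘ₗ
      TensorProduct.mk R R (Y ⊗[R] X.carrier) 1 = (TensorProduct.mk R R Y 1).rTensor X.carrier := by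
      ext; simp
    exact LinearMap.congr_fun this (δ.hom d)

/-- `W ⊗ Y = h(X, W ⊗ D)` naturally in `W`, where `D` is flat and `h(X, -)` preserves injections. -/
theorem flat (hX : X.IsInjector) [Module.Flat R D] (hδ : IsCohom δ) : Module.Flat R Y := by
  rw [Module.Flat.iff_rTensor_preserves_injective_linearMap]
  intro W W' _ _ _ _ f hf
  have hf' : Function.Injective (((regular R D).tensorHom f).hom) :=
    Module.Flat.rTensor_preserves_injective_linearMap f hf
  convert (hδ.tensor W).map_injective hX (hδ.tensor W') ((regular R D).tensorHom f) hf'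
  apply (hδ.tensor W).eq_map
  intro z
  rw [tensor_apply, tensor_apply]
  change (f.rTensor Y).rTensor X.carrier ((TensorProduct.assoc R W Y X.carrier).symm
    (δ.hom.lTensor W z)) = (TensorProduct.assoc R W' Y X.carrier).symm
      (δ.hom.lTensor W' (f.rTensor D z))
  rw [← assoc_symm_rTensor, lTensor_rTensor_apply]

/-- The colinear map `M ⊗ D → M ⊗ D ⊗ D` whose kernel is `M`. -/
noncomputable def _root_.MoritaTakeuchi.RightComodule.coactDiff (M : RightComodule R D) :
    (regular R D).tensor M.carrier ⟶ (regular R D).tensor (M.carrier ⊗[R] D) :=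
  (regular R D).tensorHom M.coact - (tensorMap M.carrier (regular R D).coactHom ≫
    (regular R D).tensorAssoc M.carrier D)

theorem _root_.MoritaTakeuchi.RightComodule.coactDiff_apply (M : RightComodule R D)
    (z : M.carrier ⊗[R] D) : M.coactDiff.hom z = M.coact.rTensor D z -
      (TensorProduct.assoc R M.carrier D D).symm
        ((Coalgebra.comul (R := R) (A := D)).lTensor M.carrier z) := by
  rw [coactDiff, sub_eq_add_neg, sub_eq_add_neg]
  rfl

theorem _root_.MoritaTakeuchi.RightComodule.exact_coact (M : RightComodule R D) :
    Function.Exact M.coactHom.hom M.coactDiff.hom := by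
  intro z
  rw [coactDiff_apply, sub_eq_zero]
  constructor
  · intro h
    exact ⟨_, (eq_coact_of_coact_rTensor_eq M z h).symm⟩
  · rintro ⟨m, rfl⟩
    change M.coact.rTensor D (M.coact m) = (TensorProduct.assoc R M.carrier D D).symm
        ((Coalgebra.comul (R := R) (A := D)).lTensor M.carrier (M.coact m))
    rw [← coassoc_apply, LinearEquiv.symm_apply_apply]

/-- Identifies `h(X, -)` of `M ⊗ D → M ⊗ D ⊗ D` with the map that defines `M □ Y`, through `h(X, W ⊗
D) = W ⊗ Y`. -/
theorem map_coactDiff (hδ : IsCohom δ) (M : RightComodule R D) :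
    (hδ.tensor M.carrier).map (hδ.tensor (M.carrier ⊗[R] D)) M.coactDiff =
      (TensorProduct.assoc R M.carrier D Y).symm.toLinearMap ∘ₗ
        cotensorMap M hδ.leftComodule := by
  symm
  apply (hδ.tensor M.carrier).eq_map
  intro (z : M.carrier ⊗[R] D)
  rw [tensor_apply, tensor_apply, coactDiff_apply]
  have h1 : (TensorProduct.assoc R M.carrier D Y).symm.toLinearMap ∘ₗ
      cotensorMap M hδ.leftComodule = M.coact.rTensor Y -
        (TensorProduct.assoc R M.carrier D Y).symm.toLinearMap ∘ₗ
          hδ.leftCoact.lTensor M.carrier := by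
    rw [cotensorMap, LinearMap.comp_sub, ← LinearMap.comp_assoc]
    congr 1
    rw [LinearEquiv.symm_comp, LinearMap.id_comp]
  rw [h1, LinearMap.rTensor_sub]
  change (M.coact.rTensor Y).rTensor X.carrier ((TensorProduct.assoc R M.carrier Y
      X.carrier).symm (δ.hom.lTensor M.carrier z)) -
    ((TensorProduct.assoc R M.carrier D Y).symm.toLinearMap ∘ₗ
      hδ.leftCoact.lTensor M.carrier).rTensor X.carrier ((TensorProduct.assoc R M.carrier Y
      X.carrier).symm (δ.hom.lTensor M.carrier z)) = _
  rw [LinearMap.rTensor_comp_apply, map_sub, map_sub]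
  congr 1
  · rw [← assoc_symm_rTensor, lTensor_rTensor_apply]
  · rw [← assoc_symm_rTensor_lTensor, ← assoc_symm_lTensor_lTensor,
      ← LinearMap.lTensor_comp_apply, ← LinearMap.lTensor_comp_apply, leftCoact_comp,
      LinearMap.lTensor_comp_apply, assoc_symm_rTensor_assoc_symm]

/-- `h(X, M) = M □ h(X, D)`. -/
theorem range_toCotensor (hX : X.IsInjector) [X.IsQuasiFinite] (hδ : IsCohom δ)
    (h : IsCohom η) : LinearMap.range (hδ.toCotensor h) = cotensor M hδ.leftComodule := by
  -- The exact functor `h(X, -)` is applied to the exact sequence `M → M ⊗ D → M ⊗ D ⊗ D`.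
  have hex := map_exact hX h (hδ.tensor M.carrier) (hδ.tensor (M.carrier ⊗[R] D)) M.coactHom
    M.coactDiff M.exact_coact
  rw [map_coactDiff] at hex
  rw [cotensor]
  refine (LinearMap.exact_iff.1 hex).symm.trans ?_
  ext z
  rw [LinearMap.mem_ker, LinearMap.mem_ker, LinearMap.comp_apply]
  exact LinearEquiv.map_eq_zero_iff _

end IsCohom

end RightComodule

/-- The isomorphism `(W ⊗ A) ⊗ B → A ⊗ (B ⊗ W)`. -/
noncomputable def tensorRotate (R : Type u) [CommRing R] (W A B : Type u) [AddCommGroup W]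
    [Module R W] [AddCommGroup A] [Module R A] [AddCommGroup B] [Module R B] :
    (W ⊗[R] A) ⊗[R] B ≃ₗ[R] A ⊗[R] (B ⊗[R] W) :=
  TensorProduct.assoc R W A B ≪≫ₗ TensorProduct.comm R W (A ⊗[R] B) ≪≫ₗ TensorProduct.assoc R A B W

@[simp]
theorem tensorRotate_tmul {W A B : Type u} [AddCommGroup W]
    [Module R W] [AddCommGroup A] [Module R A] [AddCommGroup B] [Module R B] (w : W) (a : A)
    (b : B) : tensorRotate R W A B ((w ⊗ₜ a) ⊗ₜ b) = a ⊗ₜ (b ⊗ₜ w) := rfl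

/-- Moving `W` across gives `(W ⊗ M) □ N = M □ (N ⊗ W)`. This needs no flatness of `W`, since `W`
only accompanies the parameter of the cotensor product. -/
theorem cotensorMap_tensorRotate (M : RightComodule R D) (N : LeftComodule R D) (W : Type u)
    [AddCommGroup W] [Module R W] (z : (W ⊗[R] M.carrier) ⊗[R] N.carrier) :
    cotensorMap M (N.tensor W) (tensorRotate R W M.carrier N.carrier z) =
      (TensorProduct.assoc R D N.carrier W).toLinearMap.lTensor M.carrier
        (tensorRotate R W M.carrier (D ⊗[R] N.carrier) (cotensorMap (M.tensor W) N z)) := by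
  have : cotensorMap M (N.tensor W) ∘ₗ (tensorRotate R W M.carrier N.carrier).toLinearMap =
      (TensorProduct.assoc R D N.carrier W).toLinearMap.lTensor M.carrier ∘ₗ
        (tensorRotate R W M.carrier (D ⊗[R] N.carrier)).toLinearMap ∘ₗ
          cotensorMap (M.tensor W) N := by
    ext w m n
    change TensorProduct.assoc R M.carrier D (N.carrier ⊗[R] W) (M.coact m ⊗ₜ (n ⊗ₜ w)) -
      m ⊗ₜ (TensorProduct.assoc R D N.carrier W (N.coact n ⊗ₜ w)) =
      (TensorProduct.assoc R D N.carrier W).toLinearMap.lTensor M.carrier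
        (tensorRotate R W M.carrier (D ⊗[R] N.carrier)
          (TensorProduct.assoc R (W ⊗[R] M.carrier) D N.carrier
            ((TensorProduct.assoc R W M.carrier D).symm (w ⊗ₜ M.coact m) ⊗ₜ n) -
            (w ⊗ₜ m) ⊗ₜ N.coact n))
    rw [map_sub, map_sub]
    congr 1
    induction M.coact m with
    | zero => simp
    | add a b ha hb => simp only [TensorProduct.tmul_add, TensorProduct.add_tmul, map_add, ha, hb]
    | tmul a c => simp
  exact LinearMap.congr_fun this z

theorem tensorRotate_mem_cotensor (M : RightComodule R D) (N : LeftComodule R D) {W : Type u}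
    [AddCommGroup W] [Module R W] (z : (W ⊗[R] M.carrier) ⊗[R] N.carrier) :
    tensorRotate R W M.carrier N.carrier z ∈ cotensor M (N.tensor W) ↔
      z ∈ cotensor (M.tensor W) N := by
  have hinj : Function.Injective
      ((TensorProduct.assoc R D N.carrier W).toLinearMap.lTensor M.carrier) :=
    (LinearEquiv.lTensor M.carrier (TensorProduct.assoc R D N.carrier W)).injective
  rw [cotensor, cotensor, LinearMap.mem_ker, LinearMap.mem_ker, cotensorMap_tensorRotate,
    map_eq_zero_iff _ hinj, LinearEquiv.map_eq_zero_iff]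

theorem mem_cotensor {M : RightComodule R D} {N : LeftComodule R D}
    {z : M.carrier ⊗[R] N.carrier} : z ∈ cotensor M N ↔
      TensorProduct.assoc R M.carrier D N.carrier (M.coact.rTensor N.carrier z) =
        N.coact.lTensor M.carrier z := by
  rw [cotensor, LinearMap.mem_ker, cotensorMap, LinearMap.sub_apply, sub_eq_zero]
  rfl

/-! ### The adjunction between `X □ -` and `Y ⊗ -`. -/

namespace RightComodule.IsCohom

variable {X : Bicomodule R C D} {Y : Type u} [AddCommGroup Y] [Module R Y]
  {δ : regular R D ⟶ X.right.tensor Y}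

section Pairing

variable (hC : IsCohom X.lcoactHom) (hδ : IsCohom δ)

/-- The map `C = h(X, X) → X ⊗ h(X, D)`. -/
noncomputable def copairing : C →ₗ[R] X.carrier ⊗[R] Y := hδ.toCotensor hC

/-- First compatibility between `C → X ⊗ Y` and `δ : D → Y ⊗ X`: the two maps from `X` to `X ⊗ Y ⊗
X` agree. It underlies the left triangle identity. -/
theorem copairing_apply (x : X.carrier) :
    (copairing hC hδ).rTensor X.carrier (X.lcoact x) =
      (TensorProduct.assoc R X.carrier Y X.carrier).symm (δ.hom.lTensor X.carrier (X.rcoact x)) :=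
  hδ.toCotensor_apply hC x

theorem copairing_comp :
    (copairing hC hδ).rTensor X.carrier ∘ₗ X.lcoact =
      (TensorProduct.assoc R X.carrier Y X.carrier).symm.toLinearMap ∘ₗ
        δ.hom.lTensor X.carrier ∘ₗ X.rcoact :=
  LinearMap.ext (copairing_apply hC hδ)

theorem lTensor_rcoact_apply (δ : regular R D ⟶ X.right.tensor Y) (d : D) :
    X.rcoact.lTensor Y (δ.hom d) =
      TensorProduct.assoc R Y X.carrier D (δ.hom.rTensor D (Coalgebra.comul (R := R) d)) :=
  (TensorProduct.assoc R Y X.carrier D).symm_apply_eq.1 (colinear_apply δ d)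

/-- Second compatibility: the maps from `Y` to `Y ⊗ X ⊗ Y` through `Y ⊗ C` and through `D ⊗ Y`
agree. It underlies the right triangle identity. -/
theorem lTensor_copairing_comp :
    (copairing hC hδ).lTensor Y ∘ₗ hδ.coact =
      (TensorProduct.assoc R Y X.carrier Y).toLinearMap ∘ₗ δ.hom.rTensor Y ∘ₗ hδ.leftCoact := by
  apply hδ.hom_ext
  intro (d : D)
  change ((copairing hC hδ).lTensor Y ∘ₗ hδ.coact).rTensor X.carrier (δ.hom d) =
    ((TensorProduct.assoc R Y X.carrier Y).toLinearMap ∘ₗ δ.hom.rTensor Y ∘ₗ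
      hδ.leftCoact).rTensor X.carrier (δ.hom d)
  rw [LinearMap.rTensor_comp_apply, LinearMap.rTensor_comp_apply, LinearMap.rTensor_comp_apply,
    hδ.coact_apply, hδ.leftCoact_apply, ← assoc_symm_rTensor_lTensor,
    ← LinearMap.lTensor_comp_apply, copairing_comp, LinearMap.lTensor_comp_apply,
    LinearMap.lTensor_comp_apply, lTensor_rcoact_apply, ← assoc_lTensor, ← assoc_symm_rTensor,
    ← lTensor_rTensor_apply, assoc_rTensor_assoc_symm']

theorem toCotensor_tensor (W : Type u) [AddCommGroup W] [Module R W] :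
    hδ.toCotensor (hC.tensor W) = (TensorProduct.assoc R W X.carrier Y).symm.toLinearMap ∘ₗ
      (copairing hC hδ).lTensor W := by
  symm
  apply (hC.tensor W).eq_map
  intro (z : W ⊗[R] X.carrier)
  change ((TensorProduct.assoc R W X.carrier Y).symm.toLinearMap ∘ₗ
    (copairing hC hδ).lTensor W).rTensor X.carrier
      ((TensorProduct.assoc R W C X.carrier).symm (X.lcoact.lTensor W z)) =
    (TensorProduct.assoc R (W ⊗[R] X.carrier) Y X.carrier).symm
      (δ.hom.lTensor (W ⊗[R] X.carrier) ((TensorProduct.assoc R W X.carrier D).symm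
        (X.rcoact.lTensor W z)))
  rw [LinearMap.rTensor_comp_apply, ← assoc_symm_rTensor_lTensor, ← LinearMap.lTensor_comp_apply,
    copairing_comp, LinearMap.lTensor_comp_apply, LinearMap.lTensor_comp_apply,
    assoc_symm_rTensor_assoc_symm, assoc_symm_lTensor_lTensor]

/-- The map `C ⊗ W → X ⊗ (Y ⊗ W)`. -/
noncomputable def copairingTensor (W : Type u) [AddCommGroup W] [Module R W] :
    C ⊗[R] W →ₗ[R] X.carrier ⊗[R] (Y ⊗[R] W) :=
  (TensorProduct.assoc R X.carrier Y W).toLinearMap ∘ₗ (copairing hC hδ).rTensor W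

theorem copairingTensor_eq (W : Type u) [AddCommGroup W] [Module R W] (z : C ⊗[R] W) :
    copairingTensor hC hδ W z = tensorRotate R W X.carrier Y
      (hδ.toCotensor (hC.tensor W) (TensorProduct.comm R C W z)) := by
  rw [toCotensor_tensor]
  change _ = tensorRotate R W X.carrier Y ((TensorProduct.assoc R W X.carrier Y).symm
    ((copairing hC hδ).lTensor W (TensorProduct.comm R C W z)))
  rw [tensorRotate, LinearEquiv.trans_apply, LinearEquiv.trans_apply, LinearEquiv.apply_symm_apply]
  have : copairingTensor hC hδ W = (TensorProduct.assoc R X.carrier Y W).toLinearMap ∘ₗ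
      (TensorProduct.comm R W (X.carrier ⊗[R] Y)).toLinearMap ∘ₗ
      (copairing hC hδ).lTensor W ∘ₗ (TensorProduct.comm R C W).toLinearMap := by
    apply TensorProduct.ext'
    intro c w
    simp [copairingTensor]
  exact LinearMap.congr_fun this z

/-- After permuting factors this is the embedding `h(X, W ⊗ X) → (W ⊗ X) ⊗ Y`. Injectivity therefore
comes from the injector property, for arbitrary `W`, flat or not. -/
theorem copairingTensor_injective (hX : X.right.IsInjector) (W : Type u) [AddCommGroup W]
    [Module R W] : Function.Injective (copairingTensor hC hδ W) := by
  have : ⇑(copairingTensor hC hδ W) = tensorRotate R W X.carrier Y ∘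
      hδ.toCotensor (hC.tensor W) ∘ TensorProduct.comm R C W :=
    funext (copairingTensor_eq hC hδ W)
  rw [this]
  exact (LinearEquiv.injective _).comp
    ((hδ.toCotensor_injective hX (hC.tensor W)).comp (LinearEquiv.injective _))

/-- `X □ (Y ⊗ W) = (W ⊗ X) □ Y = h(X, W ⊗ X) = W ⊗ C`. -/
theorem mem_cotensor_iff (hX : X.right.IsInjector) [X.right.IsQuasiFinite] {W : Type u}
    [AddCommGroup W] [Module R W] (z : X.carrier ⊗[R] (Y ⊗[R] W)) :
    z ∈ cotensor X.right (hδ.leftComodule.tensor W) ↔ ∃ t, copairingTensor hC hδ W t = z := by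
  obtain ⟨y, rfl⟩ := (tensorRotate R W X.carrier Y).surjective z
  refine (tensorRotate_mem_cotensor X.right hδ.leftComodule y).trans ?_
  rw [← range_toCotensor hX hδ (hC.tensor W)]
  constructor
  · rintro ⟨t, rfl⟩
    refine ⟨(TensorProduct.comm R C W).symm t, ?_⟩
    rw [copairingTensor_eq, LinearEquiv.apply_symm_apply]
  · rintro ⟨t, ht⟩
    refine ⟨TensorProduct.comm R C W t, (tensorRotate R W X.carrier Y).injective ?_⟩
    rw [← ht, copairingTensor_eq]

theorem copairingTensor_naturality {W W' : Type u} [AddCommGroup W] [Module R W] [AddCommGroup W']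
    [Module R W'] (f : W →ₗ[R] W') (t : C ⊗[R] W) :
    copairingTensor hC hδ W' (f.lTensor C t) =
      (f.lTensor Y).lTensor X.carrier (copairingTensor hC hδ W t) := by
  change TensorProduct.assoc R X.carrier Y W' ((copairing hC hδ).rTensor W' (f.lTensor C t)) =
    (f.lTensor Y).lTensor X.carrier
      (TensorProduct.assoc R X.carrier Y W ((copairing hC hδ).rTensor W t))
  rw [← assoc_lTensor, lTensor_rTensor_apply]

/-- The isomorphism `C ⊗ W → X □ (Y ⊗ W)`. -/
noncomputable def cotensorEquiv (hX : X.right.IsInjector) [X.right.IsQuasiFinite] (W : Type u)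
    [AddCommGroup W] [Module R W] :
    C ⊗[R] W ≃ₗ[R] cotensor X.right (hδ.leftComodule.tensor W) :=
  LinearEquiv.ofBijective
    ((copairingTensor hC hδ W).codRestrict _ fun t =>
      (mem_cotensor_iff hC hδ hX _).2 ⟨t, rfl⟩)
    ⟨fun a b h => copairingTensor_injective hC hδ hX W (congrArg Subtype.val h), fun z => by
      obtain ⟨t, ht⟩ := (mem_cotensor_iff hC hδ hX z.1).1 z.2
      exact ⟨t, Subtype.ext ht⟩⟩

theorem coe_cotensorEquiv (hX : X.right.IsInjector) [X.right.IsQuasiFinite] (W : Type u)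
    [AddCommGroup W] [Module R W] (t : C ⊗[R] W) :
    (cotensorEquiv hC hδ hX W t).1 = copairingTensor hC hδ W t := rfl

/-- The linear map `X □ (Y ⊗ W) → W` given by the counit of `C`. -/
noncomputable def cotensorEval (hX : X.right.IsInjector) [X.right.IsQuasiFinite] (W : Type u)
    [AddCommGroup W] [Module R W] : cotensor X.right (hδ.leftComodule.tensor W) →ₗ[R] W :=
  (TensorProduct.lid R W).toLinearMap ∘ₗ (Coalgebra.counit (R := R) (A := C)).rTensor W ∘ₗ
    (cotensorEquiv hC hδ hX W).symm.toLinearMap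

theorem cotensorEval_cotensorEquiv (hX : X.right.IsInjector) [X.right.IsQuasiFinite] (W : Type u)
    [AddCommGroup W] [Module R W] (t : C ⊗[R] W) :
    cotensorEval hC hδ hX W (cotensorEquiv hC hδ hX W t) =
      TensorProduct.lid R W ((Coalgebra.counit (R := R) (A := C)).rTensor W t) := by
  change TensorProduct.lid R W ((Coalgebra.counit (R := R) (A := C)).rTensor W
    ((cotensorEquiv hC hδ hX W).symm (cotensorEquiv hC hδ hX W t))) = _
  rw [LinearEquiv.symm_apply_apply]

end Pairing

section Unit

/-- The map `N → D ⊗ N → Y ⊗ (X ⊗ N)`. -/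
noncomputable def unitAux (δ : regular R D ⟶ X.right.tensor Y) (N : LeftComodule R D) :
    N.carrier →ₗ[R] Y ⊗[R] (X.carrier ⊗[R] N.carrier) :=
  (TensorProduct.assoc R Y X.carrier N.carrier).toLinearMap ∘ₗ
    (δ.hom : D →ₗ[R] Y ⊗[R] X.carrier).rTensor N.carrier ∘ₗ N.coact

theorem unitAux_apply (δ : regular R D ⟶ X.right.tensor Y) (N : LeftComodule R D)
    (n : N.carrier) : unitAux δ N n = TensorProduct.assoc R Y X.carrier N.carrier
      ((δ.hom : D →ₗ[R] Y ⊗[R] X.carrier).rTensor N.carrier (N.coact n)) := rfl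

/-- Right colinearity of `δ` together with coassociativity of `N`. With `Y` flat, it makes the map
`N → Y ⊗ (X ⊗ N)` take values in `Y ⊗ (X □ N)`. -/
theorem cotensorMap_unitAux (δ : regular R D ⟶ X.right.tensor Y) (N : LeftComodule R D)
    (n : N.carrier) : (cotensorMap X.right N).lTensor Y (unitAux δ N n) = 0 := by
  rw [cotensorMap, LinearMap.lTensor_sub, LinearMap.sub_apply, sub_eq_zero,
    LinearMap.lTensor_comp_apply, unitAux_apply]
  have h1 : (TensorProduct.assoc R X.carrier D N.carrier).toLinearMap.lTensor Y
      ((X.rcoact.rTensor N.carrier).lTensor Y (TensorProduct.assoc R Y X.carrier N.carrier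
        ((δ.hom : D →ₗ[R] Y ⊗[R] X.carrier).rTensor N.carrier (N.coact n)))) =
      (TensorProduct.assoc R X.carrier D N.carrier).toLinearMap.lTensor Y
        (TensorProduct.assoc R Y (X.carrier ⊗[R] D) N.carrier
          ((X.rcoact.lTensor Y ∘ₗ δ.hom).rTensor N.carrier (N.coact n))) := by
    rw [← assoc_lTensor_rTensor, LinearMap.rTensor_comp_apply]
  have h2 : X.rcoact.lTensor Y ∘ₗ δ.hom = (TensorProduct.assoc R Y X.carrier D).toLinearMap ∘ₗ
      (δ.hom : D →ₗ[R] Y ⊗[R] X.carrier).rTensor D ∘ₗ Coalgebra.comul :=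
    LinearMap.ext (lTensor_rcoact_apply δ)
  refine h1.trans ?_
  rw [h2, LinearMap.rTensor_comp_apply, LinearMap.rTensor_comp_apply]
  have h3 : ∀ z : ((Y ⊗[R] X.carrier) ⊗[R] D) ⊗[R] N.carrier,
      (TensorProduct.assoc R X.carrier D N.carrier).toLinearMap.lTensor Y
        (TensorProduct.assoc R Y (X.carrier ⊗[R] D) N.carrier
          ((TensorProduct.assoc R Y X.carrier D).toLinearMap.rTensor N.carrier z)) =
      TensorProduct.assoc R Y X.carrier (D ⊗[R] N.carrier)
        (TensorProduct.assoc R (Y ⊗[R] X.carrier) D N.carrier z) := by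
    intro z
    have : (TensorProduct.assoc R X.carrier D N.carrier).toLinearMap.lTensor Y ∘ₗ
        (TensorProduct.assoc R Y (X.carrier ⊗[R] D) N.carrier).toLinearMap ∘ₗ
          (TensorProduct.assoc R Y X.carrier D).toLinearMap.rTensor N.carrier =
      (TensorProduct.assoc R Y X.carrier (D ⊗[R] N.carrier)).toLinearMap ∘ₗ
        (TensorProduct.assoc R (Y ⊗[R] X.carrier) D N.carrier).toLinearMap := by
      ext; simp
    exact LinearMap.congr_fun this z
  rw [h3, assoc_rTensor_rTensor, N.coassoc_apply]
  change _ = (N.coact.lTensor X.carrier).lTensor Y (TensorProduct.assoc R Y X.carrier N.carrier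
    ((δ.hom : D →ₗ[R] Y ⊗[R] X.carrier).rTensor N.carrier (N.coact n)))
  rw [← assoc_lTensor, lTensor_rTensor_apply]

theorem unitAux_naturality (δ : regular R D ⟶ X.right.tensor Y) {N N' : LeftComodule R D}
    (f : N ⟶ N') (n : N.carrier) : unitAux δ N' (f.hom n) =
      (f.hom.lTensor X.carrier).lTensor Y (unitAux δ N n) := by
  rw [unitAux_apply, unitAux_apply, LeftComodule.colinear_apply, ← assoc_lTensor,
    lTensor_rTensor_apply]

theorem subtype_lTensor_injective (N : LeftComodule R D) [Module.Flat R Y] :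
    Function.Injective ((cotensor X.right N).subtype.lTensor Y) :=
  Module.Flat.lTensor_preserves_injective_linearMap _ (Submodule.injective_subtype _)

/-- The map `N → Y ⊗ (X □ N)`. -/
noncomputable def unitHom (δ : regular R D ⟶ X.right.tensor Y) [Module.Flat R Y]
    (N : LeftComodule R D) : N.carrier →ₗ[R] Y ⊗[R] cotensor X.right N :=
  (LinearEquiv.ofInjective ((cotensor X.right N).subtype.lTensor Y)
      (subtype_lTensor_injective N)).symm.toLinearMap ∘ₗ
    LinearMap.codRestrict _ (unitAux δ N) (fun n => by
      -- Flatness of `Y` identifies `Y ⊗ (X □ N)` with a kernel inside `Y ⊗ (X ⊗ N)`.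
      have hex : Function.Exact ((cotensor X.right N).subtype.lTensor Y)
          ((cotensorMap X.right N).lTensor Y) :=
        Module.Flat.lTensor_exact Y (LinearMap.exact_subtype_ker_map _)
      exact (hex _).1 (cotensorMap_unitAux δ N n))

theorem subtype_unitHom (δ : regular R D ⟶ X.right.tensor Y) [Module.Flat R Y]
    (N : LeftComodule R D) (n : N.carrier) :
    (cotensor X.right N).subtype.lTensor Y (unitHom δ N n) = unitAux δ N n :=
  congrArg Subtype.val (LinearEquiv.apply_symm_apply (LinearEquiv.ofInjective
    ((cotensor X.right N).subtype.lTensor Y) (subtype_lTensor_injective N)) _)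

/-- Left colinearity of `δ` and coassociativity of `N`; this is what makes the unit of the
adjunction left colinear. -/
theorem leftCoact_unitAux (hδ : IsCohom δ) (N : LeftComodule R D) (n : N.carrier) :
    TensorProduct.assoc R D Y (X.carrier ⊗[R] N.carrier)
      (hδ.leftCoact.rTensor (X.carrier ⊗[R] N.carrier) (unitAux δ N n)) =
    (unitAux δ N).lTensor D (N.coact n) := by
  rw [unitAux_apply, ← assoc_rTensor_rTensor]
  have h1 : (hδ.leftCoact.rTensor X.carrier).rTensor N.carrier
      ((δ.hom : D →ₗ[R] Y ⊗[R] X.carrier).rTensor N.carrier (N.coact n)) =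
      ((TensorProduct.assoc R D Y X.carrier).symm.toLinearMap ∘ₗ
        (δ.hom : D →ₗ[R] Y ⊗[R] X.carrier).lTensor D ∘ₗ Coalgebra.comul).rTensor N.carrier
          (N.coact n) := by
    rw [← LinearMap.rTensor_comp_apply]
    congr 2
    exact hδ.leftCoact_comp
  have h2 : unitAux δ N = (TensorProduct.assoc R Y X.carrier N.carrier).toLinearMap ∘ₗ
    (δ.hom : D →ₗ[R] Y ⊗[R] X.carrier).rTensor N.carrier ∘ₗ N.coact := rfl
  rw [h1, h2, LinearMap.rTensor_comp_apply, LinearMap.rTensor_comp_apply,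
    LinearMap.lTensor_comp_apply, LinearMap.lTensor_comp_apply, ← N.coassoc_apply,
    ← assoc_lTensor_rTensor]
  generalize ((δ.hom : D →ₗ[R] Y ⊗[R] X.carrier).lTensor D).rTensor N.carrier
    ((Coalgebra.comul (R := R) (A := D)).rTensor N.carrier (N.coact n)) = z
  have : (TensorProduct.assoc R D Y (X.carrier ⊗[R] N.carrier)).toLinearMap ∘ₗ
      (TensorProduct.assoc R (D ⊗[R] Y) X.carrier N.carrier).toLinearMap ∘ₗ
      (TensorProduct.assoc R D Y X.carrier).symm.toLinearMap.rTensor N.carrier =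
      (TensorProduct.assoc R Y X.carrier N.carrier).toLinearMap.lTensor D ∘ₗ
      (TensorProduct.assoc R D (Y ⊗[R] X.carrier) N.carrier).toLinearMap := by
    ext; simp
  exact LinearMap.congr_fun this z

variable [Module.Flat R D] [Module.Flat R Y] (hδ : IsCohom δ)

/-- The left colinear map `N → Y ⊗ (X □ N)`. -/
noncomputable def unitLeft (N : LeftComodule R D) :
    N ⟶ hδ.leftComodule.tensor (cotensor X.right N) where
  hom := unitHom δ N
  colinear := by
    ext n
    have hinj : Function.Injective (((cotensor X.right N).subtype.lTensor Y).lTensor D) :=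
      Module.Flat.lTensor_preserves_injective_linearMap _ (subtype_lTensor_injective N)
    apply hinj
    change ((cotensor X.right N).subtype.lTensor Y).lTensor D (TensorProduct.assoc R D Y
      (cotensor X.right N) (hδ.leftCoact.rTensor (cotensor X.right N) (unitHom δ N n))) =
      ((cotensor X.right N).subtype.lTensor Y).lTensor D ((unitHom δ N).lTensor D (N.coact n))
    rw [← LinearMap.lTensor_comp_apply, ← assoc_lTensor, lTensor_rTensor_apply]
    have : (cotensor X.right N).subtype.lTensor Y ∘ₗ unitHom δ N = unitAux δ N :=
      LinearMap.ext (subtype_unitHom δ N)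
    rw [this, subtype_unitHom, leftCoact_unitAux]

end Unit

end RightComodule.IsCohom

theorem LeftComodule.mono_of_injective {M N : LeftComodule R D} (f : M ⟶ N)
    (hf : Function.Injective f.hom) : Mono f where
  right_cancellation g h e := by
    ext x
    exact hf (LinearMap.congr_fun (congrArg LeftComodule.Hom.hom e) x)

theorem LeftComodule.epi_of_surjective {M N : LeftComodule R D} (f : M ⟶ N)
    (hf : Function.Surjective f.hom) : Epi f where
  left_cancellation g h e := by
    ext x
    obtain ⟨y, rfl⟩ := hf x
    exact LinearMap.congr_fun (congrArg LeftComodule.Hom.hom e) y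

namespace RightComodule.IsCohom

variable {X : Bicomodule R C D} {Y : Type u} [AddCommGroup Y] [Module R Y]
  {δ : regular R D ⟶ X.right.tensor Y}
  (hC : IsCohom X.lcoactHom) (hδ : IsCohom δ)

theorem cotensorEval_naturality (hX : X.right.IsInjector) [X.right.IsQuasiFinite]
    {W W' : ModuleCat.{u} R} (f : W ⟶ W')
    (z : cotensor X.right (hδ.leftComodule.tensor W)) :
    cotensorEval hC hδ hX W'
      ((X.right.cotensorFunctor.map (hδ.leftComodule.tensorFunctor.map f)).hom z) =
      f.hom (cotensorEval hC hδ hX W z) := by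
  obtain ⟨t, rfl⟩ := (cotensorEquiv hC hδ hX W).surjective z
  have : (X.right.cotensorFunctor.map (hδ.leftComodule.tensorFunctor.map f)).hom
      (cotensorEquiv hC hδ hX W t) = cotensorEquiv hC hδ hX W' (f.hom.lTensor C t) := by
    apply Subtype.ext
    exact (copairingTensor_naturality hC hδ f.hom t).symm
  rw [this, cotensorEval_cotensorEquiv, cotensorEval_cotensorEquiv, ← lTensor_rTensor_apply]
  have : (TensorProduct.lid R W').toLinearMap ∘ₗ f.hom.lTensor R =
    f.hom ∘ₗ (TensorProduct.lid R W).toLinearMap := by ext; simp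
  exact LinearMap.congr_fun this _

variable [Module.Flat R Y]

theorem unitHom_naturality (δ : regular R D ⟶ X.right.tensor Y) {N N' : LeftComodule R D}
    (f : N ⟶ N') (k : cotensor X.right N →ₗ[R] cotensor X.right N')
    (hk : (cotensor X.right N').subtype ∘ₗ k =
      f.hom.lTensor X.carrier ∘ₗ (cotensor X.right N).subtype) (n : N.carrier) :
    unitHom δ N' (f.hom n) = k.lTensor Y (unitHom δ N n) := by
  apply subtype_lTensor_injective (X := X) (Y := Y) N'
  rw [subtype_unitHom, unitAux_naturality, ← subtype_unitHom, ← LinearMap.lTensor_comp_apply,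
    ← LinearMap.lTensor_comp_apply, hk]

/-- Under `X □ (Y ⊗ W) = C ⊗ W` the unit at `Y ⊗ W` becomes the `C`-coaction of `Y` tensored with
`W`. The right triangle identity thereby reduces to the counit axiom for that coaction. -/
theorem cotensorEquiv_symm_unitLeft (hX : X.right.IsInjector) [X.right.IsQuasiFinite] (W : Type u)
    [AddCommGroup W] [Module R W] (s : Y ⊗[R] W) :
    (cotensorEquiv hC hδ hX W).symm.toLinearMap.lTensor Y
      (unitHom δ (hδ.leftComodule.tensor W) s) =
      TensorProduct.assoc R Y C W (hδ.coact.rTensor W s) := by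
  have hinj : Function.Injective ((copairingTensor hC hδ W).lTensor Y) :=
    Module.Flat.lTensor_preserves_injective_linearMap _ (copairingTensor_injective hC hδ hX W)
  apply hinj
  rw [← LinearMap.lTensor_comp_apply]
  have e1 : copairingTensor hC hδ W ∘ₗ (cotensorEquiv hC hδ hX W).symm.toLinearMap =
      (cotensor X.right (hδ.leftComodule.tensor W)).subtype := by
    ext z
    change copairingTensor hC hδ W ((cotensorEquiv hC hδ hX W).symm z) = z.1
    rw [← coe_cotensorEquiv hC hδ hX, LinearEquiv.apply_symm_apply]
  have e2 : copairingTensor hC hδ W = (TensorProduct.assoc R X.carrier Y W).toLinearMap ∘ₗ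
    (copairing hC hδ).rTensor W := rfl
  rw [e1]
  refine (subtype_unitHom δ (hδ.leftComodule.tensor W) s).trans ?_
  rw [e2, LinearMap.lTensor_comp_apply, ← assoc_lTensor_rTensor, ← LinearMap.rTensor_comp_apply,
    lTensor_copairing_comp, LinearMap.rTensor_comp_apply, LinearMap.rTensor_comp_apply]
  change TensorProduct.assoc R Y X.carrier (Y ⊗[R] W)
    ((δ.hom : D →ₗ[R] Y ⊗[R] X.carrier).rTensor (Y ⊗[R] W)
      (TensorProduct.assoc R D Y W (hδ.leftCoact.rTensor W s))) = _
  rw [← assoc_rTensor_rTensor]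
  generalize ((δ.hom : D →ₗ[R] Y ⊗[R] X.carrier).rTensor Y).rTensor W
    (hδ.leftCoact.rTensor W s) = w
  have : (TensorProduct.assoc R Y X.carrier (Y ⊗[R] W)).toLinearMap ∘ₗ
      (TensorProduct.assoc R (Y ⊗[R] X.carrier) Y W).toLinearMap =
      (TensorProduct.assoc R X.carrier Y W).toLinearMap.lTensor Y ∘ₗ
      (TensorProduct.assoc R Y (X.carrier ⊗[R] Y) W).toLinearMap ∘ₗ
      (TensorProduct.assoc R Y X.carrier Y).toLinearMap.rTensor W := by
    ext; simp
  exact LinearMap.congr_fun this w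

theorem lTensor_cotensorEval_unitHom (hX : X.right.IsInjector) [X.right.IsQuasiFinite]
    (W : Type u) [AddCommGroup W] [Module R W] (s : Y ⊗[R] W) :
    (cotensorEval hC hδ hX W).lTensor Y (unitHom δ (hδ.leftComodule.tensor W) s) = s := by
  rw [cotensorEval, LinearMap.lTensor_comp_apply, LinearMap.lTensor_comp_apply,
    cotensorEquiv_symm_unitLeft, ← assoc_lTensor_rTensor, ← LinearMap.rTensor_comp_apply]
  have : (Coalgebra.counit (R := R) (A := C)).lTensor Y ∘ₗ hδ.coact =
    (TensorProduct.mk R Y R).flip 1 := hδ.comodule.counit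
  rw [this]
  have : (TensorProduct.lid R W).toLinearMap.lTensor Y ∘ₗ
    (TensorProduct.assoc R Y R W).toLinearMap ∘ₗ ((TensorProduct.mk R Y R).flip 1).rTensor W =
    LinearMap.id := by ext; simp
  exact LinearMap.congr_fun this s

variable [Module.Flat R D]

/-- The image of `z` under the unit corresponds to some `t` in `C ⊗ (X □ N)`. Viewed in `C ⊗ X ⊗ N`,
this `t` is the left `C`-coaction of `X` applied to `z`, so the counit of `C` returns `z`. -/
theorem cotensorEval_unitLeft (hX : X.right.IsInjector) [X.right.IsQuasiFinite]
    (N : LeftComodule R D) (z : cotensor X.right N) :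
    cotensorEval hC hδ hX (cotensor X.right N)
      ((X.right.cotensorFunctor.map (unitLeft hδ N)).hom z) = z := by
  set u : cotensor X.right (hδ.leftComodule.tensor (cotensor X.right N)) :=
    (X.right.cotensorFunctor.map (unitLeft hδ N)).hom z with hu
  obtain ⟨t, ht⟩ := (cotensorEquiv hC hδ hX (cotensor X.right N)).surjective u
  have h1 : copairingTensor hC hδ (cotensor X.right N) t =
      (unitHom δ N).lTensor X.carrier z.1 := congrArg Subtype.val ht
  -- The two candidates for `t` are compared in `X ⊗ (Y ⊗ (X ⊗ N))`, into which `C ⊗ (X ⊗ N)`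
  -- embeds.
  have h2 : copairingTensor hC hδ (X.carrier ⊗[R] N.carrier)
      ((cotensor X.right N).subtype.lTensor C t) =
      copairingTensor hC hδ (X.carrier ⊗[R] N.carrier)
        (TensorProduct.assoc R C X.carrier N.carrier (X.lcoact.rTensor N.carrier z.1)) := by
    rw [copairingTensor_naturality, h1, ← LinearMap.lTensor_comp_apply]
    have e : (cotensor X.right N).subtype.lTensor Y ∘ₗ unitHom δ N = unitAux δ N :=
      LinearMap.ext (subtype_unitHom δ N)
    have e2 : unitAux δ N = (TensorProduct.assoc R Y X.carrier N.carrier).toLinearMap ∘ₗ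
      (δ.hom : D →ₗ[R] Y ⊗[R] X.carrier).rTensor N.carrier ∘ₗ N.coact := rfl
    -- Membership of `z` in `X □ N` moves the `D`-coaction from `N` to `X`, where the first
    -- compatibility applies.
    have e3 : N.coact.lTensor X.carrier z.1 =
      TensorProduct.assoc R X.carrier D N.carrier (X.rcoact.rTensor N.carrier z.1) :=
      (mem_cotensor.1 z.2).symm
    rw [e, e2, LinearMap.lTensor_comp_apply, LinearMap.lTensor_comp_apply, e3,
      ← assoc_lTensor_rTensor]
    change _ = TensorProduct.assoc R X.carrier Y (X.carrier ⊗[R] N.carrier)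
      ((copairing hC hδ).rTensor (X.carrier ⊗[R] N.carrier)
        (TensorProduct.assoc R C X.carrier N.carrier (X.lcoact.rTensor N.carrier z.1)))
    rw [← assoc_rTensor_rTensor, ← LinearMap.rTensor_comp_apply (N.carrier)
      ((copairing hC hδ).rTensor X.carrier), copairing_comp, LinearMap.rTensor_comp_apply,
      LinearMap.rTensor_comp_apply]
    generalize ((δ.hom : D →ₗ[R] Y ⊗[R] X.carrier).lTensor X.carrier).rTensor N.carrier
      (X.rcoact.rTensor N.carrier z.1) = w
    have : (TensorProduct.assoc R Y X.carrier N.carrier).toLinearMap.lTensor X.carrier ∘ₗ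
      (TensorProduct.assoc R X.carrier (Y ⊗[R] X.carrier) N.carrier).toLinearMap =
      (TensorProduct.assoc R X.carrier Y (X.carrier ⊗[R] N.carrier)).toLinearMap ∘ₗ
      (TensorProduct.assoc R (X.carrier ⊗[R] Y) X.carrier N.carrier).toLinearMap ∘ₗ
      (TensorProduct.assoc R X.carrier Y X.carrier).symm.toLinearMap.rTensor N.carrier := by
      ext; simp
    exact LinearMap.congr_fun this w
  have h3 := copairingTensor_injective hC hδ hX _ h2
  rw [← ht, cotensorEval_cotensorEquiv]
  apply Subtype.ext
  have h4 := congrArg (TensorProduct.lid R (X.carrier ⊗[R] N.carrier))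
    (congrArg ((Coalgebra.counit (R := R) (A := C)).rTensor (X.carrier ⊗[R] N.carrier)) h3)
  rw [← lTensor_rTensor_apply, ← assoc_rTensor_rTensor, ← LinearMap.rTensor_comp_apply,
    X.lcounit] at h4
  have h5 : ∀ s : R ⊗[R] cotensor X.right N, TensorProduct.lid R (X.carrier ⊗[R] N.carrier)
      ((cotensor X.right N).subtype.lTensor R s) = (TensorProduct.lid R _ s).1 := by
    intro s
    have : (TensorProduct.lid R (X.carrier ⊗[R] N.carrier)).toLinearMap ∘ₗ
      (cotensor X.right N).subtype.lTensor R = (cotensor X.right N).subtype ∘ₗ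
        (TensorProduct.lid R _).toLinearMap := by ext; simp
    exact LinearMap.congr_fun this s
  have h6 : ∀ s : X.carrier ⊗[R] N.carrier, TensorProduct.lid R (X.carrier ⊗[R] N.carrier)
      (TensorProduct.assoc R R X.carrier N.carrier
        ((TensorProduct.mk R R X.carrier 1).rTensor N.carrier s)) = s := by
    intro s
    have : (TensorProduct.lid R (X.carrier ⊗[R] N.carrier)).toLinearMap ∘ₗ
      (TensorProduct.assoc R R X.carrier N.carrier).toLinearMap ∘ₗ
        (TensorProduct.mk R R X.carrier 1).rTensor N.carrier = LinearMap.id := by ext; simp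
    exact LinearMap.congr_fun this s
  rw [h5, h6] at h4
  exact h4

/-- The functor `X □ -` is left adjoint to `Y ⊗ -`, for `Y = h(X, D)`. -/
noncomputable def cotensorAdj (hX : X.right.IsInjector) [X.right.IsQuasiFinite] :
    X.right.cotensorFunctor ⊣ hδ.leftComodule.tensorFunctor :=
  Adjunction.mkOfUnitCounit
    { unit :=
        { app := fun N => unitLeft hδ N
          naturality := fun N N' f => by
            apply LeftComodule.hom_ext
            apply LinearMap.ext
            intro n
            exact unitHom_naturality δ f (X.right.cotensorFunctor.map f).hom rfl n }
      counit :=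
        { app := fun W => ModuleCat.ofHom (cotensorEval hC hδ hX W)
          naturality := fun W W' f => by
            apply ModuleCat.hom_ext
            apply LinearMap.ext
            intro z
            exact cotensorEval_naturality hC hδ hX f z }
      left_triangle := by
        ext N z
        exact cotensorEval_unitLeft hC hδ hX N z
      right_triangle := by
        ext W s
        exact lTensor_cotensorEval_unitHom hC hδ hX W s }

end RightComodule.IsCohom

/-! ### Co-opposite coalgebras -/

section Reverse

variable {C C' M : Type u} [AddCommGroup C] [Module R C] [AddCommGroup C'] [Module R C']
  [AddCommGroup M] [Module R M]

/-- The isomorphism `C ⊗ M → M ⊗ C'` given by an isomorphism `C → C'`. -/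
noncomputable def flipTensor (σ : C ≃ₗ[R] C') (M : Type u) [AddCommGroup M] [Module R M] :
    C ⊗[R] M ≃ₗ[R] M ⊗[R] C' :=
  TensorProduct.comm R C M ≪≫ₗ LinearEquiv.lTensor M σ

@[simp]
theorem flipTensor_tmul (σ : C ≃ₗ[R] C') (c : C) (m : M) :
    flipTensor σ M (c ⊗ₜ m) = m ⊗ₜ σ c := rfl

/-- The isomorphism `C ⊗ (C ⊗ M) → M ⊗ (C' ⊗ C')` given by an isomorphism `C → C'`. -/
noncomputable def flipTensor₂ (σ : C ≃ₗ[R] C') (M : Type u) [AddCommGroup M] [Module R M] :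
    C ⊗[R] (C ⊗[R] M) ≃ₗ[R] M ⊗[R] (C' ⊗[R] C') :=
  flipTensor σ (C ⊗[R] M) ≪≫ₗ LinearEquiv.rTensor C' (flipTensor σ M) ≪≫ₗ
    TensorProduct.assoc R M C' C'

@[simp]
theorem flipTensor₂_tmul (σ : C ≃ₗ[R] C') (c d : C) (m : M) :
    flipTensor₂ σ M (c ⊗ₜ (d ⊗ₜ m)) = m ⊗ₜ (σ d ⊗ₜ σ c) := rfl

theorem flipTensor₂_lTensor (σ : C ≃ₗ[R] C') (l : M →ₗ[R] C ⊗[R] M) (z : C ⊗[R] M) :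
    flipTensor₂ σ M (l.lTensor C z) = TensorProduct.assoc R M C' C'
      (((flipTensor σ M).toLinearMap ∘ₗ l).rTensor C' (flipTensor σ M z)) := by
  induction z with
  | zero => simp
  | add a b ha hb => simp only [map_add, ha, hb]
  | tmul c m => rfl

theorem flipTensor₂_assoc (σ : C ≃ₗ[R] C') (Δ : C →ₗ[R] C ⊗[R] C) (Δ' : C' →ₗ[R] C' ⊗[R] C')
    (h : ∀ c, Δ' (σ c) = flipTensor σ C' (σ.toLinearMap.lTensor C (Δ c))) (z : C ⊗[R] M) :
    flipTensor₂ σ M (TensorProduct.assoc R C C M (Δ.rTensor M z)) =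
      Δ'.lTensor M (flipTensor σ M z) := by
  induction z with
  | zero => simp
  | add a b ha hb => simp only [map_add, ha, hb]
  | tmul c m =>
    rw [flipTensor_tmul, LinearMap.lTensor_tmul, h, LinearMap.rTensor_tmul]
    induction Δ c with
    | zero => simp
    | add a b ha hb => simp only [TensorProduct.add_tmul, TensorProduct.tmul_add, map_add, ha, hb]
    | tmul a b => simp

theorem flipTensor_lTensor (σ : C ≃ₗ[R] C')
    (z : C ⊗[R] C) : flipTensor σ C' (σ.toLinearMap.lTensor C z) =
      TensorProduct.map σ.toLinearMap σ.toLinearMap (TensorProduct.comm R C C z) := by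
  induction z with
  | zero => simp
  | add a b ha hb => simp only [map_add, ha, hb]
  | tmul c m => simp

theorem flipTensor_naturality (σ : C ≃ₗ[R] C') {N : Type u} [AddCommGroup N] [Module R N]
    (f : M →ₗ[R] N) (z : C ⊗[R] M) :
    flipTensor σ N (f.lTensor C z) = f.rTensor C' (flipTensor σ M z) := by
  induction z with
  | zero => simp
  | add a b ha hb => simp only [map_add, ha, hb]
  | tmul c m => simp

end Reverse

/-- A linear isomorphism between coalgebras that reverses the comultiplication. -/
structure IsAntiEquiv {C' : Type u} [AddCommGroup C'] [Module R C'] [Coalgebra R C']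
    (σ : C ≃ₗ[R] C') : Prop where
  comul : ∀ c, Coalgebra.comul (R := R) (σ c) =
    flipTensor σ C' (σ.toLinearMap.lTensor C (Coalgebra.comul (R := R) c))
  counit : ∀ c, Coalgebra.counit (R := R) (σ c) = Coalgebra.counit (R := R) c

/-- Permits passage from `Cop C` back to `C` with no identification of `Cop (Cop C)` with `C`. -/
theorem IsAntiEquiv.symm {C' : Type u} [AddCommGroup C'] [Module R C'] [Coalgebra R C']
    {σ : C ≃ₗ[R] C'} (h : IsAntiEquiv σ) : IsAntiEquiv σ.symm where
  comul c := by
    obtain ⟨c, rfl⟩ := σ.surjective c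
    rw [h.comul, LinearEquiv.symm_apply_apply, flipTensor_lTensor, flipTensor_lTensor]
    generalize Coalgebra.comul (R := R) c = z
    induction z with
    | zero => simp
    | add a b ha hb => simp only [map_add, ← ha, ← hb]
    | tmul c m => simp
  counit c := by
    rw [← h.counit, LinearEquiv.apply_symm_apply]

section Cop

variable {C' : Type u} [AddCommGroup C'] [Module R C'] (σ : C ≃ₗ[R] C')

/-- The opposite comultiplication, transported along a linear isomorphism. -/
noncomputable def antiComul : C' →ₗ[R] C' ⊗[R] C' :=
  (flipTensor σ C').toLinearMap ∘ₗ σ.toLinearMap.lTensor C ∘ₗ Coalgebra.comul ∘ₗ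
    σ.symm.toLinearMap

theorem antiComul_apply (c : C) : antiComul σ (σ c) =
    flipTensor σ C' (σ.toLinearMap.lTensor C (Coalgebra.comul (R := R) c)) := by
  simp [antiComul]

/-- The opposite coalgebra structure, transported along a linear isomorphism. -/
noncomputable abbrev antiCoalgebra : Coalgebra R C' where
  comul := antiComul σ
  counit := Coalgebra.counit ∘ₗ σ.symm.toLinearMap
  coassoc := by
    ext c
    obtain ⟨c, rfl⟩ := σ.surjective c
    -- The left regular coaction of `C`, moved to `C'`. Coassociativity of the reversed
    -- comultiplication is coassociativity of `l` read in the opposite order.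
    let l : C' →ₗ[R] C ⊗[R] C' := σ.toLinearMap.lTensor C ∘ₗ
      (Coalgebra.comul (R := R) (A := C)) ∘ₗ σ.symm.toLinearMap
    have hl : ∀ c, l (σ c) = σ.toLinearMap.lTensor C (Coalgebra.comul (R := R) c) := fun c => by
      simp [l]
    have hl' : l ∘ₗ σ.toLinearMap = σ.toLinearMap.lTensor C ∘ₗ Coalgebra.comul :=
      LinearMap.ext hl
    have h1 := flipTensor₂_lTensor σ l (l (σ c))
    have h2 := flipTensor₂_assoc σ (Coalgebra.comul (R := R) (A := C)) (antiComul σ)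
      (antiComul_apply σ) (l (σ c))
    have h3 : l.lTensor C (l (σ c)) = TensorProduct.assoc R C C C'
        ((Coalgebra.comul (R := R) (A := C)).rTensor C' (l (σ c))) := by
      rw [hl, ← LinearMap.lTensor_comp_apply, hl', LinearMap.lTensor_comp_apply,
        comul_lTensor_comul, ← lTensor_rTensor_apply, assoc_lTensor]
    rw [h3] at h1
    exact h1.symm.trans h2
  rTensor_counit_comp_comul := by
    ext c
    obtain ⟨c, rfl⟩ := σ.surjective c
    have h := Coalgebra.lTensor_counit_comul (R := R) c
    have h2 : ∀ z : C ⊗[R] C, (Coalgebra.counit ∘ₗ σ.symm.toLinearMap).rTensor C'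
        (flipTensor σ C' (σ.toLinearMap.lTensor C z)) = σ.toLinearMap.lTensor R
            (TensorProduct.comm R C R ((Coalgebra.counit (R := R) (A := C)).lTensor C z)) := by
      intro z
      induction z with
      | zero => simp
      | add a b ha hb => simp only [map_add, ha, hb]
      | tmul c m => simp
    rw [LinearMap.comp_apply, antiComul_apply, h2, h]
    simp
  lTensor_counit_comp_comul := by
    ext c
    obtain ⟨c, rfl⟩ := σ.surjective c
    have h := Coalgebra.rTensor_counit_comul (R := R) c
    have h2 : ∀ z : C ⊗[R] C, (Coalgebra.counit ∘ₗ σ.symm.toLinearMap).lTensor C'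
        (flipTensor σ C' (σ.toLinearMap.lTensor C z)) = σ.toLinearMap.rTensor R
            (TensorProduct.comm R R C ((Coalgebra.counit (R := R) (A := C)).rTensor C z)) := by
      intro z
      induction z with
      | zero => simp
      | add a b ha hb => simp only [map_add, ha, hb]
      | tmul c m => simp
    rw [LinearMap.comp_apply, antiComul_apply, h2, h]
    simp

theorem isAntiEquiv_antiCoalgebra :
    letI := antiCoalgebra σ
    IsAntiEquiv σ :=
  letI := antiCoalgebra σ
  { comul := antiComul_apply σ
    counit := fun c => congrArg (Coalgebra.counit (R := R)) (σ.symm_apply_apply c) }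

end Cop

/-- The coalgebra `C` with the opposite comultiplication. -/
def Cop (C : Type u) : Type u := C

namespace Cop

instance : AddCommGroup (Cop C) := inferInstanceAs (AddCommGroup C)

instance : Module R (Cop C) := inferInstanceAs (Module R C)

instance [Module.Flat R C] : Module.Flat R (Cop C) := inferInstanceAs (Module.Flat R C)

/-- The identity map from `C` to its co-opposite coalgebra. -/
def equiv (R : Type u) [CommRing R] (C : Type u) [AddCommGroup C] [Module R C] :
    C ≃ₗ[R] Cop C := LinearEquiv.refl R C

noncomputable instance : Coalgebra R (Cop C) := antiCoalgebra (equiv R C)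

theorem isAntiEquiv (R : Type u) [CommRing R] (C : Type u) [AddCommGroup C] [Module R C]
    [Coalgebra R C] : IsAntiEquiv (equiv R C) := isAntiEquiv_antiCoalgebra _

end Cop

section Flip

variable {C' : Type u} [AddCommGroup C'] [Module R C'] [Coalgebra R C'] {σ : C ≃ₗ[R] C'}

theorem flipTensor_counit (hσ : IsAntiEquiv σ) {M : Type u} [AddCommGroup M] [Module R M]
    (z : C ⊗[R] M) : (Coalgebra.counit (R := R) (A := C')).lTensor M (flipTensor σ M z) =
      TensorProduct.comm R R M ((Coalgebra.counit (R := R) (A := C)).rTensor M z) := by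
  induction z with
  | zero => simp
  | add a b ha hb => simp only [map_add, ha, hb]
  | tmul c m => simp [hσ.counit]

namespace LeftComodule

/-- The right `C'`-comodule given by a left `C`-comodule, for `C'` opposite to `C`. -/
noncomputable abbrev flip (hσ : IsAntiEquiv σ) (M : LeftComodule R C) : RightComodule R C' where
  carrier := M.carrier
  coact := (flipTensor σ M.carrier).toLinearMap ∘ₗ M.coact
  coassoc := by
    ext m
    refine (flipTensor₂_lTensor σ M.coact (M.coact m)).symm.trans ?_
    rw [← M.coassoc_apply]
    exact flipTensor₂_assoc σ _ _ hσ.comul _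
  counit := by
    ext m
    refine (flipTensor_counit hσ (M.coact m)).trans ?_
    rw [counit_apply]
    rfl

/-- The functor from left `C`-comodules to right `C'`-comodules, for `C'` opposite to `C`. -/
noncomputable abbrev flipFunctor (hσ : IsAntiEquiv σ) :
    LeftComodule R C ⥤ RightComodule R C' where
  obj M := M.flip hσ
  map {M N} f := ⟨f.hom, by
    ext m
    change flipTensor σ N.carrier (N.coact (f.hom m)) =
      f.hom.rTensor C' (flipTensor σ M.carrier (M.coact m))
    rw [colinear_apply, flipTensor_naturality]⟩

section

variable (hσ : IsAntiEquiv σ)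

instance : (flipFunctor hσ).Additive where

instance : (flipFunctor hσ).Linear R where

instance : (flipFunctor hσ).Faithful where
  map_injective h := hom_ext (congrArg RightComodule.Hom.hom h)

instance : (flipFunctor hσ).Full where
  map_surjective {M N} f := ⟨⟨f.hom, by
    ext m
    apply (flipTensor σ N.carrier).injective
    refine (RightComodule.colinear_apply f m).trans ?_
    exact (flipTensor_naturality σ f.hom _).symm⟩, rfl⟩

/-- The left `C`-comodule given by a right `C'`-comodule, for `C'` opposite to `C`. -/
noncomputable abbrev _root_.MoritaTakeuchi.RightComodule.unflip (N : RightComodule R C') :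
    LeftComodule R C where
  carrier := N.carrier
  coact := (flipTensor σ N.carrier).symm.toLinearMap ∘ₗ N.coact
  coassoc := by
    have e : (flipTensor σ N.carrier).toLinearMap ∘ₗ (flipTensor σ N.carrier).symm.toLinearMap ∘ₗ
        N.coact = N.coact := by
      ext n
      exact (flipTensor σ N.carrier).apply_symm_apply (N.coact n)
    ext n
    apply (flipTensor₂ σ N.carrier).injective
    refine (flipTensor₂_assoc σ _ _ hσ.comul _).trans ?_
    refine Eq.trans ?_ (flipTensor₂_lTensor σ _ _).symm
    rw [e]
    have e' : flipTensor σ N.carrier ((flipTensor σ N.carrier).symm (N.coact n)) = N.coact n :=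
      LinearEquiv.apply_symm_apply _ _
    change (Coalgebra.comul (R := R) (A := C')).lTensor N.carrier (flipTensor σ N.carrier
      ((flipTensor σ N.carrier).symm (N.coact n))) = TensorProduct.assoc R N.carrier C' C'
        (N.coact.rTensor C' (flipTensor σ N.carrier
          ((flipTensor σ N.carrier).symm (N.coact n))))
    rw [e', RightComodule.coassoc_apply]
  counit := by
    ext n
    have h := flipTensor_counit hσ ((flipTensor σ N.carrier).symm (N.coact n))
    rw [LinearEquiv.apply_symm_apply, RightComodule.counit_apply] at h
    exact (TensorProduct.comm R R N.carrier).injective h.symm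

instance : (flipFunctor hσ).EssSurj where
  mem_essImage N := ⟨N.unflip hσ, ⟨RightComodule.isoOfBijective ⟨LinearMap.id, by
    ext n
    rw [LinearMap.rTensor_id]
    exact (LinearEquiv.apply_symm_apply (flipTensor σ N.carrier) _).symm⟩
      Function.bijective_id⟩⟩

instance : (flipFunctor hσ).IsEquivalence where

end

/-- Transferred from right comodules over `Cop C`: the flip is an equivalence that leaves the
underlying maps unchanged. -/
theorem injective_of_mono [Module.Flat R C] {M N : LeftComodule R C} (f : M ⟶ N) [Mono f] :
    Function.Injective f.hom := by
  have := (flipFunctor (Cop.isAntiEquiv R C)).map_mono f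
  exact RightComodule.injective_of_mono ((flipFunctor (Cop.isAntiEquiv R C)).map f)

theorem Equivalent.flip (hσ : IsAntiEquiv σ) {D' : Type u} [AddCommGroup D'] [Module R D']
    [Coalgebra R D'] {τ : D ≃ₗ[R] D'} (hτ : IsAntiEquiv τ) (h : Equivalent R C D) :
    RightComodule.Equivalent R C' D' := by
  obtain ⟨F, hF, hadd, hlin⟩ := h
  have : (flipFunctor hσ).asEquivalence.functor.Additive :=
    inferInstanceAs (flipFunctor hσ).Additive
  have : (flipFunctor hσ).asEquivalence.functor.Linear R :=
    inferInstanceAs ((flipFunctor hσ).Linear R)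
  exact ⟨(flipFunctor hσ).asEquivalence.inverse ⋙ F ⋙ flipFunctor hτ, inferInstance,
    inferInstance, inferInstance⟩

theorem Equivalent.of_flip (hσ : IsAntiEquiv σ) {D' : Type u} [AddCommGroup D'] [Module R D']
    [Coalgebra R D'] {τ : D ≃ₗ[R] D'} (hτ : IsAntiEquiv τ) (h : RightComodule.Equivalent R C' D') :
    Equivalent R C D := by
  obtain ⟨F, hF, hadd, hlin⟩ := h
  have : (flipFunctor hτ).asEquivalence.functor.Additive :=
    inferInstanceAs (flipFunctor hτ).Additive
  have : (flipFunctor hτ).asEquivalence.functor.Linear R :=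
    inferInstanceAs ((flipFunctor hτ).Linear R)
  exact ⟨flipFunctor hσ ⋙ F ⋙ (flipFunctor hτ).asEquivalence.inverse, inferInstance,
    inferInstance, inferInstance⟩

end LeftComodule

end Flip

/-! ### Criteria for coflatness and for recognising the coendomorphism coalgebra. -/

namespace RightComodule

/-- Two universal maps differ by a unique linear isomorphism. The equations for `κ` are those that
determine the structure of `e(X)`, so uniqueness makes the isomorphism one of coalgebras. -/
theorem IsCohom.coendEquiv {X : RightComodule R D} [X.IsQuasiFinite] {κ : X ⟶ X.tensor C}
    (h : IsCohom κ)
    (hcomul : ∀ x, (Coalgebra.comul (R := R) (A := C)).rTensor X.carrier (κ.hom x) =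
      (TensorProduct.assoc R C C X.carrier).symm (κ.hom.lTensor C (κ.hom x)))
    (hcounit : ∀ x, (Coalgebra.counit (R := R) (A := C)).rTensor X.carrier (κ.hom x) = 1 ⊗ₜ x) :
    Nonempty (X.Coend ≃ₗc[R] C) := by
  let e : X.Coend ≃ₗ[R] C := X.isCohom_coendUnit.equiv h
  have he : ∀ x, e.toLinearMap.rTensor X.carrier (X.coendCoact x) = κ.hom x :=
    fun x => X.isCohom_coendUnit.lift_apply κ x
  have he' : e.toLinearMap.rTensor X.carrier ∘ₗ X.coendCoact = κ.hom := LinearMap.ext he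
  refine ⟨{ e with counit_comp := ?_, map_comp_comul := ?_ }⟩
  · apply X.coend_hom_ext
    intro x
    change (Coalgebra.counit (R := R) (A := C) ∘ₗ e.toLinearMap).rTensor X.carrier _ =
      X.coendCounit.rTensor X.carrier _
    rw [LinearMap.rTensor_comp_apply, he, hcounit, coendCounit_spec]
  · apply X.coend_hom_ext
    intro x
    change (TensorProduct.map e.toLinearMap e.toLinearMap ∘ₗ X.coendComul).rTensor X.carrier _ =
      (Coalgebra.comul (R := R) (A := C) ∘ₗ e.toLinearMap).rTensor X.carrier _
    have h1 : TensorProduct.map e.toLinearMap e.toLinearMap =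
        e.toLinearMap.rTensor C ∘ₗ e.toLinearMap.lTensor X.Coend :=
      (LinearMap.rTensor_comp_lTensor _ _ _).symm
    rw [LinearMap.rTensor_comp_apply, LinearMap.rTensor_comp_apply, he, hcomul, coendComul_spec,
      h1, LinearMap.rTensor_comp_apply, ← assoc_symm_rTensor_lTensor, ← assoc_symm_rTensor,
      ← LinearMap.lTensor_comp_apply, he', ← lTensor_rTensor_apply, he]

/-- For flat `X` and `D` the functor `X □ -` is automatically left exact, so only surjectivity has
to be supplied. -/
theorem IsCoflat.of_flat [Module.Flat R D] (X : RightComodule R D) [Module.Flat R X.carrier]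
    (h : ∀ ⦃N N' : LeftComodule R D⦄ (g : N ⟶ N'), Function.Surjective g.hom →
      Function.Surjective (X.cotensorFunctor.map g).hom) : X.IsCoflat := by
  intro N₁ N₂ N₃ f g hf hfg hg
  have hfX : Function.Injective (f.hom.lTensor X.carrier) :=
    Module.Flat.lTensor_preserves_injective_linearMap _ hf
  refine ⟨fun a b hab => Subtype.ext (hfX (congrArg Subtype.val hab)), ?_, h g hg⟩
  intro z
  have hexX := Module.Flat.lTensor_exact X.carrier hfg
  constructor
  · intro hz
    obtain ⟨y, hy⟩ := (hexX z.1).1 (congrArg Subtype.val hz)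
    refine ⟨⟨y, ?_⟩, Subtype.ext hy⟩
    -- The preimage `y` lies in the cotensor product because its defect maps to that of `z`, which
    -- is zero, under this injection.
    have hinj : Function.Injective ((f.hom.lTensor D).lTensor X.carrier) :=
      Module.Flat.lTensor_preserves_injective_linearMap _
        (Module.Flat.lTensor_preserves_injective_linearMap _ hf)
    apply hinj
    rw [← cotensorMap_lTensor, map_zero, hy]
    exact z.2
  · rintro ⟨y, rfl⟩
    exact Subtype.ext (hexX.apply_apply_eq_zero y.1)

end RightComodule

namespace LeftComodule

theorem IsCoflat.of_flat [Module.Flat R D] (Y : LeftComodule R D) [Module.Flat R Y.carrier]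
    (h : ∀ ⦃M M' : RightComodule R D⦄ (g : M ⟶ M'), Function.Surjective g.hom →
      Function.Surjective (Y.cotensorFunctor.map g).hom) : Y.IsCoflat := by
  intro M₁ M₂ M₃ f g hf hfg hg
  have hfY : Function.Injective (f.hom.rTensor Y.carrier) :=
    Module.Flat.rTensor_preserves_injective_linearMap _ hf
  refine ⟨fun a b hab => Subtype.ext (hfY (congrArg Subtype.val hab)), ?_, h g hg⟩
  intro z
  have hexY := Module.Flat.rTensor_exact Y.carrier hfg
  constructor
  · intro hz
    obtain ⟨y, hy⟩ := (hexY z.1).1 (congrArg Subtype.val hz)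
    refine ⟨⟨y, ?_⟩, Subtype.ext hy⟩
    have hinj : Function.Injective (f.hom.rTensor (D ⊗[R] Y.carrier)) :=
      Module.Flat.rTensor_preserves_injective_linearMap _ hf
    apply hinj
    rw [← cotensorMap_rTensor, map_zero, hy]
    exact z.2
  · rintro ⟨y, rfl⟩
    exact Subtype.ext (hexY.apply_apply_eq_zero y.1)

/-- Two instances of the universal property of `κ` suffice: a lift of the unit of `e(Y)`, and
uniqueness for endomorphisms of `C`. They make the comparison maps mutually inverse. -/
theorem coendEquiv {Y : LeftComodule R D} [Y.IsQuasiFinite] {κ : Y ⟶ Y.tensor C}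
    (hlift : ∀ f : Y ⟶ Y.tensor Y.Coend, ∃ k : C →ₗ[R] Y.Coend,
      k.lTensor Y.carrier ∘ₗ κ.hom = f.hom)
    (hext : ∀ k : C →ₗ[R] C, k.lTensor Y.carrier ∘ₗ κ.hom = κ.hom → k = LinearMap.id)
    (hcomul : ∀ x, (Coalgebra.comul (R := R) (A := C)).lTensor Y.carrier (κ.hom x) =
      TensorProduct.assoc R Y.carrier C C (κ.hom.rTensor C (κ.hom x)))
    (hcounit : ∀ x, (Coalgebra.counit (R := R) (A := C)).lTensor Y.carrier (κ.hom x) = x ⊗ₜ 1) :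
    Nonempty (Y.Coend ≃ₗc[R] C) := by
  obtain ⟨k, hk⟩ := hlift Y.coendUnit
  have hl : ∀ x, (Y.coendLift κ).lTensor Y.carrier (Y.coendCoact x) = κ.hom x :=
    LinearMap.congr_fun (Y.coendLift_spec κ)
  have hk' : ∀ x, k.lTensor Y.carrier (κ.hom x) = Y.coendCoact x := LinearMap.congr_fun hk
  let e : Y.Coend ≃ₗ[R] C := LinearEquiv.ofLinearMap (Y.coendLift κ) k
    (hext _ (LinearMap.ext fun x => by
      rw [LinearMap.comp_apply, LinearMap.lTensor_comp_apply, hk', hl]))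
    (Y.coend_hom_ext fun x => by
      rw [LinearMap.lTensor_comp_apply, hl, hk', LinearMap.lTensor_id, LinearMap.id_apply])
  have he : ∀ x, e.toLinearMap.lTensor Y.carrier (Y.coendCoact x) = κ.hom x := hl
  have he' : e.toLinearMap.lTensor Y.carrier ∘ₗ Y.coendCoact = κ.hom := LinearMap.ext he
  refine ⟨{ e with counit_comp := ?_, map_comp_comul := ?_ }⟩
  · apply Y.coend_hom_ext
    intro x
    change (Coalgebra.counit (R := R) (A := C) ∘ₗ e.toLinearMap).lTensor Y.carrier _ =
      Y.coendCounit.lTensor Y.carrier _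
    rw [LinearMap.lTensor_comp_apply, he, hcounit, coendCounit_spec]
  · apply Y.coend_hom_ext
    intro x
    change (TensorProduct.map e.toLinearMap e.toLinearMap ∘ₗ Y.coendComul).lTensor Y.carrier _ =
      (Coalgebra.comul (R := R) (A := C) ∘ₗ e.toLinearMap).lTensor Y.carrier _
    have h1 : TensorProduct.map e.toLinearMap e.toLinearMap =
        e.toLinearMap.lTensor C ∘ₗ e.toLinearMap.rTensor Y.Coend :=
      (LinearMap.lTensor_comp_rTensor _ _ _).symm
    rw [LinearMap.lTensor_comp_apply, LinearMap.lTensor_comp_apply, he, hcomul, coendComul_spec,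
      h1, LinearMap.lTensor_comp_apply, ← assoc_lTensor_rTensor, ← LinearMap.rTensor_comp_apply,
      he', ← assoc_lTensor, lTensor_rTensor_apply, he]

end LeftComodule

/-! ### The conditions of the theorem for `X` and for `Y = h(X, D)`, from a flat cogenerator. -/

namespace RightComodule.IsCohom

section

variable {X : Bicomodule R C D} {Y : Type u} [AddCommGroup Y] [Module R Y]
  {δ : regular R D ⟶ X.right.tensor Y}

/-- The `D`-`C`-bicomodule `h(X, D)`. -/
noncomputable abbrev bicomodule (hδ : IsCohom δ) : Bicomodule R D C where
  carrier := Y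
  lcoact := hδ.leftCoact
  lcoassoc := hδ.leftComodule.coassoc
  lcounit := hδ.leftComodule.counit
  rcoact := hδ.coact
  rcoassoc := hδ.comodule.coassoc
  rcounit := hδ.comodule.counit
  bicolinear := by
    apply hδ.hom_ext
    intro (d : D)
    change ((TensorProduct.assoc R D Y C).toLinearMap ∘ₗ hδ.leftCoact.rTensor C ∘ₗ
      hδ.coact).rTensor X.carrier (δ.hom d) =
      (hδ.coact.lTensor D ∘ₗ hδ.leftCoact).rTensor X.carrier (δ.hom d)
    have hc : hδ.coact.rTensor X.carrier ∘ₗ δ.hom =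
        (TensorProduct.assoc R Y C X.carrier).symm.toLinearMap ∘ₗ X.lcoact.lTensor Y ∘ₗ δ.hom :=
      LinearMap.ext hδ.coact_apply
    rw [LinearMap.rTensor_comp_apply, LinearMap.rTensor_comp_apply, LinearMap.rTensor_comp_apply,
      hδ.coact_apply, hδ.leftCoact_apply, ← assoc_symm_rTensor, ← lTensor_rTensor_apply,
      hδ.leftCoact_apply, ← assoc_symm_rTensor_lTensor, ← LinearMap.lTensor_comp_apply, hc,
      assoc_rTensor_assoc_symm', ← assoc_symm_lTensor_lTensor, LinearEquiv.apply_symm_apply,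
      LinearMap.lTensor_comp_apply, LinearMap.lTensor_comp_apply]

/-- The right coaction of `C` on `h(X, D)` as a left `D`-colinear map. -/
noncomputable abbrev coactLeftHom (hδ : IsCohom δ) :
    hδ.leftComodule ⟶ hδ.leftComodule.tensor C where
  hom := hδ.coact
  colinear := hδ.bicomodule.bicolinear

/-- `h(X, M) = M □ h(X, D)`, as an isomorphism of functors. -/
noncomputable def cohomIsoCotensor (hX : X.right.IsInjector) [X.right.IsQuasiFinite]
    (hδ : IsCohom δ) : X.right.cohom ≅ hδ.leftComodule.cotensorFunctor :=
  NatIso.ofComponents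
    (fun M => ((LinearEquiv.ofInjective (hδ.toCotensor (isCohom_unit X.right M))
      (hδ.toCotensor_injective hX _)).trans (LinearEquiv.ofEq _ _
        (range_toCotensor hX hδ (isCohom_unit X.right M)))).toModuleIso)
    (fun {M N} f => by
      ext v
      apply Subtype.ext
      have h1 : (X.right.cohom.map f).hom =
          (isCohom_unit X.right M).map (isCohom_unit X.right N) f := by
        apply (isCohom_unit X.right M).eq_map
        intro x
        exact (LinearMap.congr_fun (congrArg Hom.hom (X.right.cohomAdj.unit.naturality f)) x).symm
      change hδ.toCotensor (isCohom_unit X.right N) ((X.right.cohom.map f).hom v) =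
        f.hom.rTensor Y (hδ.toCotensor (isCohom_unit X.right M) v)
      rw [h1]
      exact LinearMap.congr_fun (hδ.toCotensor_naturality (isCohom_unit X.right M)
        (isCohom_unit X.right N) f) v)

end

end RightComodule.IsCohom

theorem LeftComodule.coact_injective (N : LeftComodule R D) : Function.Injective N.coact := by
  intro x y h
  have e := congrArg (TensorProduct.lid R N.carrier)
    (congrArg ((Coalgebra.counit (R := R) (A := D)).rTensor N.carrier) h)
  simpa only [counit_apply, TensorProduct.lid_tmul, one_smul] using e

namespace RightComodule

theorem IsCohom.cohom_faithful {X : RightComodule R D} [X.IsQuasiFinite]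
    (hX : X.IsFlatCogenerator) : X.cohom.Faithful := by
  have : ∀ M, Mono (X.cohomAdj.unit.app M) := fun M =>
    mono_of_injective _ ((isCohom_unit X M).injective hX)
  exact X.cohomAdj.faithful_L_of_mono_unit_app

namespace IsCohom

variable {X : Bicomodule R C D} {Y : Type u} [AddCommGroup Y] [Module R Y]
  {δ : regular R D ⟶ X.right.tensor Y}

/-- `N → D ⊗ N` is split injective. Up to a swap, `δ ⊗ N` is the universal map of the right comodule
`N ⊗ D`, hence injective by cogeneration. -/
theorem unitHom_injective [Module.Flat R Y] (hδ : IsCohom δ) (hX : X.right.IsFlatCogenerator)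
    (N : LeftComodule R D) : Function.Injective (unitHom δ N) := by
  have h1 : Function.Injective ((δ.hom : D →ₗ[R] Y ⊗[R] X.carrier).rTensor N.carrier) := by
    rw [← LinearMap.lTensor_inj_iff_rTensor_inj]
    have h := (hδ.tensor N.carrier).injective hX
    intro a b hab
    exact h (congrArg (TensorProduct.assoc R N.carrier Y X.carrier).symm hab)
  intro a b hab
  apply N.coact_injective
  apply h1
  apply (TensorProduct.assoc R Y X.carrier N.carrier).injective
  change unitAux δ N a = unitAux δ N b
  rw [← subtype_unitHom, ← subtype_unitHom, hab]

theorem cotensorFunctor_faithful [Module.Flat R D] [Module.Flat R Y] (hδ : IsCohom δ)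
    (hX : X.right.IsFlatCogenerator) [X.right.IsQuasiFinite] (hC : IsCohom X.lcoactHom) :
    X.right.cotensorFunctor.Faithful := by
  have : ∀ N, Mono ((cotensorAdj hC hδ hX.isInjector).unit.app N) := fun N =>
    LeftComodule.mono_of_injective _ (hδ.unitHom_injective hX N)
  exact (cotensorAdj hC hδ hX.isInjector).faithful_L_of_mono_unit_app

/-- A bicomodule that realizes `C` as `h(X, X)`, with `X` a flat cogenerator, satisfies the
conditions of the Morita-Takeuchi theorem. -/
theorem isMoritaTakeuchi_right [Module.Flat R D] (hX : X.right.IsFlatCogenerator)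
    (hC : IsCohom X.lcoactHom) : X.right.IsMoritaTakeuchi C := by
  have := hX.isQuasiFinite
  have := hX.flat
  have hδ := isCohom_unit X.right (regular R D)
  have := hδ.flat hX.isInjector
  have adj := cotensorAdj hC hδ hX.isInjector
  -- As a left adjoint, `X □ -` preserves epimorphisms, hence surjections; flatness of `X` provides
  -- the rest of coflatness.
  have := Functor.preservesEpimorphisms_of_adjunction adj
  refine ⟨inferInstance, ⟨IsCoflat.of_flat X.right fun N N' g hg => ?_,
    hδ.cotensorFunctor_faithful hX hC⟩, hX.isInjector, hC.coendEquiv ?_ X.lcounit_apply⟩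
  · have := LeftComodule.epi_of_surjective g hg
    exact (ModuleCat.epi_iff_surjective _).1 (X.right.cotensorFunctor.map_epi g)
  · intro x
    refine ((TensorProduct.assoc R C C X.carrier).symm_apply_eq.2 ?_).symm
    exact X.lcoassoc_apply x

/-- The isomorphism `C → X □ h(X, D)`. -/
noncomputable def copairingEquiv (hC : IsCohom X.lcoactHom) (hδ : IsCohom δ)
    (hX : X.right.IsInjector) [X.right.IsQuasiFinite] :
    C ≃ₗ[R] cotensor X.right hδ.leftComodule :=
  (LinearEquiv.ofInjective (copairing hC hδ) (hδ.toCotensor_injective hX hC)).trans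
    (LinearEquiv.ofEq _ _ (range_toCotensor hX hδ hC))

/-- The universal map `Y → Y ⊗ (X □ Y)` is the `C`-coaction of `Y` once `X □ Y` is identified with
`C`. This is what recognises `e(Y)` as `C` with its coalgebra structure. -/
theorem unitHom_leftComodule [Module.Flat R Y] (hC : IsCohom X.lcoactHom) (hδ : IsCohom δ)
    (hX : X.right.IsInjector) [X.right.IsQuasiFinite] :
    unitHom δ hδ.leftComodule = (copairingEquiv hC hδ hX).toLinearMap.lTensor Y ∘ₗ hδ.coact := by
  ext y
  apply subtype_lTensor_injective (X := X) (Y := Y) hδ.leftComodule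
  rw [subtype_unitHom, LinearMap.comp_apply, ← LinearMap.lTensor_comp_apply]
  exact (LinearMap.congr_fun (lTensor_copairing_comp hC hδ) y).symm

/-- The adjunction gives quasi-finiteness with `h(Y, -) = X □ -`. Its left adjoint preserves
monomorphisms because `X` is flat, so `Y` is an injector. The isomorphism `- □ Y = h(X, -)`
transports faithfulness and preservation of epimorphisms, and `h(Y, Y) = X □ Y = C`. -/
theorem isMoritaTakeuchi_left [Module.Flat R D] (hX : X.right.IsFlatCogenerator)
    [X.right.IsQuasiFinite] (hC : IsCohom X.lcoactHom) (hδ : IsCohom δ) :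
    hδ.leftComodule.IsMoritaTakeuchi C := by
  have := hX.flat
  have hY : Module.Flat R Y := hδ.flat hX.isInjector
  have : Module.Flat R hδ.leftComodule.carrier := hY
  let adj := cotensorAdj hC hδ hX.isInjector
  have hq : hδ.leftComodule.IsQuasiFinite := adj.isRightAdjoint
  have hmono : X.right.cotensorFunctor.PreservesMonomorphisms := ⟨fun {N N'} f _ => by
    have hf : Function.Injective (f.hom.lTensor X.carrier) :=
      Module.Flat.lTensor_preserves_injective_linearMap _ (LeftComodule.injective_of_mono f)
    refine (ModuleCat.mono_iff_injective _).2 fun a b hab => Subtype.ext (hf ?_)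
    exact congrArg Subtype.val hab⟩
  have hinj : hδ.leftComodule.IsInjector :=
    Functor.preservesInjectiveObjects_of_adjunction_of_preservesMonomorphisms adj
  have hepi := Functor.preservesEpimorphisms_of_adjunction X.right.cohomAdj
  have hfaith := cohom_faithful hX
  let iso := cohomIsoCotensor hX.isInjector hδ
  let e := copairingEquiv hC hδ hX.isInjector
  have hunit := unitHom_leftComodule hC hδ hX.isInjector
  have hee : ∀ {W : Type u} [AddCommGroup W] [Module R W]
      (k : cotensor X.right hδ.leftComodule →ₗ[R] W),
      k.lTensor Y ∘ₗ unitHom δ hδ.leftComodule = (k ∘ₗ e.toLinearMap).lTensor Y ∘ₗ hδ.coact := by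
    intro W _ _ k
    rw [hunit, ← LinearMap.comp_assoc, ← LinearMap.lTensor_comp]
  refine ⟨hq, ⟨LeftComodule.IsCoflat.of_flat _ fun M M' g hg => ?_, Functor.Faithful.of_iso iso⟩,
    hinj, LeftComodule.coendEquiv (κ := hδ.coactLeftHom) ?_ ?_ ?_ ?_⟩
  · have := Functor.PreservesEpimorphisms.of_iso iso
    have := epi_of_surjective g hg
    exact (ModuleCat.epi_iff_surjective _).1 (hδ.leftComodule.cotensorFunctor.map_epi g)
  · intro f
    obtain ⟨g, hg⟩ := (adj.homEquiv hδ.leftComodule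
      (ModuleCat.of R hδ.leftComodule.Coend)).surjective f
    rw [Adjunction.homEquiv_unit] at hg
    exact ⟨g.hom ∘ₗ e.toLinearMap, (hee g.hom).symm.trans (congrArg LeftComodule.Hom.hom hg)⟩
  · intro k hk
    let g₁ : X.right.cotensorFunctor.obj hδ.leftComodule ⟶ ModuleCat.of R C :=
      ModuleCat.ofHom (k ∘ₗ e.symm.toLinearMap)
    let g₂ : X.right.cotensorFunctor.obj hδ.leftComodule ⟶ ModuleCat.of R C :=
      ModuleCat.ofHom e.symm.toLinearMap
    have h : g₁ = g₂ := by
      apply (adj.homEquiv hδ.leftComodule (ModuleCat.of R C)).injective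
      rw [Adjunction.homEquiv_unit, Adjunction.homEquiv_unit]
      apply LeftComodule.hom_ext
      refine (hee (k ∘ₗ e.symm.toLinearMap)).trans (Eq.trans ?_ (hee e.symm.toLinearMap).symm)
      rw [LinearMap.comp_assoc, LinearEquiv.symm_comp, LinearMap.comp_id, LinearMap.lTensor_id]
      exact hk
    have h' := congrArg ModuleCat.Hom.hom h
    refine LinearMap.cancel_right e.symm.surjective |>.1 ?_
    exact h'
  · exact fun y => (hδ.comodule.coassoc_apply y).symm
  · exact fun y => hδ.comodule.counit_apply y

end IsCohom

end RightComodule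

/-- The coalgebra `D` as a left comodule over itself. -/
abbrev LeftComodule.regular (R : Type u) [CommRing R] (D : Type u) [AddCommGroup D] [Module R D]
    [Coalgebra R D] : LeftComodule R D where
  carrier := D
  coact := Coalgebra.comul
  coassoc := Coalgebra.coassoc
  counit := Coalgebra.rTensor_counit_comp_comul

/-! ### From the conditions of the theorem to a flat cogenerator. -/

namespace RightComodule

/-- `M □ (D ⊗ W) = (W ⊗ M) □ D`, and the latter is `W ⊗ M`, embedded by its coaction. -/
theorem mem_cotensor_regular (M : RightComodule R D) {W : Type u} [AddCommGroup W] [Module R W]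
    (z : (W ⊗[R] M.carrier) ⊗[R] D) :
    tensorRotate R W M.carrier D z ∈ cotensor M ((LeftComodule.regular R D).tensor W) ↔
      ∃ t, (M.tensor W).coact t = z := by
  refine (tensorRotate_mem_cotensor M (LeftComodule.regular R D) z).trans ?_
  rw [mem_cotensor]
  constructor
  · intro h
    exact ⟨_, (eq_coact_of_coact_rTensor_eq (M.tensor W) z
      ((TensorProduct.assoc R (W ⊗[R] M.carrier) D D).eq_symm_apply.2 h)).symm⟩
  · rintro ⟨t, rfl⟩
    exact (M.tensor W).coassoc_apply t

/-- `W ⊗ X = X □ (D ⊗ W)` naturally in `W`, so `- ⊗ X` is the composite of the exact functors `D ⊗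
-` and `X □ -`. -/
theorem IsCoflat.flat [Module.Flat R D] {X : RightComodule R D} (hX : X.IsCoflat) :
    Module.Flat R X.carrier := by
  rw [Module.Flat.iff_rTensor_preserves_injective_linearMap]
  intro W W' _ _ _ _ f hf
  let L := (LeftComodule.regular R D).tensorFunctor
  let F : ModuleCat.of R W ⟶ ModuleCat.of R W' := ModuleCat.ofHom f
  let G : ModuleCat.of R W' ⟶ ModuleCat.of R (W' ⧸ LinearMap.range f) :=
    ModuleCat.ofHom (LinearMap.range f).mkQ
  have hinj := (hX (L.map F) (L.map G) (Module.Flat.lTensor_preserves_injective_linearMap f hf)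
    (Module.Flat.lTensor_exact D (LinearMap.exact_map_mkQ_range f))
    (LinearMap.lTensor_surjective D (Submodule.mkQ_surjective _))).1
  have key : ∀ z : (W ⊗[R] X.carrier) ⊗[R] D,
      (f.lTensor D).lTensor X.carrier (tensorRotate R W X.carrier D z) =
        tensorRotate R W' X.carrier D ((f.rTensor X.carrier).rTensor D z) := by
    intro z
    have : (f.lTensor D).lTensor X.carrier ∘ₗ (tensorRotate R W X.carrier D).toLinearMap =
      (tensorRotate R W' X.carrier D).toLinearMap ∘ₗ (f.rTensor X.carrier).rTensor D := by
      ext; simp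
    exact LinearMap.congr_fun this z
  intro a b hab
  apply (X.tensor W).coact_injective
  apply (tensorRotate R W X.carrier D).injective
  have h : (⟨_, (X.mem_cotensor_regular _).2 ⟨a, rfl⟩⟩ :
      cotensor X ((LeftComodule.regular R D).tensor W)) =
      ⟨_, (X.mem_cotensor_regular _).2 ⟨b, rfl⟩⟩ := by
    apply hinj
    apply Subtype.ext
    refine (key _).trans (Eq.trans ?_ (key _).symm)
    have hc : ∀ t, (f.rTensor X.carrier).rTensor D ((X.tensor W).coact t) =
      (X.tensor W').coact (f.rTensor X.carrier t) := fun t =>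
        (LinearMap.congr_fun (X.tensor_colinear f) t).symm
    rw [hc, hc, hab]
  exact congrArg Subtype.val h

namespace IsCohom

variable {X : Bicomodule R C D} {Y : Type u} [AddCommGroup Y] [Module R Y]
  {δ : regular R D ⟶ X.right.tensor Y}

/-- The universal map `D → h(X, D) ⊗ X` as a left colinear map. -/
noncomputable abbrev unitLeftHom (hδ : IsCohom δ) :
    LeftComodule.regular R D ⟶ hδ.leftComodule.tensor X.carrier where
  hom := δ.hom
  colinear := by
    ext d
    exact (TensorProduct.assoc R D Y X.carrier).symm_apply_eq.1 (hδ.leftCoact_apply d).symm |>.symm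

/-- The counit splits the coaction, so injectivity survives tensoring with any `W`. -/
theorem lcoact_lTensor_injective (X : Bicomodule R C D) (W : Type u) [AddCommGroup W]
    [Module R W] : Function.Injective (X.lcoact.lTensor W) := by
  have h : ((TensorProduct.lid R X.carrier).toLinearMap ∘ₗ
      (Coalgebra.counit (R := R) (A := C)).rTensor X.carrier).lTensor W ∘ₗ
        X.lcoact.lTensor W = LinearMap.id := by
    rw [← LinearMap.lTensor_comp, LinearMap.comp_assoc, X.lcounit]
    ext; simp
  exact Function.LeftInverse.injective (LinearMap.congr_fun h)

/-- Faithful functors reflect monomorphisms, so it is enough that `X □ -` sends the left colinear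
map `φ : D ⊗ W → Y ⊗ (X ⊗ W)` to an injection. Under `X □ (D ⊗ W) = W ⊗ X` that image is, up to
rearranging factors, the `C`-coaction of `X` followed by the embedding of `h(X, W ⊗ X)` in `(W ⊗ X)
⊗ Y`, tensored with `X`. -/
theorem lTensor_unit_injective [Module.Flat R D] (hC : IsCohom X.lcoactHom) (hδ : IsCohom δ)
    (hX : X.right.IsInjector) (hcoflat : X.right.IsFaithfullyCoflat) (W : Type u)
    [AddCommGroup W] [Module R W] : Function.Injective (δ.hom.lTensor W) := by
  have := hcoflat.2
  have hflat : Module.Flat R X.carrier := hcoflat.1.flat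
  let φ := LeftComodule.tensorMap W hδ.unitLeftHom ≫
    hδ.leftComodule.tensorAssoc W X.carrier
  have hmap : Function.Injective (X.right.cotensorFunctor.map φ).hom := by
    rw [injective_iff_map_eq_zero]
    rintro ⟨z, hz⟩ h0
    obtain ⟨z, rfl⟩ := (tensorRotate R W X.carrier D).surjective z
    obtain ⟨m, rfl⟩ := (X.right.mem_cotensor_regular z).1 hz
    have h1 : φ.hom.lTensor X.carrier (tensorRotate R W X.carrier D
        ((X.right.tensor W).coact m)) = 0 := congrArg Subtype.val h0
    have h2 : (TensorProduct.assoc R Y X.carrier W).toLinearMap.lTensor X.carrier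
        (tensorRotate R W X.carrier (Y ⊗[R] X.carrier)
          (δ.hom.lTensor (W ⊗[R] X.carrier) ((X.right.tensor W).coact m))) = 0 := by
      refine Eq.trans ?_ h1
      generalize (X.right.tensor W).coact m = z
      have : (TensorProduct.assoc R Y X.carrier W).toLinearMap.lTensor X.carrier ∘ₗ
          (tensorRotate R W X.carrier (Y ⊗[R] X.carrier)).toLinearMap ∘ₗ
            (δ.hom : D →ₗ[R] Y ⊗[R] X.carrier).lTensor (W ⊗[R] X.carrier) =
          φ.hom.lTensor X.carrier ∘ₗ (tensorRotate R W X.carrier D).toLinearMap := by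
        ext w x d
        rfl
      exact LinearMap.congr_fun this z
    have h3 : δ.hom.lTensor (W ⊗[R] X.carrier) ((X.right.tensor W).coact m) = 0 := by
      have hinj : Function.Injective
          ((TensorProduct.assoc R Y X.carrier W).toLinearMap.lTensor X.carrier) :=
        (LinearEquiv.lTensor X.carrier (TensorProduct.assoc R Y X.carrier W)).injective
      exact (LinearEquiv.map_eq_zero_iff _).1 ((map_eq_zero_iff _ hinj).1 h2)
    -- By naturality of the universal maps, `δ` after the `D`-coaction equals the embedding of `h(X,
    -- W ⊗ X)` after the `C`-coaction. The embedding stays injective after tensoring with the flat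
    -- module `X`, so the `C`-coaction of `m` vanishes.
    have h4 := hδ.toCotensor_apply (hC.tensor W) m
    rw [h3, map_zero] at h4
    have h5 : Function.Injective ((hδ.toCotensor (hC.tensor W)).rTensor X.carrier) :=
      Module.Flat.rTensor_preserves_injective_linearMap _
        (hδ.toCotensor_injective hX (hC.tensor W))
    have h6 : X.lcoact.lTensor W m = 0 :=
      (LinearEquiv.map_eq_zero_iff (TensorProduct.assoc R W C X.carrier).symm).1
        ((map_eq_zero_iff _ h5).1 h4)
    have h7 : m = 0 := (map_eq_zero_iff _ (lcoact_lTensor_injective X W)).1 h6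
    apply Subtype.ext
    change tensorRotate R W X.carrier D ((X.right.tensor W).coact m) = 0
    rw [h7, map_zero, map_zero]
  have hmono : Mono (X.right.cotensorFunctor.map φ) := (ModuleCat.mono_iff_injective _).2 hmap
  have : Mono φ := X.right.cotensorFunctor.mono_of_mono_map hmono
  have hφ := LeftComodule.injective_of_mono φ
  refine (LinearMap.lTensor_inj_iff_rTensor_inj (M := W) (δ.hom : D →ₗ[R] Y ⊗[R] X.carrier)).2 ?_
  intro a b hab
  exact hφ (congrArg (TensorProduct.assoc R Y X.carrier W) hab)

/-- Cogeneration: the coaction embeds `M` in `M ⊗ D`, and `δ` embeds `M ⊗ D` in `(M ⊗ Y) ⊗ X`. -/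
theorem isFlatCogenerator [Module.Flat R D] (hC : IsCohom X.lcoactHom)
    [hq : X.right.IsQuasiFinite] (hX : X.right.IsInjector)
    (hcoflat : X.right.IsFaithfullyCoflat) : X.right.IsFlatCogenerator where
  isQuasiFinite := hq
  isInjector := hX
  flat := hcoflat.1.flat
  cogenerates M := by
    let δ := X.right.cohomUnit (regular R D)
    refine ⟨ModuleCat.of R (M.carrier ⊗[R] X.right.cohom.obj (regular R D)),
      M.coactHom ≫ tensorMap M.carrier δ ≫ X.right.tensorAssoc M.carrier _, ?_⟩
    have hδ : IsCohom δ := isCohom_unit X.right (regular R D)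
    exact (TensorProduct.assoc R M.carrier (X.right.cohom.obj (regular R D))
      X.carrier).symm.injective.comp
      ((hC.lTensor_unit_injective hδ hX hcoflat M.carrier).comp M.coact_injective)

end IsCohom

/-- A comodule that satisfies the conditions of the Morita-Takeuchi theorem is the underlying
right comodule of a bicomodule that realizes `C` as `h(X, X)`, and it is a flat cogenerator. -/
theorem IsMoritaTakeuchi.exists_bicomodule [Module.Flat R D] {X : RightComodule R D}
    (hX : X.IsMoritaTakeuchi C) : ∃ B : Bicomodule R C D,
      IsCohom B.lcoactHom ∧ B.right.IsFlatCogenerator := by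
  obtain ⟨B, rfl, hC⟩ := RightComodule.exists_bicomodule hX
  obtain ⟨hq, hcoflat, hinj, -⟩ := hX
  exact ⟨B, hC, hC.isFlatCogenerator hinj hcoflat⟩

end RightComodule

/-! ### Linear equivalences commute with `W ⊗ -`. -/

namespace RightComodule

section Copower

variable {M N P : RightComodule R D} {W W' : Type u} [AddCommGroup W] [Module R W]
  [AddCommGroup W'] [Module R W']

theorem inclTensor_add (M : RightComodule R D) (v w : W) :
    M.inclTensor (v + w) = M.inclTensor v + M.inclTensor w :=
  hom_ext (map_add _ v w)

theorem inclTensor_smul (M : RightComodule R D) (r : R) (w : W) :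
    M.inclTensor (r • w) = r • M.inclTensor w :=
  hom_ext (map_smul _ r w)

/-- Uniqueness half of `Hom(W ⊗ M, N) = Hom_R(W, Hom(M, N))`. This property uses only the `R`-linear
category, which is why equivalences respect `W ⊗ M`. -/
theorem tensor_hom_ext {f g : M.tensor W ⟶ N}
    (h : ∀ w, M.inclTensor w ≫ f = M.inclTensor w ≫ g) : f = g := by
  apply hom_ext
  apply TensorProduct.ext'
  intro w m
  exact LinearMap.congr_fun (congrArg Hom.hom (h w)) m

/-- The colinear map `W ⊗ M → N` given by a linear family of colinear maps `M → N`. -/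
def tensorDesc (k : W →ₗ[R] (M ⟶ N)) : M.tensor W ⟶ N where
  hom := TensorProduct.lift
    { toFun := fun w => (k w).hom
      map_add' := fun a b => by rw [map_add, add_hom]
      map_smul' := fun r a => by rw [map_smul, smul_hom, RingHom.id_apply] }
  colinear := by
    ext w m
    change N.coact ((k w).hom m) = _
    rw [colinear_apply]
    change _ = LinearMap.rTensor D _ ((TensorProduct.assoc R W M.carrier D).symm (w ⊗ₜ M.coact m))
    induction M.coact m with
    | zero => simp
    | add a b ha hb => simp only [TensorProduct.tmul_add, map_add, ha, hb]
    | tmul a d => rfl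

@[simp]
theorem inclTensor_tensorDesc (k : W →ₗ[R] (M ⟶ N)) (w : W) :
    M.inclTensor w ≫ tensorDesc k = k w := rfl

theorem inclTensor_tensorHom (f : W →ₗ[R] W') (w : W) :
    M.inclTensor w ≫ M.tensorHom f = M.inclTensor (f w) := rfl

theorem inclTensor_tensorMap (f : M ⟶ N) (w : W) :
    M.inclTensor w ≫ tensorMap W f = f ≫ N.inclTensor w := rfl

theorem inclTensor_tensorAssoc (v : W) (w : W') :
    M.inclTensor w ≫ (M.tensor W').inclTensor v ≫ M.tensorAssoc W W' =
      M.inclTensor (v ⊗ₜ[R] w) := rfl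

end Copower

section Comparison

variable (F : RightComodule R C ⥤ RightComodule R D) [F.Additive] [F.Linear R]
  (M N : RightComodule R C) (W W' : Type u) [AddCommGroup W] [Module R W]
  [AddCommGroup W'] [Module R W']

/-- The canonical map `W ⊗ F M → F (W ⊗ M)` for a linear functor `F`. -/
def comparison : (F.obj M).tensor W ⟶ F.obj (M.tensor W) :=
  tensorDesc
    { toFun := fun w => F.map (M.inclTensor w)
      map_add' := fun a b => by rw [inclTensor_add, F.map_add]
      map_smul' := fun r a => by rw [inclTensor_smul, F.map_smul, RingHom.id_apply] }

theorem inclTensor_comparison (w : W) :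
    (F.obj M).inclTensor w ≫ comparison F M W = F.map (M.inclTensor w) := rfl

variable {M N W W'}

theorem comparison_tensorHom (f : W →ₗ[R] W') :
    (F.obj M).tensorHom f ≫ comparison F M W' =
      comparison F M W ≫ F.map (M.tensorHom f) := by
  apply tensor_hom_ext
  intro w
  rw [← Category.assoc, ← Category.assoc, inclTensor_tensorHom, inclTensor_comparison,
    inclTensor_comparison, ← F.map_comp, inclTensor_tensorHom]

theorem comparison_tensorMap (f : M ⟶ N) :
    tensorMap W (F.map f) ≫ comparison F N W = comparison F M W ≫ F.map (tensorMap W f) := by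
  apply tensor_hom_ext
  intro w
  rw [← Category.assoc, ← Category.assoc, inclTensor_tensorMap, Category.assoc,
    inclTensor_comparison, inclTensor_comparison, ← F.map_comp, ← F.map_comp,
    inclTensor_tensorMap]

theorem tensorAssoc_comparison :
    (F.obj M).tensorAssoc W W' ≫ comparison F M (W ⊗[R] W') =
      tensorMap W (comparison F M W') ≫ comparison F (M.tensor W') W ≫
        F.map (M.tensorAssoc W W') := by
  apply tensor_hom_ext
  intro v
  apply tensor_hom_ext
  intro w
  have h1 : (F.obj M).inclTensor w ≫ ((F.obj M).tensor W').inclTensor v ≫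
      (F.obj M).tensorAssoc W W' ≫ comparison F M (W ⊗[R] W') =
      F.map (M.inclTensor (v ⊗ₜ[R] w)) := rfl
  have h2 : (F.obj M).inclTensor w ≫ ((F.obj M).tensor W').inclTensor v ≫
      tensorMap W (comparison F M W') ≫ comparison F (M.tensor W') W ≫
        F.map (M.tensorAssoc W W') = F.map (M.inclTensor w) ≫
          F.map ((M.tensor W').inclTensor v) ≫ F.map (M.tensorAssoc W W') := rfl
  rw [h1, h2, ← F.map_comp, ← F.map_comp, inclTensor_tensorAssoc]

variable (M W)

/-- Both sides represent linear families `W → Hom(F M, -)`; the inverse is built by pulling the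
family of inclusions back along `F`. -/
theorem isIso_comparison [F.IsEquivalence] : IsIso (comparison F M W) := by
  let e := F.objObjPreimageIso ((F.obj M).tensor W)
  let k : W →ₗ[R] (M ⟶ F.objPreimage ((F.obj M).tensor W)) :=
    { toFun := fun w => F.preimage ((F.obj M).inclTensor w ≫ e.inv)
      map_add' := fun a b => F.map_injective (by
        rw [F.map_add, F.map_preimage, F.map_preimage, F.map_preimage, inclTensor_add,
          Preadditive.add_comp])
      map_smul' := fun r a => F.map_injective (by
        rw [RingHom.id_apply, F.map_smul, F.map_preimage, F.map_preimage, inclTensor_smul,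
          Linear.smul_comp]) }
  have hk : ∀ w, F.map (k w) = (F.obj M).inclTensor w ≫ e.inv := fun w => F.map_preimage _
  let g : M.tensor W ⟶ F.objPreimage ((F.obj M).tensor W) := tensorDesc k
  have hg : ∀ w, F.map (M.inclTensor w) ≫ F.map g = (F.obj M).inclTensor w ≫ e.inv := fun w => by
    rw [← F.map_comp, inclTensor_tensorDesc, hk]
  refine ⟨F.map g ≫ e.hom, ?_, ?_⟩
  · apply tensor_hom_ext
    intro w
    rw [← Category.assoc, ← Category.assoc, inclTensor_comparison, hg, Category.assoc,
      e.inv_hom_id]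
  -- Maps out of `F (W ⊗ M)` have no evident test family in the target, so the identity is pulled
  -- back to the source category, where `tensor_hom_ext` applies to `W ⊗ M`.
  · let h := F.preimage (e.hom ≫ comparison F M W)
    have hh : F.map h = e.hom ≫ comparison F M W := F.map_preimage _
    have hgh : g ≫ h = 𝟙 _ := by
      apply tensor_hom_ext
      intro w
      apply F.map_injective
      rw [F.map_comp, F.map_comp, hh, ← Category.assoc, hg, Category.assoc, e.inv_hom_id_assoc,
        inclTensor_comparison, Category.comp_id]
    rw [Category.assoc, ← hh, ← F.map_comp, hgh, F.map_id]

/-- The isomorphism `F (W ⊗ M) ≅ W ⊗ F M` for a linear equivalence `F`. -/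
noncomputable def comparisonIso [F.IsEquivalence] :
    (F.obj M).tensor W ≅ F.obj (M.tensor W) :=
  have := isIso_comparison F M W
  asIso (comparison F M W)

theorem comparisonIso_hom [F.IsEquivalence] : (comparisonIso F M W).hom = comparison F M W := rfl

/-- A linear equivalence commutes with the functors `- ⊗ M`. -/
noncomputable def tensorFunctorIso [F.IsEquivalence] :
    (F.obj M).tensorFunctor ≅ M.tensorFunctor ⋙ F :=
  NatIso.ofComponents (fun V => comparisonIso F M V)
    fun f => comparison_tensorHom F f.hom

end Comparison

/-! ### The regular comodule and the forgetful functor. -/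

section Regular

/-- The underlying module of a right comodule. -/
abbrev forget (R : Type u) [CommRing R] (C : Type u) [AddCommGroup C] [Module R C]
    [Coalgebra R C] : RightComodule R C ⥤ ModuleCat.{u} R where
  obj M := ModuleCat.of R M.carrier
  map f := ModuleCat.ofHom f.hom

/-- The linear map `W ⊗ C → W` given by the counit. -/
noncomputable def tensorCounit (R : Type u) [CommRing R] (C : Type u) [AddCommGroup C]
    [Module R C] [Coalgebra R C] (W : Type u) [AddCommGroup W] [Module R W] : W ⊗[R] C →ₗ[R] W :=
  (TensorProduct.rid R W).toLinearMap ∘ₗ (Coalgebra.counit (R := R) (A := C)).lTensor W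

theorem tensorCounit_coact (M : RightComodule R C) (m : M.carrier) :
    tensorCounit R C M.carrier (M.coact m) = m := by
  rw [tensorCounit, LinearMap.comp_apply, counit_apply]
  simp

theorem tensorCounit_rTensor_coact {W : Type u} [AddCommGroup W] [Module R W] (z : W ⊗[R] C) :
    (tensorCounit R C W).rTensor C (((regular R C).tensor W).coact z) = z := by
  have h : (tensorCounit R C W).rTensor C ∘ₗ
      (TensorProduct.assoc R W C C).symm.toLinearMap =
      ((TensorProduct.lid R C).toLinearMap ∘ₗ
        (Coalgebra.counit (R := R) (A := C)).rTensor C).lTensor W := by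
    ext w a b
    simp [tensorCounit, TensorProduct.smul_tmul]
  have h' : (tensorCounit R C W).rTensor C ∘ₗ ((regular R C).tensor W).coact =
      LinearMap.id := by
    rw [← LinearMap.comp_assoc, h, ← LinearMap.lTensor_comp, LinearMap.comp_assoc,
      Coalgebra.rTensor_counit_comp_comul]
    ext; simp
  exact LinearMap.congr_fun h' z

/-- The functor `- ⊗ C` is right adjoint to the forgetful functor. -/
noncomputable def forgetAdj (R : Type u) [CommRing R] (C : Type u) [AddCommGroup C]
    [Module R C] [Coalgebra R C] : forget R C ⊣ (regular R C).tensorFunctor :=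
  Adjunction.mkOfUnitCounit
    { unit := { app := fun M => M.coactHom, naturality := fun M N f => hom_ext f.colinear }
      counit :=
        { app := fun W => ModuleCat.ofHom (tensorCounit R C W)
          naturality := fun V W f => by
            apply ModuleCat.hom_ext
            change tensorCounit R C W ∘ₗ f.hom.rTensor C = f.hom ∘ₗ tensorCounit R C V
            ext v c
            simp [tensorCounit] }
      left_triangle := by
        ext M m
        exact M.tensorCounit_coact m
      right_triangle := by
        ext W z
        exact tensorCounit_rTensor_coact z }

instance : (regular R C).IsQuasiFinite := (forgetAdj R C).isRightAdjoint

/-- `- ⊗ C` is right adjoint to the forgetful functor, which preserves monomorphisms since `C` is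
flat. -/
theorem isInjector_regular [Module.Flat R C] : (regular R C).IsInjector := by
  have : (forget R C).PreservesMonomorphisms :=
    ⟨fun f _ => (ModuleCat.mono_iff_injective _).2 (injective_of_mono f)⟩
  exact Functor.preservesInjectiveObjects_of_adjunction_of_preservesMonomorphisms (forgetAdj R C)

/-- `h(C, -)` is the forgetful functor, so `h(C, C) = C` with the comultiplication as universal map.
-/
theorem isCohom_coactHom_regular : IsCohom (regular R C).coactHom where
  exists_lift {W} _ _ f := by
    refine ⟨tensorCounit R C W ∘ₗ f.hom, ?_⟩
    ext c
    rw [LinearMap.comp_apply, LinearMap.rTensor_comp_apply]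
    refine (congrArg _ (colinear_apply f c).symm).trans ?_
    exact tensorCounit_rTensor_coact _
  hom_ext {W} _ _ k k' h := by
    ext c
    have e := congrArg (tensorCounit R C W) (h c)
    have hk : ∀ k : C →ₗ[R] W, tensorCounit R C W (k.rTensor C (Coalgebra.comul (R := R) c)) =
        k c := by
      intro k
      have : tensorCounit R C W ∘ₗ k.rTensor C = k ∘ₗ tensorCounit R C C := by
        ext; simp [tensorCounit]
      refine (LinearMap.congr_fun this _).trans (congrArg k ?_)
      exact (regular R C).tensorCounit_coact c
    exact (hk k).symm.trans (e.trans (hk k'))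

end Regular

/-! ### The image of the regular comodule under a linear equivalence. -/

section Transport

variable (F : RightComodule R C ⥤ RightComodule R D) [F.Additive] [F.Linear R] [F.IsEquivalence]

/-- `F` is fully faithful and `F (W ⊗ X) = W ⊗ F X` naturally in `W`, so the universal property is
carried over. -/
theorem IsCohom.map_comparison {X M : RightComodule R C} {V : Type u} [AddCommGroup V]
    [Module R V] {η : M ⟶ X.tensor V} (h : IsCohom η) :
    IsCohom (F.map η ≫ (comparisonIso F X V).inv) := by
  have key : ∀ {W : Type u} [AddCommGroup W] [Module R W] (k : V →ₗ[R] W),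
      (F.map η ≫ (comparisonIso F X V).inv) ≫ (F.obj X).tensorHom k =
        F.map (η ≫ X.tensorHom k) ≫ (comparisonIso F X W).inv := by
    intro W _ _ k
    rw [Iso.eq_comp_inv, Category.assoc, Category.assoc, comparisonIso_hom, comparison_tensorHom,
      ← comparisonIso_hom, Iso.inv_hom_id_assoc, F.map_comp]
  constructor
  · intro W _ _ f
    let g : M ⟶ X.tensor W := F.preimage (f ≫ (comparisonIso F X W).hom)
    have hg : F.map g = f ≫ (comparisonIso F X W).hom := F.map_preimage _
    refine ⟨h.lift g, ?_⟩
    have e := key (h.lift g)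
    rw [h.lift_comp, hg, Category.assoc f, Iso.hom_inv_id, Category.comp_id] at e
    exact congrArg Hom.hom e
  · intro W _ _ k k' hk
    have e : (F.map η ≫ (comparisonIso F X V).inv) ≫ (F.obj X).tensorHom k =
        (F.map η ≫ (comparisonIso F X V).inv) ≫ (F.obj X).tensorHom k' :=
      RightComodule.hom_ext (LinearMap.ext hk)
    rw [key, key, Iso.cancel_iso_inv_right] at e
    have e' := F.map_injective e
    exact h.hom_ext (LinearMap.congr_fun (congrArg Hom.hom e'))

/-- Since `- ⊗ F C` is `- ⊗ C` followed by `F`, each property passes from `C` to `F C` once put in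
categorical terms. Flatness becomes preservation of monomorphisms, which are injections because `D`
is flat; cogeneration is the image under `F` of the embedding `N → N ⊗ C`. -/
theorem isFlatCogenerator_map_regular [Module.Flat R C] [Module.Flat R D] :
    (F.obj (regular R C)).IsFlatCogenerator := by
  let iso := tensorFunctorIso F (regular R C)
  have hmono : ∀ {V W : ModuleCat.{u} R} (f : V ⟶ W) [Mono f],
      Mono ((F.obj (regular R C)).tensorFunctor.map f) := by
    intro V W f hf
    have h1 : Mono ((regular R C).tensorFunctor.map f) :=
      mono_of_injective _ (Module.Flat.rTensor_preserves_injective_linearMap _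
        ((ModuleCat.mono_iff_injective f).1 hf))
    have h2 : Mono (F.map ((regular R C).tensorFunctor.map f)) := F.map_mono _
    have h3 : (F.obj (regular R C)).tensorFunctor.map f =
        iso.hom.app V ≫ F.map ((regular R C).tensorFunctor.map f) ≫ iso.inv.app W := by
      have := iso.hom.naturality f
      rw [← Category.assoc, ← Functor.comp_map, ← this, Category.assoc, Iso.hom_inv_id_app,
        Category.comp_id]
    rw [h3]
    infer_instance
  refine ⟨Functor.isRightAdjoint_of_iso iso.symm, ⟨fun {V} hV => ?_⟩, ?_, fun M => ?_⟩
  · have h1 : Injective ((regular R C).tensor V) := isInjector_regular.injective_obj hV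
    have h2 : Injective (F.obj ((regular R C).tensor V)) := F.injective_obj_of_injective h1
    exact Injective.of_iso (comparisonIso F (regular R C) V).symm h2
  · rw [Module.Flat.iff_rTensor_preserves_injective_linearMap]
    intro W W' _ _ _ _ f hf
    have : Mono (ModuleCat.ofHom f) := (ModuleCat.mono_iff_injective _).2 hf
    have := hmono (ModuleCat.ofHom f)
    exact injective_of_mono ((F.obj (regular R C)).tensorFunctor.map (ModuleCat.ofHom f))
  · let N := F.objPreimage M
    have : Mono N.coactHom := mono_of_injective _ N.coact_injective
    have : Mono (F.map N.coactHom) := F.map_mono _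
    let f : M ⟶ (F.obj (regular R C)).tensor N.carrier := (F.objObjPreimageIso M).inv ≫
      F.map N.coactHom ≫ (comparisonIso F (regular R C) N.carrier).inv
    have : Mono f := mono_comp _ _
    exact ⟨ModuleCat.of R N.carrier, f, injective_of_mono f⟩

/-- The image of `C` under a linear equivalence from right `C`-comodules to right `D`-comodules
is a `C`-`D`-bicomodule. -/
theorem exists_bicomodule_map_regular :
    ∃ B : Bicomodule R C D, B.right = F.obj (regular R C) ∧ IsCohom B.lcoactHom := by
  let X := F.obj (regular R C)
  let κ : X ⟶ X.tensor C :=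
    F.map (regular R C).coactHom ≫ (comparisonIso F (regular R C) C).inv
  have hκ : κ ≫ (comparisonIso F (regular R C) C).hom = F.map (regular R C).coactHom := by
    rw [Category.assoc, Iso.inv_hom_id, Category.comp_id]
  -- Coassociativity of `C` is an equation between colinear maps, so `F` may be applied to it;
  -- naturality of the comparison isomorphisms rewrites the result as coassociativity of `κ`.
  have hcomul : κ ≫ X.tensorHom Coalgebra.comul = κ ≫ tensorMap C κ ≫ X.tensorAssoc C C := by
    have e : (regular R C).coactHom ≫ (regular R C).tensorHom Coalgebra.comul =
        (regular R C).coactHom ≫ tensorMap C (regular R C).coactHom ≫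
          (regular R C).tensorAssoc C C := by
      ext c
      exact (TensorProduct.assoc R C C C).eq_symm_apply.2 ((regular R C).coassoc_apply c)
    rw [← cancel_mono (comparisonIso F (regular R C) (C ⊗[R] C)).hom]
    simp only [Category.assoc, comparisonIso_hom]
    rw [comparison_tensorHom, tensorAssoc_comparison, ← comparisonIso_hom, ← Category.assoc, hκ,
      ← F.map_comp, e]
    have h2 : tensorMap C κ ≫ tensorMap C (comparisonIso F (regular R C) C).hom =
        tensorMap C (F.map (regular R C).coactHom) := by
      rw [← hκ]
      exact hom_ext (LinearMap.lTensor_comp _ _ _).symm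
    rw [← Category.assoc (tensorMap C κ), h2, ← Category.assoc (tensorMap C _),
      comparison_tensorMap, Category.assoc, Category.assoc (comparison F _ C),
      ← comparisonIso_hom, Iso.inv_hom_id_assoc, F.map_comp, F.map_comp]
  have hcounit : κ ≫ X.tensorHom Coalgebra.counit = X.inclTensor (1 : R) := by
    have e : (regular R C).coactHom ≫ (regular R C).tensorHom Coalgebra.counit =
        (regular R C).inclTensor (1 : R) := hom_ext Coalgebra.rTensor_counit_comp_comul
    rw [← cancel_mono (comparisonIso F (regular R C) R).hom]
    simp only [Category.assoc, comparisonIso_hom]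
    rw [comparison_tensorHom, ← comparisonIso_hom, ← Category.assoc, hκ, ← F.map_comp, e]
    rfl
  refine ⟨{ carrier := X.carrier
            rcoact := X.coact
            rcoassoc := X.coassoc
            rcounit := X.counit
            lcoact := κ.hom
            lcoassoc := ?_
            lcounit := congrArg Hom.hom hcounit
            bicolinear := ?_ }, rfl, isCohom_coactHom_regular.map_comparison F⟩
  · ext x
    exact (TensorProduct.assoc R C C X.carrier).eq_symm_apply.1
      (LinearMap.congr_fun (congrArg Hom.hom hcomul) x)
  · ext x
    exact ((TensorProduct.assoc R C X.carrier D).symm_apply_eq.1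
      (LinearMap.congr_fun κ.colinear x)).symm

theorem Equivalent.exists_bicomodule [Module.Flat R C] [Module.Flat R D] (h : Equivalent R C D) :
    ∃ B : Bicomodule R C D, IsCohom B.lcoactHom ∧ B.right.IsFlatCogenerator := by
  obtain ⟨F, _, _, _⟩ := h
  obtain ⟨B, hB, hC⟩ := exists_bicomodule_map_regular F
  exact ⟨B, hC, hB ▸ isFlatCogenerator_map_regular F⟩

end Transport

end RightComodule

/-! ### Passing the conditions of the theorem to opposite coalgebras. -/

theorem IsAntiEquiv.comp {A B E : Type u} [AddCommGroup A] [Module R A] [Coalgebra R A]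
    [AddCommGroup B] [Module R B] [Coalgebra R B] [AddCommGroup E] [Module R E] [Coalgebra R E]
    {τ : B ≃ₗ[R] E} (h : IsAntiEquiv τ) (e : A ≃ₗc[R] B) :
    IsAntiEquiv (e.toLinearEquiv ≪≫ₗ τ) where
  comul a := by
    have he : TensorProduct.map e.toCoalgHom.toLinearMap e.toCoalgHom.toLinearMap
        (Coalgebra.comul (R := R) a) = Coalgebra.comul (R := R) (e a) :=
      LinearMap.congr_fun e.toCoalgHom.map_comp_comul a
    refine (h.comul (e a)).trans ?_
    rw [← he, flipTensor_lTensor, flipTensor_lTensor]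
    generalize Coalgebra.comul (R := R) a = z
    induction z with
    | zero => simp
    | add a b ha hb => simp only [map_add, ha, hb]
    | tmul a b => rfl
  counit a := (h.counit (e a)).trans (LinearMap.congr_fun e.toCoalgHom.counit_comp a)

theorem flipTensor_symm_apply {A B M : Type u} [AddCommGroup A] [Module R A] [AddCommGroup B]
    [Module R B] [AddCommGroup M] [Module R M] (t : A ≃ₗ[R] B) (z : M ⊗[R] A) :
    (flipTensor t.symm M).symm z = TensorProduct.comm R M B (t.toLinearMap.lTensor M z) := by
  rw [LinearEquiv.symm_apply_eq]
  induction z with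
  | zero => simp
  | add a b ha hb => simp only [map_add, ← ha, ← hb]
  | tmul m a => simp

/-- The isomorphism `N ⊗ (A ⊗ M) → M ⊗ (B ⊗ N)` given by an isomorphism `A → B`. -/
noncomputable def swapOuter {A B : Type u} [AddCommGroup A] [Module R A] [AddCommGroup B]
    [Module R B] (t : A ≃ₗ[R] B) (N M : Type u) [AddCommGroup N] [Module R N]
    [AddCommGroup M] [Module R M] : N ⊗[R] (A ⊗[R] M) ≃ₗ[R] M ⊗[R] (B ⊗[R] N) :=
  TensorProduct.comm R N (A ⊗[R] M) ≪≫ₗ LinearEquiv.rTensor N (flipTensor t M) ≪≫ₗ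
    TensorProduct.assoc R M B N

theorem swapOuter_tmul {A B M N : Type u} [AddCommGroup A] [Module R A] [AddCommGroup B]
    [Module R B] [AddCommGroup M] [Module R M] [AddCommGroup N] [Module R N] (t : A ≃ₗ[R] B)
    (n : N) (a : A) (m : M) : swapOuter t N M (n ⊗ₜ (a ⊗ₜ m)) = m ⊗ₜ (t a ⊗ₜ n) := rfl

namespace LeftComodule

variable {D' : Type u} [AddCommGroup D'] [Module R D'] [Coalgebra R D'] {σ : D ≃ₗ[R] D'}
  (hσ : IsAntiEquiv σ)

/-- The isomorphism between the right comodules given by `Y ⊗ W` and `W ⊗ Y`. -/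
noncomputable def flipTensorIso (Y : LeftComodule R D) (W : Type u) [AddCommGroup W]
    [Module R W] : (Y.tensor W).flip hσ ≅ (Y.flip hσ).tensor W :=
  RightComodule.isoOfBijective
    { hom := (TensorProduct.comm R Y.carrier W).toLinearMap
      colinear := by
        ext y w
        change (TensorProduct.assoc R W Y.carrier D').symm
          (w ⊗ₜ flipTensor σ Y.carrier (Y.coact y)) =
          (TensorProduct.comm R Y.carrier W).toLinearMap.rTensor D'
            (flipTensor σ (Y.carrier ⊗[R] W)
              (TensorProduct.assoc R D Y.carrier W (Y.coact y ⊗ₜ w)))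
        induction Y.coact y with
        | zero => simp
        | add a b ha hb =>
          simp only [TensorProduct.tmul_add, TensorProduct.add_tmul, map_add, ha, hb]
        | tmul d y => simp }
    (TensorProduct.comm R Y.carrier W).bijective

/-- The functors `Y ⊗ -` and `- ⊗ Y` correspond to each other. -/
noncomputable def tensorFunctorFlipIso (Y : LeftComodule R D) :
    Y.tensorFunctor ⋙ flipFunctor hσ ≅ (Y.flip hσ).tensorFunctor :=
  NatIso.ofComponents (fun W => Y.flipTensorIso hσ W) fun {V W} f => by
    apply RightComodule.hom_ext
    change (TensorProduct.comm R Y.carrier W).toLinearMap ∘ₗ f.hom.lTensor Y.carrier =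
      f.hom.rTensor Y.carrier ∘ₗ (TensorProduct.comm R Y.carrier V).toLinearMap
    ext y v
    simp

/-- Exchanging the outer factors interchanges the two terms of the defining difference. This
accounts for the sign, and the kernels correspond. -/
theorem swapOuter_cotensorMap (Y : LeftComodule R D) (N : LeftComodule R D')
    (z : N.carrier ⊗[R] Y.carrier) :
    swapOuter σ N.carrier Y.carrier (cotensorMap (N.flip hσ.symm) Y z) =
      -cotensorMap (Y.flip hσ) N (TensorProduct.comm R N.carrier Y.carrier z) := by
  induction z with
  | zero => simp
  | add a b ha hb => simp only [map_add, ha, hb, neg_add]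
  | tmul n y =>
    have h1 : ∀ w : D' ⊗[R] N.carrier, swapOuter σ N.carrier Y.carrier
        (TensorProduct.assoc R N.carrier D Y.carrier (flipTensor σ.symm N.carrier w ⊗ₜ y)) =
          y ⊗ₜ w := by
      intro w
      induction w with
      | zero => simp
      | add a b ha hb => simp only [map_add, TensorProduct.add_tmul, TensorProduct.tmul_add, ha, hb]
      | tmul d n => simp [swapOuter_tmul]
    change swapOuter σ N.carrier Y.carrier (TensorProduct.assoc R N.carrier D Y.carrier
        (flipTensor σ.symm N.carrier (N.coact n) ⊗ₜ y) - n ⊗ₜ Y.coact y) =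
      -(TensorProduct.assoc R Y.carrier D' N.carrier
        (flipTensor σ Y.carrier (Y.coact y) ⊗ₜ n) - y ⊗ₜ N.coact n)
    rw [map_sub, h1, neg_sub]
    rfl

/-- The isomorphism between the cotensor products `N □ Y` and `Y □ N`. -/
noncomputable def cotensorFlipEquiv (Y : LeftComodule R D) (N : LeftComodule R D') :
    cotensor (N.flip hσ.symm) Y ≃ₗ[R] cotensor (Y.flip hσ) N :=
  (TensorProduct.comm R N.carrier Y.carrier).ofSubmodules _ _ (by
    ext z
    obtain ⟨z, rfl⟩ := (TensorProduct.comm R N.carrier Y.carrier).surjective z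
    rw [Submodule.mem_map_equiv, LinearEquiv.symm_apply_apply, cotensor, cotensor,
      LinearMap.mem_ker, LinearMap.mem_ker,
      ← LinearEquiv.map_eq_zero_iff (swapOuter σ N.carrier Y.carrier), swapOuter_cotensorMap,
      neg_eq_zero])

theorem cotensorFlipEquiv_naturality (Y : LeftComodule R D) {N N' : LeftComodule R D'}
    (f : N ⟶ N') (z : cotensor (N.flip hσ.symm) Y) :
    ((Y.flip hσ).cotensorFunctor.map f).hom (Y.cotensorFlipEquiv hσ N z) =
      Y.cotensorFlipEquiv hσ N'
        ((Y.cotensorFunctor.map ((flipFunctor hσ.symm).map f)).hom z) := by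
  apply Subtype.ext
  have : f.hom.lTensor Y.carrier ∘ₗ (TensorProduct.comm R N.carrier Y.carrier).toLinearMap =
      (TensorProduct.comm R N'.carrier Y.carrier).toLinearMap ∘ₗ f.hom.rTensor Y.carrier := by
    ext; simp
  exact LinearMap.congr_fun this z.1

/-- The functors `- □ Y` and `Y □ -` correspond to each other. -/
noncomputable def cotensorFunctorFlipIso (Y : LeftComodule R D) :
    flipFunctor hσ.symm ⋙ Y.cotensorFunctor ≅ (Y.flip hσ).cotensorFunctor :=
  NatIso.ofComponents (fun N => (Y.cotensorFlipEquiv hσ N).toModuleIso) fun {N N'} f => by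
    ext z
    exact (Y.cotensorFlipEquiv_naturality hσ f z).symm

theorem IsCoflat.flip {Y : LeftComodule R D} (hY : Y.IsCoflat) : (Y.flip hσ).IsCoflat := by
  intro N₁ N₂ N₃ f g hf hfg hg
  obtain ⟨h1, h2, h3⟩ := hY ((flipFunctor hσ.symm).map f) ((flipFunctor hσ.symm).map g) hf hfg hg
  let e := Y.cotensorFlipEquiv hσ
  have he := fun {N N' : LeftComodule R D'} => Y.cotensorFlipEquiv_naturality hσ (N := N) (N' := N')
  refine ⟨fun a b hab => ?_, fun z => ⟨fun hz => ?_, ?_⟩, fun z => ?_⟩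
  · obtain ⟨a, rfl⟩ := (e N₁).surjective a
    obtain ⟨b, rfl⟩ := (e N₁).surjective b
    exact congrArg (e N₁) (h1 ((e N₂).injective ((he f a).symm.trans (hab.trans (he f b)))))
  · obtain ⟨z, rfl⟩ := (e N₂).surjective z
    obtain ⟨y, hy⟩ := (h2 z).1 ((e N₃).injective (((he g z).symm.trans hz).trans
      (map_zero (e N₃)).symm))
    exact ⟨e N₁ y, (he f y).trans (congrArg (e N₂) hy)⟩
  · rintro ⟨y, rfl⟩
    obtain ⟨y, rfl⟩ := (e N₁).surjective y
    exact (congrArg _ (he f y)).trans ((he g _).trans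
      ((congrArg (e N₃) (h2.apply_apply_eq_zero y)).trans (map_zero (e N₃))))
  · obtain ⟨z, rfl⟩ := (e N₃).surjective z
    obtain ⟨y, hy⟩ := h3 z
    exact ⟨e N₂ y, (he g y).trans (congrArg (e N₃) hy)⟩

/-- A left comodule as a right comodule over its coendomorphism coalgebra. -/
noncomputable abbrev coendComodule (Y : LeftComodule R D) [Y.IsQuasiFinite] :
    RightComodule R Y.Coend where
  carrier := Y.carrier
  coact := Y.coendCoact
  coassoc := LinearMap.ext fun y => (Y.coendComul_spec y).symm
  counit := LinearMap.ext Y.coendCounit_spec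

/-- Flipping leaves the module `h(Y, Y)` and its universal map unchanged up to a swap of factors,
and that swap reverses the comultiplication. -/
theorem nonempty_coend_flip {E E' : Type u} [AddCommGroup E] [Module R E] [Coalgebra R E]
    [AddCommGroup E'] [Module R E'] [Coalgebra R E'] {τ : E ≃ₗ[R] E'} (hτ : IsAntiEquiv τ)
    (Y : LeftComodule R D) [Y.IsQuasiFinite] [(Y.flip hσ).IsQuasiFinite]
    (e : Y.Coend ≃ₗc[R] E) : Nonempty ((Y.flip hσ).Coend ≃ₗc[R] E') := by
  have ht := hτ.comp e
  set t := e.toLinearEquiv ≪≫ₗ τ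
  -- `Y` is a right comodule over `e(Y)`, hence a left comodule over the opposite coalgebra `E'`.
  -- Its axioms are the equations that `κ` must satisfy.
  let L : LeftComodule R E' := Y.coendComodule.unflip ht.symm
  let T : ModuleCat.of R Y.Coend ⟶ ModuleCat.of R E' := ModuleCat.ofHom t.toLinearMap
  let κ : Y.flip hσ ⟶ (Y.flip hσ).tensor E' :=
    (flipFunctor hσ).map (Y.coendUnit ≫ Y.tensorFunctor.map T) ≫ (Y.flipTensorIso hσ E').hom
  have hκL : ∀ y, κ.hom y = L.coact y := fun y => (flipTensor_symm_apply t (Y.coendCoact y)).symm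
  have hcomm : ∀ {V W : Type u} [AddCommGroup V] [Module R V] [AddCommGroup W] [Module R W]
      (k : V →ₗ[R] W) (z : Y.carrier ⊗[R] V), k.rTensor Y.carrier
        (TensorProduct.comm R Y.carrier V z) = TensorProduct.comm R Y.carrier W
          (k.lTensor Y.carrier z) := by
    intro V W _ _ _ _ k z
    have : k.rTensor Y.carrier ∘ₗ (TensorProduct.comm R Y.carrier V).toLinearMap =
      (TensorProduct.comm R Y.carrier W).toLinearMap ∘ₗ k.lTensor Y.carrier := by ext; simp
    exact LinearMap.congr_fun this z
  have hκ : ∀ {W : Type u} [AddCommGroup W] [Module R W] (k : E' →ₗ[R] W) (y : Y.carrier),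
      k.rTensor Y.carrier (κ.hom y) = TensorProduct.comm R Y.carrier W
        ((k ∘ₗ t.toLinearMap).lTensor Y.carrier (Y.coendCoact y)) := by
    intro W _ _ k y
    rw [LinearMap.lTensor_comp_apply]
    exact hcomm k (t.toLinearMap.lTensor Y.carrier (Y.coendCoact y))
  have hcohom : RightComodule.IsCohom κ := by
    constructor
    · intro W _ _ f
      let g : Y ⟶ Y.tensor W := (flipFunctor hσ).preimage (f ≫ (Y.flipTensorIso hσ W).inv)
      have hg : (flipFunctor hσ).map g = f ≫ (Y.flipTensorIso hσ W).inv :=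
        (flipFunctor hσ).map_preimage _
      refine ⟨Y.coendLift g ∘ₗ t.symm.toLinearMap, LinearMap.ext fun y => ?_⟩
      refine (hκ _ y).trans ?_
      rw [LinearMap.comp_assoc, LinearEquiv.symm_comp, LinearMap.comp_id]
      refine (congrArg _ (LinearMap.congr_fun (Y.coendLift_spec g) y)).trans ?_
      have h := (Iso.eq_comp_inv _).1 hg
      exact LinearMap.congr_fun (congrArg RightComodule.Hom.hom h) y
    · intro W _ _ k k' h
      refine LinearMap.cancel_right t.surjective |>.1 (Y.coend_hom_ext fun y => ?_)
      apply (TensorProduct.comm R Y.carrier W).injective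
      exact (hκ k y).symm.trans ((h y).trans (hκ k' y))
  refine hcohom.coendEquiv (fun y => ?_) (fun y => ?_)
  · have hκ' : κ.hom = L.coact := LinearMap.ext hκL
    rw [hκ']
    exact (TensorProduct.assoc R E' E' Y.carrier).eq_symm_apply.2 (L.coassoc_apply y)
  · rw [hκL]
    exact L.counit_apply y

theorem IsMoritaTakeuchi.flip {E E' : Type u} [AddCommGroup E] [Module R E] [Coalgebra R E]
    [AddCommGroup E'] [Module R E'] [Coalgebra R E'] {τ : E ≃ₗ[R] E'} (hτ : IsAntiEquiv τ)
    {Y : LeftComodule R D} (hY : Y.IsMoritaTakeuchi E) : (Y.flip hσ).IsMoritaTakeuchi E' := by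
  obtain ⟨hq, ⟨hcoflat, hfaith⟩, hinj, ⟨e⟩⟩ := hY
  have hq' : (Y.flip hσ).IsQuasiFinite :=
    Functor.isRightAdjoint_of_iso (Y.tensorFunctorFlipIso hσ)
  refine ⟨hq', ⟨hcoflat.flip hσ, Functor.Faithful.of_iso (Y.cotensorFunctorFlipIso hσ)⟩,
    ⟨fun {W} hW => ?_⟩, nonempty_coend_flip hσ hτ Y e⟩
  have h1 : Injective (Y.tensor W) := hinj.injective_obj hW
  have h2 : Injective ((flipFunctor hσ).obj (Y.tensor W)) :=
    (flipFunctor hσ).injective_obj_of_injective h1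
  exact Injective.of_iso (Y.flipTensorIso hσ W) h2

end LeftComodule

/-! ### The implications of the theorem. -/

section Equivalences

variable (R : Type u) [CommRing R] (C : Type u) [AddCommGroup C] [Module R C] [Coalgebra R C]
  (D : Type u) [AddCommGroup D] [Module R D] [Coalgebra R D] [Module.Flat R D]

theorem exists_right_of_equivalent [Module.Flat R C] (h : RightComodule.Equivalent R C D) :
    ∃ X : Bicomodule R C D, X.right.IsMoritaTakeuchi C := by
  obtain ⟨X, hC, hX⟩ := h.exists_bicomodule
  exact ⟨X, hC.isMoritaTakeuchi_right hX⟩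

theorem equivalent_of_isMoritaTakeuchi {X : RightComodule R D} (h : X.IsMoritaTakeuchi C) :
    RightComodule.Equivalent R C D := by
  obtain ⟨B, hC, hB⟩ := h.exists_bicomodule
  exact hB.equivalent hC

theorem exists_left_of_isMoritaTakeuchi {X : RightComodule R D} (h : X.IsMoritaTakeuchi C) :
    ∃ Y : Bicomodule R D C, Y.left.IsMoritaTakeuchi C := by
  obtain ⟨B, hC, hB⟩ := h.exists_bicomodule
  have := hB.isQuasiFinite
  have hδ := B.right.isCohom_unit (RightComodule.regular R D)
  exact ⟨hδ.bicomodule, hC.isMoritaTakeuchi_left hB hδ⟩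

/-- Over the co-opposite coalgebras `Y` becomes a right comodule with the same properties, to which
the right-handed implication applies. -/
theorem equivalent_of_left {Y : LeftComodule R D} (h : Y.IsMoritaTakeuchi C) :
    LeftComodule.Equivalent R C D := by
  have h' := h.flip (Cop.isAntiEquiv R D) (Cop.isAntiEquiv R C)
  exact LeftComodule.Equivalent.of_flip (Cop.isAntiEquiv R C) (Cop.isAntiEquiv R D)
    (equivalent_of_isMoritaTakeuchi R (Cop C) (Cop D) h')

/-- The sides are exchanged twice. Over the co-opposites the equivalence gives a right-handed `X`,
hence a left-handed `Y = h(X, -)` of the co-opposite of `D`; flipped back, `Y` is right-handed over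
`D`. -/
theorem exists_right_of_left_equivalent [Module.Flat R C] (h : LeftComodule.Equivalent R C D) :
    ∃ X : Bicomodule R C D, X.right.IsMoritaTakeuchi C := by
  have h1 : RightComodule.Equivalent R (Cop C) (Cop D) :=
    h.flip (Cop.isAntiEquiv R C) (Cop.isAntiEquiv R D)
  obtain ⟨X, hX⟩ := exists_right_of_equivalent R (Cop C) (Cop D) h1
  obtain ⟨Y, hY⟩ := exists_left_of_isMoritaTakeuchi R (Cop C) (Cop D) hX
  have h2 := hY.flip (Cop.isAntiEquiv R D).symm (Cop.isAntiEquiv R C).symm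
  -- The flip retains only the right `D`-comodule; the left `C`-coaction is recovered from the
  -- isomorphism of its coendomorphism coalgebra with `C`.
  obtain ⟨B, hC, hB⟩ := h2.exists_bicomodule
  exact ⟨B, hC.isMoritaTakeuchi_right hB⟩

end Equivalences

end MoritaTakeuchi

theorem theorem5 (R : Type u) [CommRing R]
    (C : Type u) [AddCommGroup C] [Module R C] [Coalgebra R C] [Module.Flat R C]
    (D : Type u) [AddCommGroup D] [Module R D] [Coalgebra R D] [Module.Flat R D] :
    List.TFAE [
      MoritaTakeuchi.RightComodule.Equivalent R C D,
      MoritaTakeuchi.LeftComodule.Equivalent R C D,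
      ∃ X : MoritaTakeuchi.Bicomodule R C D, X.right.IsMoritaTakeuchi C,
      ∃ X : MoritaTakeuchi.Bicomodule R C D, X.left.IsMoritaTakeuchi D,
      ∃ Y : MoritaTakeuchi.Bicomodule R D C, Y.right.IsMoritaTakeuchi D,
      ∃ Y : MoritaTakeuchi.Bicomodule R D C, Y.left.IsMoritaTakeuchi C] := by
  tfae_have 1 → 3 := MoritaTakeuchi.exists_right_of_equivalent R C D
  tfae_have 3 → 1 := fun ⟨_, hX⟩ => MoritaTakeuchi.equivalent_of_isMoritaTakeuchi R C D hX
  tfae_have 3 → 6 := fun ⟨_, hX⟩ => MoritaTakeuchi.exists_left_of_isMoritaTakeuchi R C D hX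
  tfae_have 6 → 2 := fun ⟨_, hY⟩ => MoritaTakeuchi.equivalent_of_left R C D hY
  tfae_have 2 → 3 := MoritaTakeuchi.exists_right_of_left_equivalent R C D
  -- Conditions 5 and 4 are conditions 3 and 6 with `C` and `D` exchanged, and condition 1 is
  -- symmetric.
  tfae_have 1 → 5 := fun h => MoritaTakeuchi.exists_right_of_equivalent R D C h.symm
  tfae_have 5 → 1 := fun ⟨_, hY⟩ =>
    (MoritaTakeuchi.equivalent_of_isMoritaTakeuchi R D C hY).symm
  tfae_have 5 → 4 := fun ⟨_, hY⟩ => MoritaTakeuchi.exists_left_of_isMoritaTakeuchi R D C hY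
  tfae_have 4 → 5 := fun ⟨_, hX⟩ => MoritaTakeuchi.exists_right_of_left_equivalent R D C
    (MoritaTakeuchi.equivalent_of_left R D C hX)
  tfae_finish
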